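/- Let $F$ be Thompson's group, i.e. the group, under composition $(fg)(t)=f(g(t))$, of all piecewise linear homeomorphisms of $[0,1]$ with finitely many breakpoints, all of which have dyadic rational coordinates, and with all slopes integral powers of $2$. Let $\mu\colon F\times F\to F$, $(f,g)\mapsto f*g$, be the homomorphism given by $(f*g)(t)=f(2t)/2$ for $0\le t\le 1/2$ and $(f*g)(t)=(g(2t-1)+1)/2$ for $1/2\le t\le 1$. Give $H_*(F)=\bigoplus_{n\ge 0}H_n(F,\mathbb Z)$ the product $H_p(F)\otimes H_q(F)\to H_{p+q}(F\times F)\xrightarrow{\mu_*}H_{p+q}(F)$, where the first map is the homology cross product. Let $\varepsilon\in H_0(F)=\mathbb Z$ be the canonical generator, let $x_0\in F$ be the element that maps $[0,\frac12],[\frac12,\frac34],[\frac34,1]$ affinely onto $[0,\frac14],[\frac14,\frac12],[\frac12,1]$, and let $\zeta\in H_1(F)=F/[F,F]$ be the class of $x_0$ or its negative. Then $H_*(F)$ is an associative ring, it has no identity element, and the following hold. 1. $H_*(F)$ is generated as a ring by $\varepsilon$ and $\zeta$, which satisfy $\varepsilon^2=\varepsilon$ and $\varepsilon\zeta=\zeta-\zeta\varepsilon$,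 and these are defining relations (in the category of associative rings not necessarily having an identity). For every $n\ge 1$, $H_n(F)$ is free abelian of rank $2$ with basis $\zeta^n,\ \zeta^n\varepsilon$. 2. Let $\alpha=\zeta\varepsilon$ and $\beta=\varepsilon\zeta$. Then $H_*(F)$ is generated as a ring by $\varepsilon,\alpha,\beta$, which satisfy $\varepsilon^2=\varepsilon$, $\varepsilon\alpha=\beta\varepsilon=0$, $\alpha\varepsilon=\alpha$, $\varepsilon\beta=\beta$, and these are defining relations. Moreover $\alpha^2=\beta^2=0$, and for every $n\ge 1$ the two alternating products $\alpha\beta\alpha\cdots$ and $\beta\alpha\beta\cdots$ with $n$ factors form a basis of $H_n(F)$. -/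

import Mathlib

open scoped unitInterval DirectSum

noncomputable section

/-! ### Integral group homology and its cross product -/

namespace IntegralHomology

open Finsupp

variable {α β G H : Type}

/-- Prepend the letter `x` to every word. -/
def pre (x : α) : (List α →₀ ℤ) →ₗ[ℤ] (List α →₀ ℤ) := Finsupp.lmapDomain ℤ ℤ (List.cons x)

theorem pre_single (x : α) (u : List α) (c : ℤ) :
    pre x (single u c) = single (x :: u) c := by simp [pre]

/-- The signed sum of all shuffles of the words `(g₁,1) ⋯ (g_p,1)` and `(1,h₁) ⋯ (1,h_q)`: a
shuffle begins either with `(g₁,1)` or with `(1,h₁)`, and in the second case the letter `(1,h₁)`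
has moved past `p` letters, which accounts for the sign `(-1) ^ p`. -/
def shuffle [One G] [One H] : List G → List H → (List (G × H) →₀ ℤ)
  | [], [] => single [] 1
  | g :: u, [] => pre (g, 1) (shuffle u [])
  | [], h :: v => pre (1, h) (shuffle [] v)
  | g :: u, h :: v => pre (g, 1) (shuffle u (h :: v)) +
      (-1 : ℤ) ^ (u.length + 1) • pre (1, h) (shuffle (g :: u) v)
  termination_by u v => u.length + v.length

/-- The linear extension of a map defined on words. -/
def lin {M : Type} [AddCommGroup M] (φ : List α → M) : (List α →₀ ℤ) →ₗ[ℤ] M :=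
  Finsupp.lsum ℤ fun u => LinearMap.toSpanSingleton ℤ _ (φ u)

theorem lin_single {M : Type} [AddCommGroup M] (φ : List α → M) (u : List α) (c : ℤ) :
    lin φ (single u c) = c • φ u := by simp [lin]

/-- The bilinear extension of a map defined on pairs of words. -/
def bilin {M : Type} [AddCommGroup M] (φ : List α → List β → M) :
    (List α →₀ ℤ) →ₗ[ℤ] (List β →₀ ℤ) →ₗ[ℤ] M :=
  lin fun u => lin (φ u)

theorem bilin_single {M : Type} [AddCommGroup M] (φ : List α → List β → M) (u v) (a b : ℤ) :
    bilin φ (single u a) (single v b) = (a * b) • φ u v := by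
  simp [bilin, lin_single, mul_smul]

theorem lin_ext {M : Type} [AddCommGroup M] {f g : (List α →₀ ℤ) →ₗ[ℤ] M}
    (h : ∀ u, f (single u 1) = g (single u 1)) : f = g :=
  Finsupp.lhom_ext' fun u => LinearMap.ext_ring (h u)

theorem bilin_ext {M : Type} [AddCommGroup M] {f g : (List α →₀ ℤ) →ₗ[ℤ] (List β →₀ ℤ) →ₗ[ℤ] M}
    (h : ∀ u v, f (single u 1) (single v 1) = g (single u 1) (single v 1)) : f = g :=
  lin_ext fun u => lin_ext fun v => h u v

/-- The signed sum of the staircase paths in a product of two simplices. -/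
def prism : List α → List β → (List (α × β) →₀ ℤ)
  | [], _ => 0
  | _ :: _, [] => 0
  | x :: s, y :: t => pre (x, y) (prism s (y :: t) + (-1 : ℤ) ^ s.length • prism (x :: s) t +
      if s = [] ∧ t = [] then single [] 1 else 0)
  termination_by u v => u.length + v.length

/-- The (augmented) boundary of a simplex given by its list of vertices. -/
def bdH : List α → (List α →₀ ℤ)
  | [] => 0
  | x :: s => single s 1 - pre x (bdH s)

theorem bdH_pre (x : α) (w : List α →₀ ℤ) : lin bdH (pre x w) = w - pre x (lin bdH w) := by
  suffices lin bdH ∘ₗ pre x = LinearMap.id - pre x ∘ₗ lin bdH from LinearMap.congr_fun this w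
  exact lin_ext fun u => by simp [pre_single, lin_single, bdH]

/-- The sign operator. -/
def sgn : (List α →₀ ℤ) →ₗ[ℤ] (List α →₀ ℤ) :=
  lin fun u => single u ((-1) ^ u.length)

theorem sgn_pre (x : α) (w : List α →₀ ℤ) : sgn (pre x w) = - pre x (sgn w) := by
  suffices sgn ∘ₗ pre x = - (pre x ∘ₗ sgn) from LinearMap.congr_fun this w
  exact lin_ext fun u => by simp [pre_single, sgn, lin_single, pow_succ]

theorem sgn_sgn (w : List α →₀ ℤ) : sgn (sgn w) = w := by
  suffices sgn ∘ₗ sgn = (LinearMap.id : (List α →₀ ℤ) →ₗ[ℤ] _) from LinearMap.congr_fun this w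
  exact lin_ext fun u => by simp [sgn, lin_single, ← mul_pow]

theorem sgn_bdH (w : List α →₀ ℤ) : sgn (lin bdH w) = - lin bdH (sgn w) := by
  suffices sgn ∘ₗ lin bdH = - (lin bdH ∘ₗ (sgn (α := α))) from LinearMap.congr_fun this w
  refine lin_ext fun u => ?_
  induction u with
  | nil => simp [sgn, lin_single, bdH]
  | cons x s ih =>
    have e : single (x :: s) (1 : ℤ) = pre x (single s 1) := by simp [pre_single]
    simp only [LinearMap.comp_apply, LinearMap.neg_apply] at ih ⊢
    rw [e, bdH_pre, sgn_pre, map_neg, bdH_pre, map_sub, sgn_pre, ih]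
    simp

/-- The coefficient of the empty word. -/
def aug : (List α →₀ ℤ) →ₗ[ℤ] ℤ := Finsupp.lapply []

theorem aug_nil (c : ℤ) : aug (single ([] : List α) c) = c := by simp [aug]

theorem aug_cons (x : α) (u : List α) (c : ℤ) : aug (single (x :: u) c) = 0 := by simp [aug]

theorem aug_pre (x : α) (w : List α →₀ ℤ) : aug (pre x w) = 0 := by
  suffices aug ∘ₗ pre x = 0 from LinearMap.congr_fun this w
  exact lin_ext fun u => by simp [pre_single, aug_cons]

theorem aug_sgn (w : List α →₀ ℤ) : aug (sgn w) = aug w := by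
  suffices aug ∘ₗ sgn = aug (α := α) from LinearMap.congr_fun this w
  refine lin_ext fun u => ?_
  rcases u with _ | ⟨x, u⟩ <;> simp [aug_nil, aug_cons, sgn, lin_single]

theorem prism_pre (x : α) (y : β) (v : List α →₀ ℤ) (w : List β →₀ ℤ) :
    bilin prism (pre x v) (pre y w) = pre (x, y) (bilin prism v (pre y w) +
      bilin prism (pre x (sgn v)) w + (aug v * aug w) • single [] 1) := by
  suffices (bilin prism).compl₁₂ (pre x) (pre y) =
      ((bilin prism).compl₁₂ .id (pre y) + (bilin prism).compl₁₂ (pre x ∘ₗ sgn) .id +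
        ((LinearMap.mul ℤ ℤ).compl₁₂ aug aug).compr₂ (LinearMap.toSpanSingleton ℤ _
          (single ([] : List (α × β)) (1 : ℤ)))).compr₂ (pre (x, y)) by
    have h := LinearMap.congr_fun₂ this v w
    simp only [LinearMap.compl₁₂_apply, LinearMap.compr₂_apply, LinearMap.add_apply,
      LinearMap.toSpanSingleton_apply, LinearMap.comp_apply, LinearMap.id_apply,
      LinearMap.mul_apply'] at h
    exact h
  refine bilin_ext fun u v => ?_
  simp only [LinearMap.compl₁₂_apply, LinearMap.compr₂_apply, LinearMap.add_apply,
      LinearMap.toSpanSingleton_apply, LinearMap.comp_apply, LinearMap.id_apply,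
      LinearMap.mul_apply']
  rcases u with _ | ⟨a, u⟩ <;> rcases v with _ | ⟨b, v⟩ <;>
    simp [pre_single, bilin_single, aug_nil, aug_cons, sgn, lin_single, prism]

theorem bdH_prism_single (u : List α) (v : List β) :
    lin bdH (bilin prism (single u 1) (single v 1)) =
      bilin prism (lin bdH (single u 1)) (single v 1) -
      bilin prism (sgn (single u 1)) (lin bdH (single v 1)) +
      (aug (lin bdH (single u 1)) * aug (lin bdH (single v 1))) • single [] 1 := by
  induction hn : u.length + v.length using Nat.strong_induction_on generalizing u v with
  | _ n ih =>
  rcases u with _ | ⟨x, s⟩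
  · have h : ∀ w : List β →₀ ℤ, bilin prism (single ([] : List α) 1) w = 0 := fun w => by
      suffices bilin prism (single ([] : List α) 1) = (0 : (List β →₀ ℤ) →ₗ[ℤ] _) from
        LinearMap.congr_fun this w
      exact lin_ext fun v => by simp [bilin_single, prism]
    simp [h, sgn, lin_single, bdH]
  rcases v with _ | ⟨y, t⟩
  · have h : ∀ w : List α →₀ ℤ, bilin prism w (single ([] : List β) 1) = 0 := fun w => by
      suffices (bilin prism).flip (single ([] : List β) 1) = (0 : (List α →₀ ℤ) →ₗ[ℤ] _) from
        LinearMap.congr_fun this w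
      exact lin_ext fun v => by rcases v with _ | ⟨a, v⟩ <;> simp [bilin_single, prism]
    simp [h, lin_single, bdH]
  have hs := ih (s.length + (t.length + 1)) (by simp at hn; omega) s (y :: t) rfl
  have ht := ih (s.length + 1 + t.length) (by simp at hn; omega) (x :: s) t rfl
  have ex : ∀ c : ℤ, single (x :: s) c = pre x (single s c) := fun c => by simp [pre_single]
  have ey : ∀ c : ℤ, single (y :: t) c = pre y (single t c) := fun c => by simp [pre_single]
  have ht' : lin bdH (bilin prism (pre x (sgn (single s 1))) (single t 1)) =
      bilin prism (lin bdH (pre x (sgn (single s 1)))) (single t 1) -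
      bilin prism (sgn (pre x (sgn (single s 1)))) (lin bdH (single t 1)) +
      (aug (lin bdH (pre x (sgn (single s 1)))) * aug (lin bdH (single t 1))) • single [] 1 := by
    have e : pre x (sgn (single s 1)) = (-1 : ℤ) ^ s.length • single (x :: s) 1 := by
      simp [sgn, lin_single, pre_single]
    rw [e]
    simp only [map_smul, LinearMap.smul_apply, ht, smul_sub, smul_add, smul_smul, smul_eq_mul,
      mul_assoc]
  have e0 : lin bdH (single ([] : List (α × β)) 1) = 0 := by simp [lin_single, bdH]
  rw [ey] at hs
  rw [ex] at ht
  rw [ex, ey]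
  rw [prism_pre, bdH_pre]
  simp only [map_add, hs, ht', map_smul, bdH_pre, sgn_pre, sgn_sgn, map_sub, map_neg,
    LinearMap.sub_apply, LinearMap.neg_apply, prism_pre, aug_pre, aug_sgn, sgn_bdH, e0, map_zero,
    smul_zero]
  module


theorem bdH_prism (v : List α →₀ ℤ) (w : List β →₀ ℤ) :
    lin bdH (bilin prism v w) = bilin prism (lin bdH v) w - bilin prism (sgn v) (lin bdH w) +
      (aug (lin bdH v) * aug (lin bdH w)) • single [] 1 := by
  suffices (bilin prism).compr₂ (lin bdH) =
      (bilin prism).compl₁₂ (lin bdH) .id - (bilin prism).compl₁₂ sgn (lin bdH) +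
        ((LinearMap.mul ℤ ℤ).compl₁₂ (aug ∘ₗ lin bdH) (aug ∘ₗ lin bdH)).compr₂
          (LinearMap.toSpanSingleton ℤ _ (single ([] : List (α × β)) (1 : ℤ))) from
    LinearMap.congr_fun₂ this v w
  exact bilin_ext bdH_prism_single

/-! The bar complex, in terms of words -/

section
variable [Group G] [Group H]

/-- The last faces of `g :: u`. -/
def faces : G → List G → (List G →₀ ℤ)
  | _, [] => single [] 1
  | g, h :: v => single (g * h :: v) 1 - pre g (faces h v)

/-- The differential of the bar complex. -/
def bdB : List G → (List G →₀ ℤ)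
  | [] => 0
  | g :: u => single u 1 - faces g u

/-- From vertices to edges. -/
def edges : List G → List G
  | [] => []
  | [_] => []
  | x :: y :: s => x⁻¹ * y :: edges (y :: s)

/-- From edges to vertices. -/
def vertices (x : G) : List G → List G
  | [] => [x]
  | g :: u => x :: vertices (x * g) u

theorem edges_vertices (x : G) (u : List G) : edges (vertices x u) = u := by
  induction u generalizing x with
  | nil => rfl
  | cons g u ih =>
    rcases u with _ | ⟨h, u⟩
    · simp [vertices, edges]
    · have := ih (x * g)
      simp only [vertices] at this ⊢
      simp [edges, this]

/-- Linear extension of `edges`. -/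
def edgesL : (List G →₀ ℤ) →ₗ[ℤ] (List G →₀ ℤ) := lin fun
  | [] => 0
  | x :: s => single (edges (x :: s)) 1

theorem edgesL_pre_pre (x y : G) (w : List G →₀ ℤ) :
    edgesL (pre x (pre y w)) = pre (x⁻¹ * y) (edgesL (pre y w)) := by
  suffices edgesL ∘ₗ pre x ∘ₗ pre y = pre (x⁻¹ * y) ∘ₗ edgesL ∘ₗ pre y from
    LinearMap.congr_fun this w
  exact lin_ext fun u => by simp [pre_single, edgesL, lin_single, edges]

theorem edgesL_pre_bdH (x y : G) (s : List G) :
    edgesL (pre x (bdH (y :: s))) = faces (x⁻¹ * y) (edges (y :: s)) := by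
  induction s generalizing x y with
  | nil => simp [bdH, pre_single, edgesL, lin_single, edges, faces]
  | cons z s ih =>
    rw [bdH, map_sub, map_sub, edgesL_pre_pre, ih]
    simp [pre_single, edgesL, lin_single, edges, faces, mul_assoc]

theorem edgesL_bdH (w : List G →₀ ℤ) : edgesL (lin bdH w) = lin bdB (edgesL w) := by
  suffices edgesL ∘ₗ lin bdH = lin bdB ∘ₗ edgesL (G := G) from LinearMap.congr_fun this w
  refine lin_ext fun u => ?_
  rcases u with _ | ⟨x, _ | ⟨y, s⟩⟩
  · simp [edgesL, lin_single, bdH]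
  · simp [edgesL, lin_single, bdH, bdB, edges]
  · have h : edgesL (bdH (x :: y :: s)) = bdB (edges (x :: y :: s)) := by
      rw [bdH, map_sub, edgesL_pre_bdH]
      simp [edgesL, lin_single, edges, bdB]
    simpa [lin_single, edgesL] using h

theorem edges_length (x : G) (s : List G) : (edges (x :: s)).length = s.length := by
  induction s generalizing x with
  | nil => rfl
  | cons y s ih => simp [edges, ih]

theorem edgesL_pre_prism (z : G × H) (x : G) (y : H) (s : List G) (t : List H) :
    edgesL (pre z (prism (x :: s) (y :: t))) =
      pre (z⁻¹ * (x, y)) (edgesL (prism (x :: s) (y :: t))) := by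
  rw [prism, edgesL_pre_pre]

theorem edgesL_prism (x : G) (y : H) (s : List G) (t : List H) :
    edgesL (prism (x :: s) (y :: t)) = shuffle (edges (x :: s)) (edges (y :: t)) := by
  induction hn : s.length + t.length using Nat.strong_induction_on generalizing x y s t with
  | _ n ih =>
  rw [prism]
  rcases s with _ | ⟨x', s⟩ <;> rcases t with _ | ⟨y', t⟩
  · simp [prism, pre_single, edgesL, lin_single, edges, shuffle]
  · have h := ih t.length (by simp at hn; omega) x y' [] t (by simp)
    simp only [reduceCtorEq, and_false, if_false, add_zero]
    rw [show prism ([] : List G) (y :: y' :: t) = 0 by rw [prism], zero_add, List.length_nil,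
      pow_zero, one_smul, edgesL_pre_prism, h, edges, edges, shuffle]
    simp
  · have h := ih s.length (by simp at hn; omega) x' y s [] (by simp)
    simp only [reduceCtorEq, false_and, if_false, add_zero]
    rw [show prism (x :: x' :: s) ([] : List H) = 0 by rw [prism], smul_zero, add_zero,
      edgesL_pre_prism, h, edges, edges, shuffle]
    simp
  · have h1 := ih (s.length + (t.length + 1)) (by simp at hn; omega) x' y s (y' :: t) (by simp)
    have h2 := ih (s.length + 1 + t.length) (by simp at hn; omega) x y' (x' :: s) t (by simp)
    simp only [reduceCtorEq, and_false, if_false, add_zero]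
    rw [map_add, map_add, map_smul, map_smul, edgesL_pre_prism, edgesL_pre_prism, h1, h2, edges,
      edges, shuffle, edges_length]
    simp

theorem edgesL_bilin_prism (v : List G →₀ ℤ) (w : List H →₀ ℤ) :
    edgesL (bilin prism v w) = bilin shuffle (edgesL v) (edgesL w) := by
  suffices (bilin prism).compr₂ edgesL = (bilin shuffle).compl₁₂ (edgesL (G := G))
    (edgesL (G := H)) from LinearMap.congr_fun₂ this v w
  refine bilin_ext fun u v => ?_
  simp only [LinearMap.compr₂_apply, LinearMap.compl₁₂_apply, bilin_single]
  rcases u with _ | ⟨x, s⟩ <;> rcases v with _ | ⟨y, t⟩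
  · simp [prism, edgesL, lin_single]
  · simp [prism, edgesL, lin_single]
  · simp [prism, edgesL, lin_single]
  · rw [mul_one, one_smul, edgesL_prism]
    simp [edgesL, lin_single, bilin_single]

theorem edgesL_sgn (w : List G →₀ ℤ) : edgesL (sgn w) = - sgn (edgesL w) := by
  suffices edgesL ∘ₗ sgn = - (sgn ∘ₗ edgesL (G := G)) from LinearMap.congr_fun this w
  refine lin_ext fun u => ?_
  rcases u with _ | ⟨x, s⟩
  · simp [edgesL, sgn, lin_single]
  · simp [edgesL, sgn, lin_single, edges_length, pow_succ]

theorem edgesL_surjective (w : List G →₀ ℤ) : ∃ v, edgesL v = w := by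
  refine ⟨lin (fun u => single (vertices 1 u) 1) w, ?_⟩
  suffices edgesL ∘ₗ lin (fun u => single (vertices (1 : G) u) (1 : ℤ)) = LinearMap.id from
    LinearMap.congr_fun this w
  refine lin_ext fun u => ?_
  have e : ∃ s, vertices (1 : G) u = 1 :: s := by cases u <;> exact ⟨_, rfl⟩
  obtain ⟨s, hs⟩ := e
  have h := edges_vertices (1 : G) u
  rw [hs] at h
  simp [lin_single, edgesL, hs, h]

/-- The Leibniz rule for the shuffle product. -/
theorem bdB_shuffle (v : List G →₀ ℤ) (w : List H →₀ ℤ) :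
    lin bdB (bilin shuffle v w) =
      bilin shuffle (lin bdB v) w + bilin shuffle (sgn v) (lin bdB w) := by
  obtain ⟨v, rfl⟩ := edgesL_surjective v
  obtain ⟨w, rfl⟩ := edgesL_surjective w
  have h0 : edgesL (single ([] : List (G × H)) 1) = 0 := by simp [edgesL, lin_single]
  rw [← edgesL_bilin_prism, ← edgesL_bdH, bdH_prism, map_add, map_sub, map_smul, h0,
    edgesL_bilin_prism, edgesL_bilin_prism, edgesL_bdH, edgesL_bdH, edgesL_sgn]
  simp

end

/-! Chains indexed by tuples -/

/-- Tuples as words. -/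
def emb (n : ℕ) : ((Fin n → α) →₀ ℤ) →ₗ[ℤ] (List α →₀ ℤ) := Finsupp.lmapDomain ℤ ℤ List.ofFn

/-- Words as tuples. -/
def tup [One α] (n : ℕ) : (List α →₀ ℤ) →ₗ[ℤ] ((Fin n → α) →₀ ℤ) :=
  Finsupp.lmapDomain ℤ ℤ fun l (i : Fin n) => l.getD i 1

theorem emb_single (n : ℕ) (u : Fin n → α) (c : ℤ) :
    emb n (single u c) = single (List.ofFn u) c := by simp [emb]

theorem tup_single [One α] (n : ℕ) (u : List α) (c : ℤ) :
    tup n (single u c) = single (fun i : Fin n => u.getD i 1) c := by simp [tup]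

theorem tup_emb [One α] (n : ℕ) (w : (Fin n → α) →₀ ℤ) : tup n (emb n w) = w := by
  suffices tup n ∘ₗ emb n = (LinearMap.id : ((Fin n → α) →₀ ℤ) →ₗ[ℤ] _) from
    LinearMap.congr_fun this w
  refine Finsupp.lhom_ext' fun u => LinearMap.ext_ring ?_
  simp [emb_single, tup_single]

theorem emb_injective [One α] (n : ℕ) : Function.Injective (emb (α := α) n) :=
  Function.LeftInverse.injective (tup_emb n)

theorem emb_tup_pre [One α] (n : ℕ) (x : α) (w : List α →₀ ℤ) :
    emb (n + 1) (tup (n + 1) (pre x w)) = pre x (emb n (tup n w)) := by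
  suffices emb (n + 1) ∘ₗ tup (n + 1) ∘ₗ pre x = pre x ∘ₗ emb n ∘ₗ tup n from
    LinearMap.congr_fun this w
  exact lin_ext fun u => by simp [emb_single, tup_single, pre_single, List.ofFn_succ]

theorem emb_tup_shuffle [One G] [One H] (n : ℕ) (u : List G) (v : List H)
    (hn : u.length + v.length = n) : emb n (tup n (shuffle u v)) = shuffle u v := by
  induction n generalizing u v with
  | zero =>
    obtain rfl : u = [] := List.length_eq_zero_iff.1 (by omega)
    obtain rfl : v = [] := List.length_eq_zero_iff.1 (by omega)
    simp [shuffle, emb_single, tup_single]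
  | succ n ih =>
    rcases u with _ | ⟨x, s⟩ <;> rcases v with _ | ⟨y, t⟩
    · simp at hn
    · rw [shuffle, emb_tup_pre, ih]; simp at hn ⊢; omega
    · rw [shuffle, emb_tup_pre, ih]; simp at hn ⊢; omega
    · rw [shuffle, map_add, map_add, map_smul, map_smul, emb_tup_pre, emb_tup_pre, ih, ih] <;>
        simp at hn ⊢ <;> omega

theorem sgn_emb (n : ℕ) (w : (Fin n → α) →₀ ℤ) : sgn (emb n w) = (-1 : ℤ) ^ n • emb n w := by
  suffices sgn ∘ₗ emb n = (-1 : ℤ) ^ n • emb (α := α) n from LinearMap.congr_fun this w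
  refine Finsupp.lhom_ext' fun u => LinearMap.ext_ring ?_
  simp [emb_single, sgn, lin_single]

/-- The cross product of bar chains,
`[g₁|…|g_p] × [h₁|…|h_q] = ∑ ± (shuffles of (g₁,1), …, (g_p,1) and (1,h₁), …, (1,h_q))`,
as a chain of degree `n`; it is used for `n = p + q` only. -/
def crossChain [One G] [One H] (p q n : ℕ) :
    ((Fin p → G) →₀ ℤ) →ₗ[ℤ] ((Fin q → H) →₀ ℤ) →ₗ[ℤ] ((Fin n → G × H) →₀ ℤ) :=
  ((bilin shuffle).compl₁₂ (emb p) (emb q)).compr₂ (tup n)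

theorem emb_crossChain [One G] [One H] {p q n : ℕ} (hn : p + q = n) (v : (Fin p → G) →₀ ℤ)
    (w : (Fin q → H) →₀ ℤ) :
    emb n (crossChain p q n v w) = bilin shuffle (emb p v) (emb q w) := by
  suffices (crossChain p q n).compr₂ (emb n) =
      (bilin shuffle).compl₁₂ (emb (α := G) p) (emb (α := H) q) from
    LinearMap.congr_fun₂ this v w
  refine Finsupp.lhom_ext' fun u => LinearMap.ext_ring ?_
  refine Finsupp.lhom_ext' fun u' => LinearMap.ext_ring ?_
  simp [crossChain, emb_single, bilin_single, emb_tup_shuffle n (List.ofFn u) (List.ofFn u')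
    (by simpa using hn)]

theorem faces_ofFn [Group G] (n : ℕ) (g : Fin (n + 1) → G) :
    emb n (∑ j : Fin (n + 1), (-1 : ℤ) ^ (j : ℕ) • single (Fin.contractNth j (· * ·) g) (1 : ℤ)) =
      faces (g 0) (List.ofFn fun i => g i.succ) := by
  induction n with
  | zero => simp [emb_single, faces]
  | succ n ih =>
    have e0 : List.ofFn (Fin.contractNth 0 (· * ·) g) =
        (g 0 * g 1) :: List.ofFn fun i : Fin n => g i.succ.succ := by
      rw [List.ofFn_succ]
      congr 1
    have es : ∀ j : Fin (n + 1), List.ofFn (Fin.contractNth j.succ (· * ·) g) =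
        g 0 :: List.ofFn (Fin.contractNth j (· * ·) fun i => g i.succ) := fun j => by
      rw [List.ofFn_succ]
      congr 1
      congr 1
      funext i
      simp [Fin.contractNth]
    have := congr_arg (pre (g 0)) (ih fun i => g i.succ)
    rw [Fin.sum_univ_succ, List.ofFn_succ, faces]
    simp only [map_add, map_sum, map_smul, emb_single, e0, es, pre_single] at this ⊢
    rw [Fin.succ_zero_eq_one] at *
    rw [← this]
    simp [pow_succ, Finset.sum_neg_distrib, sub_eq_add_neg]

/-- The trivial `G`-module `ℤ`. -/
abbrev triv (G : Type) [Group G] : Rep ℤ G := Rep.trivial ℤ G ℤ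

theorem emb_d [Group G] (n : ℕ) (w : (Fin (n + 1) → G) →₀ ℤ) :
    emb n ((groupHomology.inhomogeneousChains.d (triv G) n).hom w) = lin bdB (emb (n + 1) w) := by
  suffices emb n ∘ₗ (groupHomology.inhomogeneousChains.d (triv G) n).hom =
    lin bdB ∘ₗ emb (α := G) (n + 1) from LinearMap.congr_fun this w
  refine Finsupp.lhom_ext' fun u => LinearMap.ext_ring ?_
  have h := faces_ofFn n u
  have hd : (groupHomology.inhomogeneousChains.d (triv G) n).hom (single u (1 : ℤ)) =
      single (fun i => u i.succ) (1 : ℤ) -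
        ∑ j : Fin (n + 1), (-1 : ℤ) ^ (j : ℕ) • single (Fin.contractNth j (· * ·) u) (1 : ℤ) := by
    have := groupHomology.inhomogeneousChains.d_single (A := triv G) n u (1 : ℤ)
    refine this.trans ?_
    rw [sub_eq_add_neg, ← Finset.sum_neg_distrib]
    congr 1
    refine Finset.sum_congr rfl fun j _ => ?_
    rw [pow_succ, mul_neg_one, neg_smul]
  simp only [LinearMap.comp_apply, lsingle_apply]
  rw [hd, map_sub, h, emb_single, emb_single, List.ofFn_succ, lin_single, bdB, one_smul]

theorem bdB_emb_zero [Group G] (w : (Fin 0 → G) →₀ ℤ) : lin bdB (emb 0 w) = 0 := by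
  suffices lin bdB ∘ₗ emb (α := G) 0 = 0 from LinearMap.congr_fun this w
  refine Finsupp.lhom_ext' fun u => LinearMap.ext_ring ?_
  simp [emb_single, lin_single, bdB]

open CategoryTheory

section
variable [Group G] [Group H]

/-- The differential of Mathlib's complex of inhomogeneous chains with coefficients in `ℤ`. -/
abbrev dd (G : Type) [Group G] (i j : ℕ) : ((Fin i → G) →₀ ℤ) →ₗ[ℤ] ((Fin j → G) →₀ ℤ) :=
  ((groupHomology.inhomogeneousChains (triv G)).d i j).hom

theorem emb_dd (n : ℕ) (w : (Fin (n + 1) → G) →₀ ℤ) :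
    emb n (dd G (n + 1) n w) = lin bdB (emb (n + 1) w) := by
  rw [← emb_d]
  unfold dd
  rw [groupHomology.inhomogeneousChains.d_def]

theorem bdB_emb_eq_zero_iff (n : ℕ) (w : (Fin n → G) →₀ ℤ) :
    lin bdB (emb n w) = 0 ↔ dd G n (n - 1) w = 0 := by
  rcases n with _ | n
  · simp only [bdB_emb_zero, true_iff]
    unfold dd
    rw [(groupHomology.inhomogeneousChains (triv G)).shape 0 (0 - 1) (by simp)]
    rfl
  · rw [← emb_dd]
    exact ⟨fun h => emb_injective n (by simpa using h), fun h => by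
      change dd G (n + 1) n w = 0 at h; rw [h, map_zero]⟩


/-- The integral homology `H_n(G) = H_n(G, ℤ)`. -/
abbrev HZ (G : Type) [Group G] (n : ℕ) : ModuleCat ℤ := groupHomology (triv G) n
/-- The `n`-cycles with coefficients in `ℤ`. -/
abbrev ZZ (G : Type) [Group G] (n : ℕ) : ModuleCat ℤ := groupHomology.cycles (triv G) n

/-- The chain underlying a cycle. -/
def toChain (n : ℕ) : ZZ G n →+ ((Fin n → G) →₀ ℤ) :=
  (groupHomology.iCycles (triv G) n).hom.toAddMonoidHom

/-- The homology class of a cycle. -/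
def toClass (n : ℕ) : ZZ G n →+ HZ G n :=
  (groupHomology.π (triv G) n).hom.toAddMonoidHom

theorem toChain_injective (n : ℕ) : Function.Injective (toChain (G := G) n) :=
  (ModuleCat.mono_iff_injective (groupHomology.iCycles (triv G) n)).1 inferInstance

theorem toClass_surjective (n : ℕ) : Function.Surjective (toClass (G := G) n) :=
  (ModuleCat.epi_iff_surjective ((groupHomology.inhomogeneousChains (triv G)).homologyπ n)).1
    inferInstance

theorem bdB_toChain (n : ℕ) (x : ZZ G n) : lin bdB (emb n (toChain n x)) = 0 := by
  rw [bdB_emb_eq_zero_iff]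
  exact LinearMap.congr_fun (ModuleCat.hom_ext_iff.1
    ((groupHomology.inhomogeneousChains (triv G)).iCycles_d n (n - 1))) x

theorem next_down (n : ℕ) : (ComplexShape.down ℕ).next n = n - 1 := by
  rcases n with _ | n <;> simp

theorem exists_cycle (n : ℕ) (w : (Fin n → G) →₀ ℤ) (h : lin bdB (emb n w) = 0) :
    ∃ x : ZZ G n, toChain n x = w := by
  rw [bdB_emb_eq_zero_iff] at h
  exact ⟨groupHomology.cyclesMk n (n - 1) (next_down n) w h, groupHomology.iCycles_mk _ _ _⟩

theorem toClass_eq_zero_iff (n : ℕ) (x : ZZ G n) :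
    toClass n x = 0 ↔ ∃ w : (Fin (n + 1) → G) →₀ ℤ,
      emb n (toChain n x) = lin bdB (emb (n + 1) w) := by
  let K := groupHomology.inhomogeneousChains (triv G)
  have hex := ShortComplex.exact_of_g_is_cokernel
    (ShortComplex.mk (K.toCycles (n + 1) n) (K.homologyπ n) (by simp))
    (K.homologyIsCokernel (n + 1) n (by simp))
  rw [ShortComplex.moduleCat_exact_iff] at hex
  have hd : ∀ w : (Fin (n + 1) → G) →₀ ℤ,
      toChain n ((K.toCycles (n + 1) n).hom w) = dd G (n + 1) n w := fun w =>
    LinearMap.congr_fun (ModuleCat.hom_ext_iff.1 (K.toCycles_i (n + 1) n)) w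
  constructor
  · intro h
    obtain ⟨w, hw⟩ := hex x h
    refine ⟨w, ?_⟩
    rw [← emb_dd, ← hd w]
    exact congr_arg (fun x => emb n (toChain n x)) hw.symm
  · rintro ⟨w, hw⟩
    rw [← emb_dd, ← hd w] at hw
    rw [toChain_injective n (emb_injective n hw)]
    exact LinearMap.congr_fun (ModuleCat.hom_ext_iff.1 (K.toCycles_comp_homologyπ (n + 1) n)) w

theorem bdB_crossChain {p q n : ℕ} (hn : p + q = n) (v : (Fin p → G) →₀ ℤ)
    (w : (Fin q → H) →₀ ℤ) :
    lin bdB (emb n (crossChain p q n v w)) =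
      bilin shuffle (lin bdB (emb p v)) (emb q w) +
        (-1 : ℤ) ^ p • bilin shuffle (emb p v) (lin bdB (emb q w)) := by
  rw [emb_crossChain hn, bdB_shuffle, sgn_emb, map_smul, LinearMap.smul_apply]

/-- The cross product of two cycles, as a cycle. -/
def crossCycleFun (p q : ℕ) (x : ZZ G p) (y : ZZ H q) : ZZ (G × H) (p + q) :=
  groupHomology.cyclesMk (p + q) (p + q - 1) (next_down _)
    (crossChain p q (p + q) (toChain p x) (toChain q y))
    ((bdB_emb_eq_zero_iff _ _).1 (by rw [bdB_crossChain rfl, bdB_toChain, bdB_toChain]; simp))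

theorem toChain_crossCycleFun (p q : ℕ) (x : ZZ G p) (y : ZZ H q) :
    toChain (p + q) (crossCycleFun p q x y) =
      crossChain p q (p + q) (toChain p x) (toChain q y) := by
  unfold crossCycleFun
  exact groupHomology.iCycles_mk _ _ _

/-- The cross product of cycles, as a bi-additive map. -/
def crossCycle (p q : ℕ) : ZZ G p →+ ZZ H q →+ ZZ (G × H) (p + q) :=
  AddMonoidHom.mk' (fun x => AddMonoidHom.mk' (crossCycleFun p q x) fun y y' =>
      toChain_injective _ (by simp only [map_add, toChain_crossCycleFun]))
    fun x x' => AddMonoidHom.ext fun y => toChain_injective _ (by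
      simp only [AddMonoidHom.mk'_apply, AddMonoidHom.add_apply, map_add, toChain_crossCycleFun,
        LinearMap.add_apply])

theorem toChain_crossCycle (p q : ℕ) (x : ZZ G p) (y : ZZ H q) :
    toChain (p + q) (crossCycle p q x y) =
      crossChain p q (p + q) (toChain p x) (toChain q y) :=
  toChain_crossCycleFun p q x y

theorem toClass_crossCycle_left (p q : ℕ) (x : ZZ G p) (y : ZZ H q) (hx : toClass p x = 0) :
    toClass (p + q) (crossCycle p q x y) = 0 := by
  obtain ⟨w, hw⟩ := (toClass_eq_zero_iff p x).1 hx
  refine (toClass_eq_zero_iff _ _).2 ⟨crossChain (p + 1) q (p + q + 1) w (toChain q y), ?_⟩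
  rw [bdB_crossChain (by omega), bdB_toChain, map_zero, smul_zero, add_zero, ← hw,
    toChain_crossCycle, emb_crossChain rfl]

theorem toClass_crossCycle_right (p q : ℕ) (x : ZZ G p) (y : ZZ H q) (hy : toClass q y = 0) :
    toClass (p + q) (crossCycle p q x y) = 0 := by
  obtain ⟨w, hw⟩ := (toClass_eq_zero_iff q y).1 hy
  refine (toClass_eq_zero_iff _ _).2
    ⟨(-1 : ℤ) ^ p • crossChain p (q + 1) (p + q + 1) (toChain p x) w, ?_⟩
  rw [map_smul, map_smul, bdB_crossChain (by omega), bdB_toChain, map_zero,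
    LinearMap.zero_apply, zero_add, ← hw, toChain_crossCycle, emb_crossChain rfl, smul_smul,
    ← mul_pow]
  simp

/-- The homology cross product `H_p(G) × H_q(H) → H_{p+q}(G × H)`, characterized by
`cross_toClass` below. -/
def cross (p q : ℕ) : HZ G p →+ HZ H q →+ HZ (G × H) (p + q) :=
  (toClass p).liftOfSurjective (toClass_surjective p)
    ⟨((toClass q).liftOfSurjective (toClass_surjective q)
      ⟨((AddMonoidHom.compHom (toClass (p + q))).comp (crossCycle p q)).flip, fun y hy =>
        AddMonoidHom.ext fun x => toClass_crossCycle_right p q x y hy⟩).flip, fun x hx =>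
          AddMonoidHom.ext fun z => by
            obtain ⟨y, rfl⟩ := toClass_surjective q z
            rw [AddMonoidHom.flip_apply, AddMonoidHom.liftOfRightInverse_comp_apply]
            exact toClass_crossCycle_left p q x y hx⟩

theorem cross_toClass (p q : ℕ) (x : ZZ G p) (y : ZZ H q) :
    cross p q (toClass p x) (toClass q y) = toClass (p + q) (crossCycle p q x y) := by
  rw [cross, AddMonoidHom.liftOfRightInverse_comp_apply, AddMonoidHom.flip_apply,
    AddMonoidHom.liftOfRightInverse_comp_apply]
  rfl

/-- The map induced on integral homology by a group homomorphism. -/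
def pushforward (f : G →* H) (n : ℕ) : HZ G n →+ HZ H n :=
  (groupHomology.map (A := triv G) (B := triv H) f
    (Rep.ofHom ⟨LinearMap.id, fun _ => rfl⟩) n).hom.toAddMonoidHom

variable (G) in
/-- The canonical generator of `H_0(G) = ℤ`, i.e. the class of a point. -/
def pointClass : HZ G 0 := groupHomology.H0π (triv G) (1 : ℤ)

/-- The class in `H_1(G)` (the abelianization of `G`) of an element `g` of `G`, i.e. the class of
the `1`-cycle `[g]`. -/
def elementClass (g : G) : HZ G 1 :=
  groupHomology.H1π (triv G)
    ((groupHomology.cycles₁IsoOfIsTrivial (triv G)).inv (single g (1 : ℤ)))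

end

/-! ### Products in rings without identity -/

/-- The power `x ^ (n + 1) = x ⋯ x x`. -/
def powSucc {R : Type} [Mul R] (x : R) : ℕ → R
  | 0 => x
  | n + 1 => powSucc x n * x

/-- The alternating product `x y x ⋯` with `n + 1` factors, beginning with `x`. -/
def altProd {R : Type} [Mul R] (x y : R) : ℕ → R
  | 0 => x
  | n + 1 => x * altProd y x n

end IntegralHomology

/-! ### Thompson's group `F` -/

namespace Thompson

/-- Dyadic rational numbers. -/
def IsDyadic (x : ℝ) : Prop := ∃ (m : ℤ) (n : ℕ), x = m / 2 ^ n

/-- `f` is piecewise linear with finitely many breakpoints (all of which lie in the finite set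
`S`), every breakpoint has dyadic coordinates, and every slope is an integral power of `2`: on
each closed interval with no breakpoint in its interior, `f` is affine of slope `2 ^ k`. -/
def IsDyadicPL (f : I ≃o I) : Prop :=
  ∃ S : Finset I,
    (∀ s ∈ S, IsDyadic (s : ℝ) ∧ IsDyadic (f s : ℝ)) ∧
    ∀ a b : I, a ≤ b → (∀ s ∈ S, ¬ (a < s ∧ s < b)) →
      ∃ k : ℤ, ∀ t : I, a ≤ t → t ≤ b → (f t : ℝ) = f a + (2 : ℝ) ^ k * (t - a)

theorem IsDyadic.intCast (m : ℤ) : IsDyadic m := ⟨m, 0, by simp⟩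

theorem IsDyadic.half_pow (n : ℕ) : IsDyadic (1 / 2 ^ n) := ⟨1, n, by simp⟩

theorem IsDyadic.add {x y : ℝ} (hx : IsDyadic x) (hy : IsDyadic y) : IsDyadic (x + y) := by
  obtain ⟨m, n, rfl⟩ := hx
  obtain ⟨m', n', rfl⟩ := hy
  refine ⟨m * 2 ^ n' + m' * 2 ^ n, n + n', ?_⟩
  push_cast
  rw [pow_add]
  field_simp

theorem IsDyadic.mul {x y : ℝ} (hx : IsDyadic x) (hy : IsDyadic y) : IsDyadic (x * y) := by
  obtain ⟨m, n, rfl⟩ := hx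
  obtain ⟨m', n', rfl⟩ := hy
  refine ⟨m * m', n + n', ?_⟩
  push_cast
  rw [pow_add]
  field_simp

theorem IsDyadic.sub {x y : ℝ} (hx : IsDyadic x) (hy : IsDyadic y) : IsDyadic (x - y) := by
  have h := hx.add ((IsDyadic.intCast (-1)).mul hy)
  have e : x + ((-1 : ℤ) : ℝ) * y = x - y := by push_cast; ring
  rwa [e] at h

theorem IsDyadic.two_zpow (k : ℤ) : IsDyadic ((2 : ℝ) ^ k) := by
  obtain ⟨n, rfl | rfl⟩ := k.eq_nat_or_neg
  · exact ⟨2 ^ n, 0, by simp⟩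
  · exact ⟨1, n, by simp⟩

/-- A dyadic PL-homeomorphism of the unit interval maps dyadic numbers to dyadic numbers. -/
theorem IsDyadicPL.isDyadic {f : I ≃o I} (hf : IsDyadicPL f) {x : I} (hx : IsDyadic (x : ℝ)) :
    IsDyadic (f x : ℝ) := by
  obtain ⟨S, hS, hA⟩ := hf
  have hS' : ∀ s ∈ insert (0 : I) S, IsDyadic (s : ℝ) ∧ IsDyadic (f s : ℝ) := by
    intro s hs
    rcases Finset.mem_insert.1 hs with rfl | hs
    · have h0 : f 0 = 0 := map_bot f
      rw [h0]
      have : IsDyadic ((0 : I) : ℝ) := by simpa using IsDyadic.intCast 0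
      exact ⟨this, this⟩
    · exact hS s hs
  let T := (insert (0 : I) S).filter (· ≤ x)
  have hT : T.Nonempty := ⟨0, by simp [T]⟩
  obtain ⟨hc, hcx⟩ := Finset.mem_filter.1 (T.max'_mem hT)
  obtain ⟨k, hk⟩ := hA (T.max' hT) x hcx (by
    rintro s hs ⟨h1, h2⟩
    exact absurd (T.le_max' s (by simp [T, hs, h2.le])) (not_le.2 h1))
  rw [hk x hcx le_rfl]
  exact (hS' _ hc).2.add ((IsDyadic.two_zpow k).mul (hx.sub (hS' _ hc).1))

theorem IsDyadicPL.one : IsDyadicPL 1 :=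
  ⟨∅, by simp, fun a b _ _ => ⟨0, fun t _ _ => by simp⟩⟩

theorem IsDyadicPL.inv {f : I ≃o I} (hf : IsDyadicPL f) : IsDyadicPL f⁻¹ := by
  classical
  obtain ⟨S, hS, hA⟩ := hf
  refine ⟨S.image f, ?_, ?_⟩
  · intro s hs
    obtain ⟨r, hr, rfl⟩ := Finset.mem_image.1 hs
    exact ⟨(hS r hr).2, by simpa using (hS r hr).1⟩
  · intro a b hab h
    obtain ⟨k, hk⟩ := hA (f.symm a) (f.symm b) (f.symm.monotone hab) (by
      rintro s hs ⟨h1, h2⟩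
      refine h (f s) (Finset.mem_image_of_mem _ hs) ⟨?_, ?_⟩
      · rwa [← OrderIso.symm_apply_lt]
      · rwa [← OrderIso.lt_symm_apply])
    refine ⟨-k, fun t hat htb => ?_⟩
    have h := hk (f.symm t) (f.symm.monotone hat) (f.symm.monotone htb)
    rw [OrderIso.apply_symm_apply, OrderIso.apply_symm_apply] at h
    change (f.symm t : ℝ) = f.symm a + _
    rw [h, zpow_neg]
    field_simp
    ring

theorem IsDyadicPL.mul {f g : I ≃o I} (hf : IsDyadicPL f) (hg : IsDyadicPL g) :
    IsDyadicPL (f * g) := by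
  classical
  have hf' := hf
  have hg' := hg
  obtain ⟨S, hS, hA⟩ := hf
  obtain ⟨T, hT, hB⟩ := hg
  refine ⟨T ∪ S.image g.symm, ?_, ?_⟩
  · intro s hs
    rcases Finset.mem_union.1 hs with hs | hs
    · exact ⟨(hT s hs).1, hf'.isDyadic (hT s hs).2⟩
    · obtain ⟨r, hr, rfl⟩ := Finset.mem_image.1 hs
      exact ⟨hg'.inv.isDyadic (hS r hr).1, by simpa using (hS r hr).2⟩
  · intro a b hab h
    obtain ⟨k, hk⟩ := hB a b hab fun s hs => h s (Finset.mem_union_left _ hs)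
    obtain ⟨l, hl⟩ := hA (g a) (g b) (g.monotone hab) (by
      rintro s hs ⟨h1, h2⟩
      refine h (g.symm s) (Finset.mem_union_right _ (Finset.mem_image_of_mem _ hs)) ⟨?_, ?_⟩
      · rwa [OrderIso.lt_symm_apply]
      · rwa [OrderIso.symm_apply_lt])
    refine ⟨l + k, fun t hat htb => ?_⟩
    change (f (g t) : ℝ) = f (g a) + _
    rw [hl (g t) (g.monotone hat) (g.monotone htb), hk t hat htb, zpow_add₀ (by norm_num)]
    ring

/-- Thompson's group `F`: the group of dyadic PL-homeomorphisms of `[0,1]`, with composition as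
group law, `(f * g) t = f (g t)`.  (All slopes being positive, a dyadic PL-homeomorphism is
increasing; so we work inside the group of order isomorphisms of `[0,1]`, which are precisely
its increasing self-homeomorphisms.) -/
def thompsonGroup : Subgroup (I ≃o I) where
  carrier := {f | IsDyadicPL f}
  one_mem' := IsDyadicPL.one
  mul_mem' := IsDyadicPL.mul
  inv_mem' := IsDyadicPL.inv

/-- Thompson's group `F` as a type. -/
abbrev F : Type := thompsonGroup

/-! ### The product `f * g` on `F` -/

/-- The function which is a rescaled copy of `f` on `[0,1/2]` and of `g` on `[1/2,1]`. -/
def glueFun (f g : I ≃o I) (t : I) : I :=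
  if h : (t : ℝ) ≤ 1 / 2 then
    ⟨(f ⟨2 * t, by constructor <;> linarith [t.2.1]⟩ : ℝ) / 2,
      by constructor <;> linarith [(f ⟨2 * t, by constructor <;> linarith [t.2.1]⟩).2.1,
        (f ⟨2 * t, by constructor <;> linarith [t.2.1]⟩).2.2]⟩
  else
    ⟨((g ⟨2 * t - 1, by constructor <;> linarith [t.2.2]⟩ : ℝ) + 1) / 2,
      by constructor <;> linarith [(g ⟨2 * t - 1, by constructor <;> linarith [t.2.2]⟩).2.1,
        (g ⟨2 * t - 1, by constructor <;> linarith [t.2.2]⟩).2.2]⟩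

theorem glueFun_left (f g : I ≃o I) (t s : I) (h : (t : ℝ) ≤ 1 / 2) (hs : (s : ℝ) = 2 * t) :
    (glueFun f g t : ℝ) = f s / 2 := by
  obtain rfl : s = ⟨2 * t, by constructor <;> linarith [t.2.1]⟩ := Subtype.ext hs
  simp only [glueFun, dif_pos h]

theorem glueFun_right (f g : I ≃o I) (t s : I) (h : 1 / 2 ≤ (t : ℝ)) (hs : (s : ℝ) = 2 * t - 1) :
    (glueFun f g t : ℝ) = (g s + 1) / 2 := by
  rcases h.eq_or_lt with h | h
  · obtain rfl : s = 0 := Subtype.ext (by rw [hs, ← h]; norm_num)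
    rw [glueFun_left f g t 1 h.ge (by rw [← h]; norm_num)]
    have h1 : f 1 = 1 := map_top f
    have h0 : g 0 = 0 := map_bot g
    rw [h1, h0]
    norm_num
  · obtain rfl : s = ⟨2 * t - 1, by constructor <;> linarith [t.2.2]⟩ := Subtype.ext hs
    simp only [glueFun, dif_neg (not_le.2 h)]

theorem exists_double (t : I) (h : (t : ℝ) ≤ 1 / 2) : ∃ s : I, (s : ℝ) = 2 * t :=
  ⟨⟨2 * t, by constructor <;> linarith [t.2.1]⟩, rfl⟩

theorem exists_double_sub (t : I) (h : 1 / 2 ≤ (t : ℝ)) : ∃ s : I, (s : ℝ) = 2 * t - 1 :=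
  ⟨⟨2 * t - 1, by constructor <;> linarith [t.2.2]⟩, rfl⟩

theorem glueFun_comp (f g f' g' : I ≃o I) (t : I) :
    glueFun f g (glueFun f' g' t) = glueFun (f * f') (g * g') t := by
  apply Subtype.ext
  rcases le_total (t : ℝ) (1 / 2) with h | h
  · obtain ⟨s, hs⟩ := exists_double t h
    have e := glueFun_left f' g' t s h hs
    rw [glueFun_left (f * f') (g * g') t s h hs,
      glueFun_left f g _ (f' s) (by rw [e]; linarith [(f' s).2.2]) (by rw [e]; ring)]
    rfl
  · obtain ⟨s, hs⟩ := exists_double_sub t h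
    have e := glueFun_right f' g' t s h hs
    rw [glueFun_right (f * f') (g * g') t s h hs,
      glueFun_right f g _ (g' s) (by rw [e]; linarith [(g' s).2.1]) (by rw [e]; ring)]
    rfl

theorem glueFun_one (t : I) : glueFun 1 1 t = t := by
  apply Subtype.ext
  rcases le_total (t : ℝ) (1 / 2) with h | h
  · obtain ⟨s, hs⟩ := exists_double t h
    rw [glueFun_left 1 1 t s h hs]
    change (s : ℝ) / 2 = t
    linarith
  · obtain ⟨s, hs⟩ := exists_double_sub t h
    rw [glueFun_right 1 1 t s h hs]
    change ((s : ℝ) + 1) / 2 = t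
    linarith

theorem glueFun_strictMono (f g : I ≃o I) : StrictMono (glueFun f g) := by
  intro a b hab
  have hab' : (a : ℝ) < b := hab
  change (glueFun f g a : ℝ) < glueFun f g b
  rcases le_or_gt (b : ℝ) (1 / 2) with hb | hb
  · obtain ⟨s, hs⟩ := exists_double a (by linarith)
    obtain ⟨r, hr⟩ := exists_double b hb
    rw [glueFun_left f g a s (by linarith) hs, glueFun_left f g b r hb hr]
    have : (f s : ℝ) < f r := f.strictMono (show (s : ℝ) < r by linarith)
    linarith
  · obtain ⟨r, hr⟩ := exists_double_sub b hb.le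
    rw [glueFun_right f g b r hb.le hr]
    rcases le_or_gt (a : ℝ) (1 / 2) with ha | ha
    · obtain ⟨s, hs⟩ := exists_double a ha
      rw [glueFun_left f g a s ha hs]
      have h0 : g 0 = 0 := map_bot g
      have h1 : ((g 0 : I) : ℝ) < g r :=
        g.strictMono (show ((0 : I) : ℝ) < r by rw [hr]; norm_num; linarith)
      rw [h0] at h1
      have h2 : ((0 : I) : ℝ) = 0 := rfl
      linarith [(f s).2.2]
    · obtain ⟨s, hs⟩ := exists_double_sub a ha.le
      rw [glueFun_right f g a s ha.le hs]
      have : (g s : ℝ) < g r := g.strictMono (show (s : ℝ) < r by linarith)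
      linarith

/-- `glueFun f g` as an order isomorphism of `[0,1]`. -/
def glue (f g : I ≃o I) : I ≃o I where
  toFun := glueFun f g
  invFun := glueFun f⁻¹ g⁻¹
  left_inv t := by rw [glueFun_comp, inv_mul_cancel, inv_mul_cancel, glueFun_one]
  right_inv t := by rw [glueFun_comp, mul_inv_cancel, mul_inv_cancel, glueFun_one]
  map_rel_iff' := (glueFun_strictMono f g).le_iff_le

/-- The inclusion `t ↦ t / 2` of `[0,1]` as `[0,1/2]`. -/
def halfL (t : I) : I := ⟨t / 2, by constructor <;> linarith [t.2.1, t.2.2]⟩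

/-- The inclusion `t ↦ (t + 1) / 2` of `[0,1]` as `[1/2,1]`. -/
def halfR (t : I) : I := ⟨(t + 1) / 2, by constructor <;> linarith [t.2.1, t.2.2]⟩

theorem IsDyadicPL.glue {f g : I ≃o I} (hf : IsDyadicPL f) (hg : IsDyadicPL g) :
    IsDyadicPL (glue f g) := by
  classical
  obtain ⟨S, hS, hA⟩ := hf
  obtain ⟨T, hT, hB⟩ := hg
  have d2 : IsDyadic (1 / 2) := by simpa using IsDyadic.half_pow 1
  have d1 : IsDyadic 1 := by simpa using IsDyadic.intCast 1
  have hL : ∀ x : ℝ, IsDyadic x → IsDyadic (x / 2) := fun x hx => by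
    have := hx.mul d2
    rwa [mul_one_div] at this
  have vL : ∀ s : I, (Thompson.glue f g (halfL s) : ℝ) = f s / 2 := fun s =>
    glueFun_left f g (halfL s) s (by change (s : ℝ) / 2 ≤ _; linarith [s.2.2])
      (by change (s : ℝ) = 2 * (s / 2); ring)
  have vR : ∀ s : I, (Thompson.glue f g (halfR s) : ℝ) = (g s + 1) / 2 := fun s =>
    glueFun_right f g (halfR s) s (by change _ ≤ ((s : ℝ) + 1) / 2; linarith [s.2.1])
      (by change (s : ℝ) = 2 * ((s + 1) / 2) - 1; ring)
  refine ⟨insert (halfR 0) (S.image halfL ∪ T.image halfR), ?_, ?_⟩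
  · intro s hs
    simp only [Finset.mem_insert, Finset.mem_union, Finset.mem_image] at hs
    rcases hs with rfl | ⟨r, hr, rfl⟩ | ⟨r, hr, rfl⟩
    · have h0 : g 0 = 0 := map_bot g
      rw [vR, h0]
      have e : (((0 : I) : ℝ) + 1) / 2 = 1 / 2 := by norm_num
      exact ⟨by change IsDyadic ((((0 : I) : ℝ) + 1) / 2); rwa [e], by rwa [e]⟩
    · rw [vL]
      exact ⟨hL _ (hS r hr).1, hL _ (hS r hr).2⟩
    · rw [vR]
      exact ⟨hL _ ((hT r hr).1.add d1), hL _ ((hT r hr).2.add d1)⟩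
  · intro a b hab h
    have hab' : (a : ℝ) ≤ b := hab
    have h12 : ((halfR 0 : I) : ℝ) = 1 / 2 := by
      change (((0 : I) : ℝ) + 1) / 2 = _; norm_num
    have key : (b : ℝ) ≤ 1 / 2 ∨ 1 / 2 ≤ (a : ℝ) := by
      by_contra! hc
      refine h (halfR 0) (by simp) ⟨?_, ?_⟩
      · change (a : ℝ) < (halfR 0 : I)
        rw [h12]; exact hc.2
      · change ((halfR 0 : I) : ℝ) < b
        rw [h12]; exact hc.1
    rcases key with hb | ha
    · obtain ⟨a', ha'⟩ := exists_double a (by linarith)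
      obtain ⟨b', hb'⟩ := exists_double b hb
      obtain ⟨k, hk⟩ := hA a' b' (show (a' : ℝ) ≤ b' by linarith) (by
        rintro s hs ⟨h1, h2⟩
        have h1' : (a' : ℝ) < s := h1
        have h2' : (s : ℝ) < b' := h2
        refine h (halfL s) ?_ ⟨?_, ?_⟩
        · simp only [Finset.mem_insert, Finset.mem_union, Finset.mem_image]
          exact Or.inr (Or.inl ⟨s, hs, rfl⟩)
        · change (a : ℝ) < s / 2; linarith
        · change (s : ℝ) / 2 < b; linarith)
      refine ⟨k, fun t hat htb => ?_⟩
      have hat' : (a : ℝ) ≤ t := hat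
      have htb' : (t : ℝ) ≤ b := htb
      obtain ⟨t', ht'⟩ := exists_double t (by linarith)
      change (glueFun f g t : ℝ) = glueFun f g a + _
      rw [glueFun_left f g t t' (by linarith) ht', glueFun_left f g a a' (by linarith) ha',
        hk t' (show (a' : ℝ) ≤ t' by linarith) (show (t' : ℝ) ≤ b' by linarith), ha', ht']
      ring
    · obtain ⟨a', ha'⟩ := exists_double_sub a ha
      obtain ⟨b', hb'⟩ := exists_double_sub b (by linarith)
      obtain ⟨k, hk⟩ := hB a' b' (show (a' : ℝ) ≤ b' by linarith) (by
        rintro s hs ⟨h1, h2⟩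
        have h1' : (a' : ℝ) < s := h1
        have h2' : (s : ℝ) < b' := h2
        refine h (halfR s) ?_ ⟨?_, ?_⟩
        · simp only [Finset.mem_insert, Finset.mem_union, Finset.mem_image]
          exact Or.inr (Or.inr ⟨s, hs, rfl⟩)
        · change (a : ℝ) < (s + 1) / 2; linarith
        · change ((s : ℝ) + 1) / 2 < b; linarith)
      refine ⟨k, fun t hat htb => ?_⟩
      have hat' : (a : ℝ) ≤ t := hat
      have htb' : (t : ℝ) ≤ b := htb
      obtain ⟨t', ht'⟩ := exists_double_sub t (by linarith)
      change (glueFun f g t : ℝ) = glueFun f g a + _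
      rw [glueFun_right f g t t' (by linarith) ht', glueFun_right f g a a' ha ha',
        hk t' (show (a' : ℝ) ≤ t' by linarith) (show (t' : ℝ) ≤ b' by linarith), ha', ht']
      ring

/-- The homomorphism `μ : F × F → F`, `(f, g) ↦ f * g`, where
`(f * g) t = f (2 t) / 2` for `t ≤ 1 / 2` and `(f * g) t = (g (2 t - 1) + 1) / 2` for
`t ≥ 1 / 2`. -/
def mu : F × F →* F where
  toFun p := ⟨glue p.1 p.2, p.1.2.glue p.2.2⟩
  map_one' := Subtype.ext (OrderIso.ext (funext glueFun_one))
  map_mul' p q := Subtype.ext (OrderIso.ext (funext fun t =>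
    (glueFun_comp p.1.1 p.2.1 q.1.1 q.2.1 t).symm))

/-! ### The generator `x₀` -/

/-- The map underlying `x₀`: it is affine from `[0,1/2]`, `[1/2,3/4]`, `[3/4,1]` onto
`[0,1/4]`, `[1/4,1/2]`, `[1/2,1]` respectively. -/
def x0Fun (t : ℝ) : ℝ := if t ≤ 1 / 2 then t / 2 else if t ≤ 3 / 4 then t - 1 / 4 else 2 * t - 1

/-- The inverse of `x0Fun`. -/
def x0Inv (t : ℝ) : ℝ := if t ≤ 1 / 4 then 2 * t else if t ≤ 1 / 2 then t + 1 / 4 else (t + 1) / 2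

/-- `x₀` as an order isomorphism of `[0,1]`. -/
def x0Iso : I ≃o I where
  toFun t := ⟨x0Fun t, by
    have h0 := t.2.1
    have h1 := t.2.2
    unfold x0Fun
    split_ifs <;> constructor <;> linarith⟩
  invFun t := ⟨x0Inv t, by
    have h0 := t.2.1
    have h1 := t.2.2
    unfold x0Inv
    split_ifs <;> constructor <;> linarith⟩
  left_inv t := Subtype.ext (by
    change x0Inv (x0Fun t) = t
    unfold x0Fun x0Inv
    split_ifs <;> linarith)
  right_inv t := Subtype.ext (by
    change x0Fun (x0Inv t) = t
    unfold x0Fun x0Inv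
    split_ifs <;> linarith)
  map_rel_iff' {a b} := by
    change x0Fun a ≤ x0Fun b ↔ (a : ℝ) ≤ b
    unfold x0Fun
    split_ifs <;> constructor <;> intro <;> linarith

theorem isDyadicPL_x0Iso : IsDyadicPL x0Iso := by
  have hv : ∀ t : I, (x0Iso t : ℝ) = x0Fun t := fun _ => rfl
  refine ⟨{⟨1 / 2, by norm_num, by norm_num⟩, ⟨3 / 4, by norm_num, by norm_num⟩}, ?_, ?_⟩
  · intro s hs
    simp only [Finset.mem_insert, Finset.mem_singleton] at hs
    rcases hs with rfl | rfl
    · rw [hv]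
      exact ⟨⟨1, 1, by norm_num⟩, ⟨1, 2, by norm_num [x0Fun]⟩⟩
    · rw [hv]
      exact ⟨⟨3, 2, by norm_num⟩, ⟨1, 1, by norm_num [x0Fun]⟩⟩
  · intro a b hab h
    have h1 := h ⟨1 / 2, by norm_num, by norm_num⟩ (by simp)
    have h2 := h ⟨3 / 4, by norm_num, by norm_num⟩ (by simp)
    rw [← Subtype.coe_lt_coe, ← Subtype.coe_lt_coe] at h1 h2
    simp only [not_and, not_lt] at h1 h2
    have hab' : (a : ℝ) ≤ b := hab
    rcases lt_or_ge (a : ℝ) (1 / 2) with ha | ha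
    · refine ⟨-1, fun t hat htb => ?_⟩
      have hat' : (a : ℝ) ≤ t := hat
      have htb' : (t : ℝ) ≤ b := htb
      have := h1 ha
      rw [hv, hv]
      simp only [x0Fun, zpow_neg_one]
      split_ifs <;> linarith
    · rcases lt_or_ge (a : ℝ) (3 / 4) with ha' | ha'
      · refine ⟨0, fun t hat htb => ?_⟩
        have hat' : (a : ℝ) ≤ t := hat
        have htb' : (t : ℝ) ≤ b := htb
        have := h2 ha'
        rw [hv, hv]
        simp only [x0Fun, zpow_zero]
        split_ifs <;> linarith
      · refine ⟨1, fun t hat htb => ?_⟩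
        have hat' : (a : ℝ) ≤ t := hat
        have htb' : (t : ℝ) ≤ b := htb
        rw [hv, hv]
        simp only [x0Fun, zpow_one]
        split_ifs <;> linarith

/-- The generator `x₀` of Thompson's group `F`. -/
def x0 : F := ⟨x0Iso, isDyadicPL_x0Iso⟩

/-! ### The homology ring -/

open IntegralHomology

/-- The product `H_p(F) × H_q(F) → H_{p+q}(F)` induced by `μ`: the cross product
`H_p(F) × H_q(F) → H_{p+q}(F × F)` followed by `μ_*`. -/
def product (p q : ℕ) : HZ F p →+ HZ F q →+ HZ F (p + q) :=
  (AddMonoidHom.compHom (pushforward mu (p + q))).comp (cross p q)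

instance : DirectSum.GNonUnitalNonAssocSemiring (fun n => HZ F n) where
  mul {p q} x y := product p q x y
  mul_zero x := map_zero (product _ _ x)
  zero_mul y := by
    change product _ _ 0 y = 0
    rw [map_zero, AddMonoidHom.zero_apply]
  mul_add x y z := map_add (product _ _ x) y z
  add_mul x y z := by
    rw [map_add, AddMonoidHom.add_apply]

/-- The integral homology `H_*(F)`, the direct sum of the groups `H_n(F)`. -/
abbrev HF : Type := ⨁ n, HZ F n

instance : NonUnitalNonAssocRing HF :=
  { (inferInstance : AddCommGroup HF), (inferInstance : NonUnitalNonAssocSemiring HF) with }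

/-- The inclusion of `H_n(F)` into `H_*(F)`. -/
abbrev incl (n : ℕ) : HZ F n →+ HF := DirectSum.of (fun n => HZ F n) n

/-- The element `ε` of `H_0(F)`: the canonical generator. -/
def epsilon : HF := incl 0 (pointClass F)

/-- The class of `x₀` in `H_1(F)`. -/
def x0Class : HF := incl 1 (elementClass x0)

end Thompson

end

open Thompson IntegralHomology

/-! Conjugation by $x_0$ reassociates the product: $((f*g)*h)\,x_0 = x_0\,(f*(g*h))$
(`mu_mu_mul_x0`). Conjugate homomorphisms are homotopic on bar chains (`bdB_slideL`), so the product
on homology is associative. For the shift $\tau f = 1*f$ this specializes to $\tau(g)\,x_0 =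
x_0\,\tau^2(g)$, so $\tau$ and $\tau^2$ are homotopic.

The additive structure comes from a small free resolution of $\mathbb Z$ over $\mathbb ZF$, a
cubical complex with vertex set $F$. A cube starts at a group element and attaches carets to
finitely many leaves of an infinite forest; attaching a caret to leaf $i$ is right multiplication by
$x_i=\tau^i(x_0)$. The elements of $F$ that carry every interval $[1-2^{-n},1-2^{-(n+1)}]$ affinely
onto a standard dyadic interval form the monoid of forests. Its divisibility properties
(`isForestMonoid_forests`) make $F$ a directed poset and allow the cubes below a vertex $u$ to be
contracted onto $u$ (`sub_contract_mem`, `exists_of_eqv_cubeD_eq_zero`). A chain map `theta` sends a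
cube to an iterated homotopy in the bar complex. The mapping cone is exact, free and bounded below,
so its coinvariants are exact (`exact_coinvariants`), and $\theta$ is an isomorphism on homology
(`exists_thetaL_eq`, `exists_bdL_eq_of_thetaL`).

Write $U$ for the shift of a word (`upL`) and $K$ for prefixing the letter $0$ (`pre 0`). In the
coinvariants $\partial U=U\partial$ and $\partial K=U^2-U-K\partial$. A direct computation shows
that every cycle is, modulo boundaries, $(UK-KU)b+s[0]+r[\,]$ with $b$ a cycle, the class of $b$ and
the integers $s,r$ being unique (`exists_of_bdL_eq_zero`, `eq_bdL_of_twist`).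

Under $\theta$ the operator $UK-KU$ becomes the commutator of $\tau$ with the homotopy belonging to
$x_0$. The pentagon relation $(x_0*1)\,x_0\,(1*x_0)=x_0^2$ identifies it, up to sign and boundaries,
with left multiplication by $x_0$ (`exists_twist`). Thus every element of $H_*(F)$ is uniquely
$\zeta b+s\zeta+r\varepsilon$ (`IsFreeGenerator`). The pentagon also gives
$\varepsilon\zeta+\zeta\varepsilon=\zeta$ (`exists_chainMul_nil_x0`).

The rest is algebra. Reading the decomposition degree by degree gives the bases $\varepsilon$ and
$\zeta^n,\zeta^n\varepsilon$; a map defined on these bases is multiplicative as soon as the two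
relations hold in the target (`existsUnique_hom`). The second presentation is the substitution
$\zeta=\alpha+\beta$. -/

noncomputable section

namespace IntegralHomology

open Finsupp

/-! ### Naturality of the bar complex, and the homotopy of a conjugation -/

section

variable {α β γ : Type}

/-- The map on linear combinations of words induced by a map of letters. -/
def mapL (f : α → β) : (List α →₀ ℤ) →ₗ[ℤ] (List β →₀ ℤ) := Finsupp.lmapDomain ℤ ℤ (List.map f)

theorem mapL_single (f : α → β) (u : List α) (c : ℤ) :
    mapL f (single u c) = single (u.map f) c := by simp [mapL]

theorem mapL_pre (f : α → β) (x : α) (w : List α →₀ ℤ) :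
    mapL f (pre x w) = pre (f x) (mapL f w) := by
  suffices mapL f ∘ₗ pre x = pre (f x) ∘ₗ mapL f from LinearMap.congr_fun this w
  exact lin_ext fun u => by simp [pre_single, mapL_single]

theorem mapL_mapL (f : α → β) (g : β → γ) (w : List α →₀ ℤ) :
    mapL g (mapL f w) = mapL (g ∘ f) w := by
  suffices mapL g ∘ₗ mapL f = mapL (g ∘ f) from LinearMap.congr_fun this w
  exact lin_ext fun u => by simp [mapL_single]

theorem cons_eq_pre (x : α) (u : List α) (c : ℤ) : single (x :: u) c = pre x (single u c) :=
  (pre_single x u c).symm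

/-- The homotopy between two homomorphisms `φ` and `ψ` with `φ g * h = h * ψ g`: the alternating
sum of the words `φ g₁, …, φ gᵢ, h, ψ gᵢ₊₁, …, ψ gₙ`. -/
def slide (φ ψ : α → β) (h : β) : List α → (List β →₀ ℤ)
  | [] => single [h] 1
  | g :: u => single (h :: ψ g :: u.map ψ) 1 - pre (φ g) (slide φ ψ h u)

/-- The linear extension of `slide`. -/
def slideL (φ ψ : α → β) (h : β) : (List α →₀ ℤ) →ₗ[ℤ] (List β →₀ ℤ) := lin (slide φ ψ h)

theorem slideL_nil (φ ψ : α → β) (h : β) (c : ℤ) :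
    slideL φ ψ h (single [] c) = single [h] c := by simp [slideL, lin_single, slide]

theorem slideL_pre (φ ψ : α → β) (h : β) (g : α) (w : List α →₀ ℤ) :
    slideL φ ψ h (pre g w) = pre h (pre (ψ g) (mapL ψ w)) - pre (φ g) (slideL φ ψ h w) := by
  suffices slideL φ ψ h ∘ₗ pre g = pre h ∘ₗ pre (ψ g) ∘ₗ mapL ψ - pre (φ g) ∘ₗ slideL φ ψ h from
    LinearMap.congr_fun this w
  exact lin_ext fun u => by simp [pre_single, slideL, lin_single, slide, mapL_single]

/-- The homotopy comparing the composite of two homotopies of the form `slide` with the homotopy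
belonging to the product. -/
def slide₂ (φ ψ χ : α → β) (h k : β) : List α → (List β →₀ ℤ)
  | [] => single [h, k] 1
  | g :: u => pre h (slide ψ χ k (g :: u)) + pre (φ g) (slide₂ φ ψ χ h k u)

/-- The linear extension of `slide₂`. -/
def slide₂L (φ ψ χ : α → β) (h k : β) : (List α →₀ ℤ) →ₗ[ℤ] (List β →₀ ℤ) :=
  lin (slide₂ φ ψ χ h k)

theorem slide₂L_nil (φ ψ χ : α → β) (h k : β) (c : ℤ) :
    slide₂L φ ψ χ h k (single [] c) = single [h, k] c := by simp [slide₂L, lin_single, slide₂]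

theorem slide₂L_pre (φ ψ χ : α → β) (h k : β) (g : α) (w : List α →₀ ℤ) :
    slide₂L φ ψ χ h k (pre g w) =
      pre h (slideL ψ χ k (pre g w)) + pre (φ g) (slide₂L φ ψ χ h k w) := by
  suffices slide₂L φ ψ χ h k ∘ₗ pre g =
      pre h ∘ₗ slideL ψ χ k ∘ₗ pre g + pre (φ g) ∘ₗ slide₂L φ ψ χ h k from
    LinearMap.congr_fun this w
  exact lin_ext fun u => by simp [pre_single, slideL, slide₂L, lin_single, slide₂]

end

section

variable {G H : Type} [Group G] [Group H]

/-- The linear extension of `faces g`. -/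
def facesL (g : G) : (List G →₀ ℤ) →ₗ[ℤ] (List G →₀ ℤ) := lin (faces g)

theorem facesL_nil (g : G) (c : ℤ) : facesL g (single [] c) = single [] c := by
  simp [facesL, lin_single, faces]

theorem facesL_pre (g h : G) (w : List G →₀ ℤ) :
    facesL g (pre h w) = pre (g * h) w - pre g (facesL h w) := by
  suffices facesL g ∘ₗ pre h = pre (g * h) - pre g ∘ₗ facesL h from LinearMap.congr_fun this w
  exact lin_ext fun u => by simp [pre_single, facesL, lin_single, faces]

theorem bdB_nil (c : ℤ) : lin bdB (single ([] : List G) c) = 0 := by simp [lin_single, bdB]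

theorem bdB_pre (g : G) (w : List G →₀ ℤ) : lin bdB (pre g w) = w - facesL g w := by
  suffices lin bdB ∘ₗ pre g = LinearMap.id - facesL g from LinearMap.congr_fun this w
  exact lin_ext fun u => by simp [pre_single, facesL, lin_single, bdB]

theorem mapL_facesL (φ : G →* H) (g : G) (w : List G →₀ ℤ) :
    mapL φ (facesL g w) = facesL (φ g) (mapL φ w) := by
  suffices mapL φ ∘ₗ facesL g = facesL (φ g) ∘ₗ mapL φ from LinearMap.congr_fun this w
  refine lin_ext fun u => ?_
  induction u generalizing g with
  | nil => simp [facesL_nil, mapL_single]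
  | cons h u ih =>
    have := ih h
    simp only [LinearMap.comp_apply] at this ⊢
    rw [cons_eq_pre, facesL_pre, map_sub, mapL_pre, mapL_pre, mapL_pre, facesL_pre, this, map_mul]

/-- This is the inductive core of `bdB_slideL`: only the faces other than the one dropping the first
letter are compared. The two `ψ`-terms come from the summand of `slide` that begins with `h`, the
last term is the word with all letters under `φ`, and `hφ` matches the two ways of merging `h` with
a neighbour. -/
theorem slideL_facesL {φ ψ : G →* H} {h : H} (hφ : ∀ g, φ g * h = h * ψ g) (g : G)
    (w : List G →₀ ℤ) :
    slideL φ ψ h (facesL g w) = facesL (φ g) (slideL φ ψ h w) + pre h (mapL ψ (facesL g w)) -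
      pre (h * ψ g) (mapL ψ w) + pre (φ g) (mapL φ w) := by
  suffices slideL φ ψ h ∘ₗ facesL g = facesL (φ g) ∘ₗ slideL φ ψ h + pre h ∘ₗ mapL ψ ∘ₗ facesL g -
      pre (h * ψ g) ∘ₗ mapL ψ + pre (φ g) ∘ₗ mapL φ from LinearMap.congr_fun this w
  refine lin_ext fun u => ?_
  induction u generalizing g with
  | nil =>
    simp only [LinearMap.comp_apply, LinearMap.add_apply, LinearMap.sub_apply]
    rw [facesL_nil, slideL_nil, cons_eq_pre, facesL_pre, facesL_nil, hφ]
    simp only [mapL_single, List.map_nil]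
    abel
  | cons k u ih =>
    have := ih k
    simp only [LinearMap.comp_apply, LinearMap.add_apply, LinearMap.sub_apply] at this ⊢
    rw [cons_eq_pre]
    simp only [facesL_pre, map_sub, slideL_pre, mapL_pre, this, map_add, map_mul, hφ,
      mapL_facesL]
    abel

/-- The prism operator of a natural transformation `h` between functors of one-object categories.
Faces merging `h` with its left and right neighbours cancel in consecutive summands; the words from
which `h` is dropped at either end survive. -/
theorem bdB_slideL {φ ψ : G →* H} {h : H} (hφ : ∀ g, φ g * h = h * ψ g) (w : List G →₀ ℤ) :
    lin bdB (slideL φ ψ h w) + slideL φ ψ h (lin bdB w) = mapL ψ w - mapL φ w := by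
  suffices lin bdB ∘ₗ slideL φ ψ h + slideL φ ψ h ∘ₗ lin bdB = mapL ψ - mapL φ from
    LinearMap.congr_fun this w
  refine lin_ext fun u => ?_
  simp only [LinearMap.comp_apply, LinearMap.add_apply, LinearMap.sub_apply]
  rcases u with _ | ⟨g, u⟩
  · rw [slideL_nil, bdB_nil, map_zero, cons_eq_pre, bdB_pre, facesL_nil]
    simp [mapL_single]
  · rw [cons_eq_pre, slideL_pre, bdB_pre, map_sub, bdB_pre, bdB_pre, map_sub, slideL_facesL hφ,
      mapL_pre, mapL_pre, facesL_pre, mapL_facesL]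
    abel

theorem slide₂L_facesL {φ ψ χ : G →* H} {h k : H} (hφ : ∀ g, φ g * h = h * ψ g)
    (hψ : ∀ g, ψ g * k = k * χ g) (g : G) (w : List G →₀ ℤ) :
    slide₂L φ ψ χ h k (facesL g w) = facesL (φ g) (slide₂L φ ψ χ h k w) +
      facesL h (slideL ψ χ k (pre g w)) - slideL φ χ (h * k) (pre g w) +
      slideL φ ψ h (pre g w) := by
  suffices slide₂L φ ψ χ h k ∘ₗ facesL g = facesL (φ g) ∘ₗ slide₂L φ ψ χ h k +
      facesL h ∘ₗ slideL ψ χ k ∘ₗ pre g - slideL φ χ (h * k) ∘ₗ pre g +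
      slideL φ ψ h ∘ₗ pre g from LinearMap.congr_fun this w
  refine lin_ext fun u => ?_
  induction u generalizing g with
  | nil =>
    simp only [LinearMap.comp_apply, LinearMap.add_apply, LinearMap.sub_apply]
    simp only [facesL_nil, slide₂L_nil, slideL_pre, slideL_nil, cons_eq_pre, facesL_pre, map_sub,
      mapL_single, List.map_nil, hφ, hψ]
    abel
  | cons l u ih =>
    have := ih l
    simp only [LinearMap.comp_apply, LinearMap.add_apply, LinearMap.sub_apply] at this ⊢
    rw [cons_eq_pre]
    simp only [facesL_pre, map_sub, map_add, slide₂L_pre, slideL_pre, mapL_pre, this, map_mul, hφ,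
      hψ, mapL_facesL, slideL_facesL hψ]
    abel

/-- The prism over a triangle: for composable natural transformations `h` and `k`, the three side
faces are the homotopies of `k`, of `h * k` and of `h`. -/
theorem bdB_slide₂L {φ ψ χ : G →* H} {h k : H} (hφ : ∀ g, φ g * h = h * ψ g)
    (hψ : ∀ g, ψ g * k = k * χ g) (w : List G →₀ ℤ) :
    lin bdB (slide₂L φ ψ χ h k w) - slide₂L φ ψ χ h k (lin bdB w) =
      slideL ψ χ k w - slideL φ χ (h * k) w + slideL φ ψ h w := by
  suffices lin bdB ∘ₗ slide₂L φ ψ χ h k - slide₂L φ ψ χ h k ∘ₗ lin bdB =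
      slideL ψ χ k - slideL φ χ (h * k) + slideL φ ψ h from LinearMap.congr_fun this w
  refine lin_ext fun u => ?_
  simp only [LinearMap.comp_apply, LinearMap.add_apply, LinearMap.sub_apply]
  rcases u with _ | ⟨g, u⟩
  · rw [slide₂L_nil, bdB_nil, map_zero]
    simp only [slideL_nil, cons_eq_pre, bdB_pre, facesL_pre, facesL_nil]
    abel
  · rw [cons_eq_pre, slide₂L_pre, bdB_pre, map_add, bdB_pre, bdB_pre, map_sub,
      slide₂L_facesL hφ hψ]
    abel

end

end IntegralHomology

end

noncomputable section

/-! ### The complex of forests -/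

namespace ForestComplex

open Finsupp IntegralHomology

/-- Add one to the first letter. -/
def up : List ℕ → List ℕ
  | [] => []
  | a :: l => (a + 1) :: l

/-- The linear extension of `up`. -/
def upL : (List ℕ →₀ ℤ) →ₗ[ℤ] (List ℕ →₀ ℤ) := Finsupp.lmapDomain ℤ ℤ up

theorem upL_single (l : List ℕ) (c : ℤ) : upL (single l c) = single (up l) c := by simp [upL]

/-- The boundary of a cube of forests: the word `a₁ ⋯ aₙ` stands for the cube spanned by
carets attached to the `n` leaves which are preceded by `a₁`, `a₁ + 1 + a₂`, … leaves. -/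
def bd : List ℕ → (List ℕ →₀ ℤ)
  | [] => 0
  | a :: l => upL^[a] (upL (upL (single l 1)) - upL (single l 1) - pre 0 (bd l))

/-- The linear extension of `bd`. -/
def bdL : (List ℕ →₀ ℤ) →ₗ[ℤ] (List ℕ →₀ ℤ) := lin bd

theorem bdL_nil (c : ℤ) : bdL (single [] c) = 0 := by simp [bdL, lin_single, bd]

theorem bdL_upL (w : List ℕ →₀ ℤ) : bdL (upL w) = upL (bdL w) := by
  suffices bdL ∘ₗ upL = upL ∘ₗ bdL from LinearMap.congr_fun this w
  refine lin_ext fun l => ?_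
  rcases l with _ | ⟨a, l⟩
  · simp [bdL_nil, upL_single, up]
  · simp only [LinearMap.comp_apply, upL_single, up, bdL, lin_single, one_smul, bd]
    rw [Function.iterate_succ_apply']

/-- Every word arises from `[]` by `up` and by prefixing `0`, so this formula, `bdL_upL` and
`bdL_nil` determine the differential. It has the shape of `bdB_slideL` with `upL` as `φ` and its
square as `ψ`. -/
theorem bdL_pre (w : List ℕ →₀ ℤ) :
    bdL (pre 0 w) = upL (upL w) - upL w - pre 0 (bdL w) := by
  suffices bdL ∘ₗ pre 0 = upL ∘ₗ upL - upL - pre 0 ∘ₗ bdL from LinearMap.congr_fun this w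
  exact lin_ext fun l => by simp [pre_single, bdL, lin_single, bd]

/-- The left inverse of `upL` that kills the words beginning with `0`. -/
def downL : (List ℕ →₀ ℤ) →ₗ[ℤ] (List ℕ →₀ ℤ) := lin fun
  | [] => single [] 1
  | 0 :: _ => 0
  | (a + 1) :: l => single (a :: l) 1

/-- The left inverse of `pre 0` that kills the words not beginning with `0`. -/
def headL : (List ℕ →₀ ℤ) →ₗ[ℤ] (List ℕ →₀ ℤ) := lin fun
  | [] => 0
  | 0 :: l => single l 1
  | (_ + 1) :: _ => 0

theorem upL_downL_add (w : List ℕ →₀ ℤ) : upL (downL w) + pre 0 (headL w) = w := by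
  suffices upL ∘ₗ downL + pre 0 ∘ₗ headL = LinearMap.id from LinearMap.congr_fun this w
  refine lin_ext fun l => ?_
  rcases l with _ | ⟨_ | a, l⟩ <;> simp [upL_single, downL, headL, lin_single, pre_single, up]

theorem downL_upL (w : List ℕ →₀ ℤ) : downL (upL w) = w := by
  suffices downL ∘ₗ upL = LinearMap.id from LinearMap.congr_fun this w
  refine lin_ext fun l => ?_
  rcases l with _ | ⟨a, l⟩ <;> simp [upL_single, downL, lin_single, up]

theorem headL_upL (w : List ℕ →₀ ℤ) : headL (upL w) = 0 := by
  suffices headL ∘ₗ upL = 0 from LinearMap.congr_fun this w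
  refine lin_ext fun l => ?_
  rcases l with _ | ⟨a, l⟩ <;> simp [upL_single, headL, lin_single, up]

theorem downL_pre (w : List ℕ →₀ ℤ) : downL (pre 0 w) = 0 := by
  suffices downL ∘ₗ pre 0 = 0 from LinearMap.congr_fun this w
  exact lin_ext fun l => by simp [pre_single, downL, lin_single]

theorem headL_pre (w : List ℕ →₀ ℤ) : headL (pre 0 w) = w := by
  suffices headL ∘ₗ pre 0 = LinearMap.id from LinearMap.congr_fun this w
  exact lin_ext fun l => by simp [pre_single, headL, lin_single]

theorem eq_of_upL_add_eq {a b c d : List ℕ →₀ ℤ} (h : upL a + pre 0 b = upL c + pre 0 d) :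
    a = c ∧ b = d := by
  constructor
  · simpa [downL_upL, downL_pre] using congr_arg downL h
  · simpa [headL_upL, headL_pre] using congr_arg headL h

theorem up_injective : Function.Injective up := by
  intro l l' h
  rcases l with _ | ⟨a, l⟩ <;> rcases l' with _ | ⟨b, l'⟩ <;> simp_all [up]

theorem upL_apply_up (w : List ℕ →₀ ℤ) (l : List ℕ) : upL w (up l) = w l :=
  Finsupp.mapDomain_apply up_injective w l

theorem pre_apply_up (w : List ℕ →₀ ℤ) (l : List ℕ) : pre 0 w (up l) = 0 := by
  refine Finsupp.mapDomain_of_notMem_range w _ ?_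
  rcases l with _ | ⟨b, l⟩ <;> simp [up]

/-! ### Cycles and boundaries of the complex of forests -/

/-- A chain that is fixed by `upL` modulo words beginning with `0` is a multiple of the empty
word. -/
theorem eq_nil_of_sub_upL {r q : List ℕ →₀ ℤ} (h : r - upL r = pre 0 q) :
    q = 0 ∧ ∃ c, r = single [] c := by
  have hs : ∀ a l, r ((a + 1) :: l) = r (a :: l) := fun a l => by
    have := DFunLike.congr_fun h (up (a :: l))
    rw [Finsupp.sub_apply, pre_apply_up, upL_apply_up] at this
    exact sub_eq_zero.1 this
  have hz : ∀ a l, r (a :: l) = 0 := by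
    intro a l
    have ha : ∀ b, r ((a + b) :: l) = r (a :: l) := fun b => by
      induction b with
      | zero => rfl
      | succ b ih => exact (hs (a + b) l).trans ih
    by_contra hne
    -- The coefficients are constant along an infinite family of words, but the support is finite.
    have hinf : (Set.range fun b : ℕ => (a + b) :: l).Infinite :=
      Set.infinite_range_of_injective fun b c hbc => by simpa using hbc
    refine hinf (r.support.finite_toSet.subset ?_)
    rintro _ ⟨b, rfl⟩
    simpa [ha b] using hne
  have hr : r = single [] (r []) := by
    ext l
    rcases l with _ | ⟨a, l⟩
    · simp
    · simp [hz]
  refine ⟨?_, _, hr⟩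
  rw [hr, upL_single, up, sub_self] at h
  simpa [headL_pre] using (congr_arg headL h).symm

theorem bdL_apply_nil (w : List ℕ →₀ ℤ) : bdL w [] = 0 := by
  suffices (Finsupp.lapply []) ∘ₗ bdL = (0 : (List ℕ →₀ ℤ) →ₗ[ℤ] ℤ) from
    LinearMap.congr_fun this w
  have hu : ∀ v : List ℕ →₀ ℤ, upL v [] = v [] := fun v => upL_apply_up v []
  refine lin_ext fun l => ?_
  rcases l with _ | ⟨a, l⟩
  · simp [bdL_nil]
  · simp only [bdL, lin_single, bd, LinearMap.comp_apply, one_smul, Finsupp.lapply_apply,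
      LinearMap.zero_apply]
    induction a with
    | zero =>
      rw [Function.iterate_zero, id, Finsupp.sub_apply, Finsupp.sub_apply, hu, hu, sub_self,
        show ([] : List ℕ) = up [] from rfl, pre_apply_up, sub_zero]
    | succ a ih => rw [Function.iterate_succ_apply', hu, ih]

/-- By `bdL_pre`, `upL (upL w)` and `upL w` agree modulo boundaries and words beginning with `0`.
Hence a first letter at least `2` can be lowered until it is `1`. -/
theorem exists_reduction (A : List ℕ →₀ ℤ) :
    ∃ Y b c r, upL A = bdL Y + upL (pre 0 b) + pre 0 c + single [] r := by
  induction A using Finsupp.induction_linear with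
  | zero => exact ⟨0, 0, 0, 0, by simp⟩
  | add f g hf hg =>
    obtain ⟨Y, b, c, r, h⟩ := hf
    obtain ⟨Y', b', c', r', h'⟩ := hg
    refine ⟨Y + Y', b + b', c + c', r + r', ?_⟩
    simp only [map_add, h, h', Finsupp.single_add]
    abel
  | single l z =>
    rcases l with _ | ⟨a, l⟩
    · exact ⟨0, 0, 0, z, by simp [upL_single, up]⟩
    induction a with
    | zero => exact ⟨0, single l z, 0, 0, by simp [pre_single]⟩
    | succ a ih =>
      obtain ⟨Y, b, c, r, h⟩ := ih
      refine ⟨pre 0 (single (a :: l) z) + Y, b, c + bdL (single (a :: l) z), r, ?_⟩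
      have e : single ((a + 1) :: l) z = upL (single (a :: l) z) := by rw [upL_single, up]
      rw [map_add, bdL_pre, e, map_add (pre 0)]
      rw [← sub_eq_zero] at h ⊢
      rw [← h]
      abel

theorem bdL_bdL (w : List ℕ →₀ ℤ) : bdL (bdL w) = 0 := by
  suffices bdL ∘ₗ bdL = (0 : (List ℕ →₀ ℤ) →ₗ[ℤ] (List ℕ →₀ ℤ)) from LinearMap.congr_fun this w
  refine lin_ext fun l => ?_
  simp only [LinearMap.comp_apply, LinearMap.zero_apply]
  induction l with
  | nil => simp [bdL_nil]
  | cons a l ih =>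
    induction a with
    | zero => rw [cons_eq_pre, bdL_pre, map_sub, map_sub, bdL_pre]; simp [bdL_upL, ih]
    | succ a ih' =>
      rw [show single ((a + 1) :: l) (1 : ℤ) = upL (single (a :: l) 1) by rw [upL_single, up],
        bdL_upL, bdL_upL, ih', map_zero]

/-- After the reduction only words beginning with `1` (from `b`), with `0` (from `c`) and the empty
word remain. Splitting `c` further by its first letter puts the boundary into a form whose pieces
can be separated with `eq_of_upL_add_eq`. -/
theorem exists_normal_form (k : List ℕ →₀ ℤ) :
    ∃ Y b c p q r, k = bdL Y + upL (pre 0 b) + pre 0 c + single [] r ∧ c = upL p + pre 0 q ∧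
      bdL k = upL (upL (upL b - b + c - p) - pre 0 (bdL b + q)) - pre 0 (bdL c) := by
  obtain ⟨Y, b, c, r, h⟩ := exists_reduction (downL k)
  have hk : k = bdL Y + upL (pre 0 b) + pre 0 (c + headL k) + single [] r := by
    conv_lhs => rw [← upL_downL_add k, h]
    rw [map_add]
    abel
  refine ⟨Y, b, c + headL k, downL (c + headL k), headL (c + headL k), r, hk,
    (upL_downL_add _).symm, ?_⟩
  generalize c + headL k = c at *
  have hc := upL_downL_add c
  generalize downL c = p at *
  generalize headL c = q at *
  rw [hk, map_add, map_add, map_add, bdL_bdL, bdL_upL, bdL_pre, bdL_pre, bdL_nil]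
  have : upL c = upL (upL p) + upL (pre 0 q) := by rw [← map_add, hc]
  simp only [map_add, map_sub, this]
  abel

/-- Every cycle is homologous to one of a special form. -/
theorem exists_of_bdL_eq_zero (k : List ℕ →₀ ℤ) (hk : bdL k = 0) :
    ∃ Y b s r, bdL b = 0 ∧
      k = bdL Y + (upL (pre 0 b) - pre 0 (upL b)) + single [0] s + single [] r := by
  obtain ⟨Y, b, c, p, q, r, h, hc, hd⟩ := exists_normal_form k
  rw [hk] at hd
  obtain ⟨h1, h2⟩ := eq_of_upL_add_eq (a := 0) (b := 0)
    (c := upL (upL b - b + c - p) - pre 0 (bdL b + q)) (d := - bdL c) (by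
      rw [map_zero, map_zero, add_zero, map_neg, ← sub_eq_add_neg, ← hd])
  obtain ⟨h3, h4⟩ := eq_of_upL_add_eq (a := 0) (b := 0)
    (c := upL b - b + c - p) (d := - (bdL b + q)) (by
      rw [map_zero, map_zero, add_zero, map_neg, ← sub_eq_add_neg, ← h1])
  -- The vanishing of `upL b - b + c - p`, together with `c = upL p + pre 0 q`, says that `p + b` is
  -- fixed by `upL` modulo words beginning with `0`.
  obtain ⟨hq, s, hs⟩ := eq_nil_of_sub_upL (r := p + b) (q := q) (by
    have e : c - upL p = pre 0 q := by rw [hc]; abel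
    rw [← e, map_add, ← sub_eq_zero, ← neg_eq_zero, h3]
    abel)
  have hcb : c = single [] s - upL b := by
    have e : p = single [] s - b := by rw [← hs]; abel
    rw [hc, hq, map_zero, add_zero, e, map_sub, upL_single, up]
  refine ⟨Y, b, s, r, ?_, ?_⟩
  · rw [hq, add_zero] at h4
    simpa using h4.symm
  · rw [cons_eq_pre, h, hcb, map_sub]
    abel

/-- Uniqueness in `exists_of_bdL_eq_zero`: the normal form of `Y` is compared with the given
boundary letter by letter. The integers are read off from coefficients of the empty word, which are
zero in every boundary. -/
theorem eq_bdL_of_twist (b Y : List ℕ →₀ ℤ) (s r : ℤ)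
    (h : bdL Y = upL (pre 0 b) - pre 0 (upL b) + single [0] s + single [] r) :
    s = 0 ∧ r = 0 ∧ ∃ p, b = bdL p := by
  have hr : r = 0 := by
    have := DFunLike.congr_fun h []
    rw [bdL_apply_nil, Finsupp.add_apply, Finsupp.add_apply, Finsupp.sub_apply,
      show upL (pre 0 b) [] = 0 from (upL_apply_up _ []).trans (pre_apply_up _ []),
      show pre 0 (upL b) [] = 0 from pre_apply_up _ []] at this
    simpa using this.symm
  obtain ⟨-, p, c, c₁, c₂, -, -, hc, hd⟩ := exists_normal_form Y
  rw [h, hr, Finsupp.single_zero, add_zero, cons_eq_pre] at hd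
  obtain ⟨h1, h2⟩ := eq_of_upL_add_eq (a := pre 0 b) (b := single [] s - upL b)
    (c := upL (upL p - p + c - c₁) - pre 0 (bdL p + c₂)) (d := - bdL c) (by
      rw [map_neg, ← sub_eq_add_neg, ← hd, map_sub]
      abel)
  obtain ⟨h3, h4⟩ := eq_of_upL_add_eq (a := 0) (b := b)
    (c := upL p - p + c - c₁) (d := - (bdL p + c₂)) (by
      rw [map_zero, zero_add, map_neg, ← sub_eq_add_neg, ← h1])
  obtain ⟨hq, -⟩ := eq_nil_of_sub_upL (r := c₁ + p) (q := c₂) (by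
    have e : c - upL c₁ = pre 0 c₂ := by rw [hc]; abel
    rw [← e, map_add, ← sub_eq_zero, ← neg_eq_zero, h3]
    abel)
  have hb : b = bdL (-p) := by rw [h4, hq, add_zero, map_neg]
  refine ⟨?_, hr, -p, hb⟩
  have := DFunLike.congr_fun h2 []
  rw [Finsupp.neg_apply, bdL_apply_nil, Finsupp.sub_apply,
    show upL b [] = b [] from upL_apply_up _ [], hb, bdL_apply_nil] at this
  simpa using this

end ForestComplex

end

noncomputable section

/-! ### Free modules over a group ring -/

namespace FreeAction

open Finsupp

variable {G X Y Z : Type}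

/-- The inclusion of `ℤ[X]` in `ℤ[G × X]` as `g • ℤ[X]`. -/
def tens (g : G) : (X →₀ ℤ) →ₗ[ℤ] (G × X →₀ ℤ) := lmapDomain ℤ ℤ (Prod.mk g)

theorem tens_single (g : G) (x : X) (c : ℤ) : tens g (single x c) = single (g, x) c := by
  simp [tens]

/-- The projection of `ℤ[G × X]` onto its coinvariants `ℤ[X]`. -/
def proj : (G × X →₀ ℤ) →ₗ[ℤ] (X →₀ ℤ) := lmapDomain ℤ ℤ Prod.snd

theorem proj_single (p : G × X) (c : ℤ) : proj (single p c) = single p.2 c := by simp [proj]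

theorem proj_tens (g : G) (w : X →₀ ℤ) : proj (tens g w) = w := by
  suffices proj ∘ₗ tens g = (LinearMap.id : (X →₀ ℤ) →ₗ[ℤ] _) from LinearMap.congr_fun this w
  exact Finsupp.lhom_ext' fun x => LinearMap.ext_ring (by simp [tens_single, proj_single])

theorem ext_single {M : Type} [AddCommGroup M] {f g : (X →₀ ℤ) →ₗ[ℤ] M}
    (h : ∀ x, f (single x 1) = g (single x 1)) : f = g :=
  Finsupp.lhom_ext' fun u => LinearMap.ext_ring (h u)

variable [Group G]

/-- The action of `g` on `ℤ[G × X]`. -/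
def transL (g : G) : (G × X →₀ ℤ) →ₗ[ℤ] (G × X →₀ ℤ) := lmapDomain ℤ ℤ fun p => (g * p.1, p.2)

theorem transL_single (g : G) (p : G × X) (c : ℤ) :
    transL g (single p c) = single (g * p.1, p.2) c := by simp [transL]

theorem transL_tens (g h : G) (w : X →₀ ℤ) : transL g (tens h w) = tens (g * h) w := by
  suffices transL g ∘ₗ tens h = (tens (g * h) : (X →₀ ℤ) →ₗ[ℤ] _) from LinearMap.congr_fun this w
  exact ext_single fun x => by simp [tens_single, transL_single]

theorem transL_transL (g h : G) (z : G × X →₀ ℤ) : transL g (transL h z) = transL (g * h) z := by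
  suffices transL g ∘ₗ transL h = (transL (g * h) : (G × X →₀ ℤ) →ₗ[ℤ] _) from
    LinearMap.congr_fun this z
  exact ext_single fun x => by simp [transL_single, mul_assoc]

theorem transL_one (z : G × X →₀ ℤ) : transL 1 z = z := by
  suffices transL 1 = (LinearMap.id : (G × X →₀ ℤ) →ₗ[ℤ] _) from LinearMap.congr_fun this z
  exact ext_single fun x => by simp [transL_single]

theorem proj_transL (g : G) (z : G × X →₀ ℤ) : proj (transL g z) = proj z := by
  suffices proj ∘ₗ transL g = (proj : (G × X →₀ ℤ) →ₗ[ℤ] _) from LinearMap.congr_fun this z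
  exact ext_single fun x => by simp [transL_single, proj_single]

/-- The equivariant extension of a map defined on a basis. -/
def eqv (φ : X → (G × Y →₀ ℤ)) : (G × X →₀ ℤ) →ₗ[ℤ] (G × Y →₀ ℤ) :=
  linearCombination ℤ fun p : G × X => transL p.1 (φ p.2)

theorem eqv_single (φ : X → (G × Y →₀ ℤ)) (p : G × X) (c : ℤ) :
    eqv φ (single p c) = c • transL p.1 (φ p.2) := by simp [eqv]

theorem eqv_one (φ : X → (G × Y →₀ ℤ)) (x : X) : eqv φ (single (1, x) 1) = φ x := by
  simp [eqv_single, transL_one]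

theorem eqv_transL (φ : X → (G × Y →₀ ℤ)) (g : G) (z : G × X →₀ ℤ) :
    eqv φ (transL g z) = transL g (eqv φ z) := by
  suffices eqv φ ∘ₗ transL g = transL g ∘ₗ eqv φ from LinearMap.congr_fun this z
  exact ext_single fun x => by simp [transL_single, eqv_single, transL_transL]

theorem ext_one {f g : (G × X →₀ ℤ) →ₗ[ℤ] (G × Y →₀ ℤ)}
    (hf : ∀ h z, f (transL h z) = transL h (f z)) (hg : ∀ h z, g (transL h z) = transL h (g z))
    (h : ∀ x, f (single (1, x) 1) = g (single (1, x) 1)) : f = g :=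
  ext_single fun p => by
    have e : single p (1 : ℤ) = transL p.1 (single (1, p.2) 1) := by simp [transL_single]
    rw [e, hf, hg, h]

theorem proj_eqv (φ : X → (G × Y →₀ ℤ)) (z : G × X →₀ ℤ) :
    proj (eqv φ z) = linearCombination ℤ (fun x => proj (φ x)) (proj z) := by
  suffices proj ∘ₗ eqv φ = linearCombination ℤ (fun x => proj (φ x)) ∘ₗ proj from
    LinearMap.congr_fun this z
  exact ext_single fun x => by simp [eqv_single, proj_single, proj_transL]

theorem supported_induction {X : Type} {S : Set X} {p : (X →₀ ℤ) → Prop} (h0 : p 0)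
    (hadd : ∀ f g, p f → p g → p (f + g)) (hs : ∀ x ∈ S, ∀ c, p (single x c)) {z : X →₀ ℤ}
    (hz : ↑z.support ⊆ S) : p z := by
  classical
  rw [← Finsupp.sum_single z]
  unfold Finsupp.sum
  exact Finset.sum_induction _ p hadd h0 fun x hx => hs x (hz hx) _

/-- A partial equivariant contraction of an exact complex of free modules. -/
theorem exists_contraction (D : X → (G × X →₀ ℤ)) (deg : X → ℕ)
    (hdeg : ∀ x, ∀ p ∈ (D x).support, deg p.2 < deg x) (hD : ∀ z, eqv D (eqv D z) = 0)
    (hex : ∀ z, eqv D z = 0 → ∃ y, eqv D y = z) (n : ℕ) :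
    ∃ s : X → (G × X →₀ ℤ), ∀ z : G × X →₀ ℤ, (∀ p ∈ z.support, deg p.2 < n) →
      eqv D (eqv s z) + eqv s (eqv D z) = z := by
  classical
  induction n with
  | zero =>
    refine ⟨fun _ => 0, fun z hz => ?_⟩
    have : z = 0 := by
      rw [← Finsupp.support_eq_empty, Finset.eq_empty_iff_forall_notMem]
      exact fun p hp => absurd (hz p hp) (Nat.not_lt_zero _)
    simp [this]
  | succ n ih =>
    obtain ⟨s, hs⟩ := ih
    have key : ∀ x, ∃ y, deg x ≤ n → eqv D y + eqv s (D x) = single (1, x) 1 := by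
      intro x
      by_cases hx : deg x ≤ n
      -- All terms of `D x` have degree below `n`, so the contraction identity already holds for `D
      -- x` and shows that this chain is a cycle.
      · obtain ⟨y, hy⟩ := hex (single (1, x) 1 - eqv s (D x)) (by
          have h1 := hs (D x) fun p hp => (hdeg x p hp).trans_le hx
          have h2 : eqv D (D x) = 0 := by rw [← eqv_one D x, hD]
          rw [h2, map_zero, add_zero] at h1
          rw [map_sub, eqv_one, h1, sub_self])
        exact ⟨y, fun _ => by rw [hy, sub_add_cancel]⟩
      · exact ⟨0, fun h => absurd h hx⟩
    choose t ht using key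
    -- The old values are kept in degrees below `n`, so that the identity already proved there
    -- persists.
    let s' : X → (G × X →₀ ℤ) := fun x => if deg x < n then s x else t x
    have hss' : ∀ z : G × X →₀ ℤ, (∀ p ∈ z.support, deg p.2 < n) → eqv s' z = eqv s z := by
      intro z hz
      refine supported_induction (S := {p : G × X | deg p.2 < n}) (p := fun z => eqv s' z = eqv s z)
        (by simp) (fun f g hf hg => by rw [map_add, map_add, hf, hg]) (fun p hp c => ?_)
        (fun p hp => hz p hp)
      have hp' : deg p.2 < n := hp
      simp [eqv_single, s', hp']
    refine ⟨s', fun z hz => ?_⟩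
    refine supported_induction (S := {p : G × X | deg p.2 < n + 1})
      (p := fun z => eqv D (eqv s' z) + eqv s' (eqv D z) = z)
        (by simp) (fun f g hf hg => ?_) (fun p hp c => ?_) (fun p hp => hz p hp)
    · simp only [map_add]
      rw [add_add_add_comm, hf, hg]
    · have e : single p c = c • transL p.1 (single (1, p.2) 1) := by simp [transL_single]
      have hp' : deg p.2 ≤ n := Nat.lt_succ_iff.1 hp
      rw [e]
      simp only [map_smul, eqv_transL, eqv_one]
      rw [← smul_add, ← map_add]
      congr 2
      rw [hss' (D p.2) fun q hq => (hdeg _ q hq).trans_le hp']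
      by_cases h : deg p.2 < n
      · have := hs (single (1, p.2) 1) fun q hq => by
          obtain rfl : q = (1, p.2) := by simpa using (Finsupp.support_single_subset hq)
          exact h
        rw [eqv_one, eqv_one] at this
        simp only [s', h, if_true]
        exact this
      · simp only [s', h, if_false]
        exact ht _ hp'

/-- The coinvariants of an exact complex of free modules (bounded below) are exact. -/
theorem exact_coinvariants (D : X → (G × X →₀ ℤ)) (deg : X → ℕ)
    (hdeg : ∀ x, ∀ p ∈ (D x).support, deg p.2 < deg x) (hD : ∀ z, eqv D (eqv D z) = 0)
    (hex : ∀ z, eqv D z = 0 → ∃ y, eqv D y = z) (z : X →₀ ℤ)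
    (hz : linearCombination ℤ (fun x => proj (D x)) z = 0) :
    ∃ y, linearCombination ℤ (fun x => proj (D x)) y = z := by
  -- Since `s` is equivariant it descends to coinvariants, where the term `s D` depends only on the
  -- projected boundary of `z`, which is zero. A contraction up to the top degree of `z` is enough.
  obtain ⟨s, hs⟩ := exists_contraction D deg hdeg hD hex (z.support.sup deg + 1)
  have h := hs (tens 1 z) fun p hp => by
    classical
    obtain ⟨x, hx, rfl⟩ := Finset.mem_image.1 (Finsupp.mapDomain_support hp)
    exact Nat.lt_succ_of_le (Finset.le_sup (f := deg) hx)
  replace h := congr_arg proj h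
  rw [map_add, proj_eqv D, proj_eqv s (eqv D _), proj_eqv D, proj_tens, hz, map_zero,
    add_zero] at h
  exact ⟨_, h⟩

end FreeAction

end

noncomputable section

/-! ### The bar resolution and the resolution by forests -/

namespace ForestComplex

open Finsupp IntegralHomology FreeAction

section

variable {G : Type}

/-- The augmentation of the bar resolution. -/
def barAug : (G × List G →₀ ℤ) →ₗ[ℤ] ℤ := linearCombination ℤ fun p => if p.2 = [] then 1 else 0

theorem barAug_single (h : G) (u : List G) (c : ℤ) :
    barAug (single (h, u) c) = c * if u = [] then 1 else 0 := by simp [barAug]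

theorem barAug_tens (g : G) (w : List G →₀ ℤ) : barAug (tens g w) = w [] := by
  suffices barAug ∘ₗ tens g = Finsupp.lapply [] from LinearMap.congr_fun this w
  refine lin_ext fun u => ?_
  simp [tens_single, barAug_single, Finsupp.single_apply]

variable [Group G]

/-- The differential of the bar resolution. -/
def barD : List G → (G × List G →₀ ℤ)
  | [] => 0
  | g :: u => single (g, u) 1 - tens 1 (faces g u)

theorem eqv_barD_pre (h g : G) (w : List G →₀ ℤ) :
    eqv barD (tens h (pre g w)) = tens (h * g) w - tens h (facesL g w) := by
  suffices eqv barD ∘ₗ tens h ∘ₗ pre g = tens (h * g) - tens h ∘ₗ facesL g from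
    LinearMap.congr_fun this w
  refine lin_ext fun u => ?_
  simp [pre_single, tens_single, eqv_single, barD, transL_single, transL_tens, facesL, lin_single]

theorem eqv_barD_nil (h : G) (c : ℤ) : eqv barD (single (h, []) c) = 0 := by
  simp [eqv_single, barD]

/-- The contraction of the bar resolution. -/
def barS : (G × List G →₀ ℤ) →ₗ[ℤ] (G × List G →₀ ℤ) :=
  lmapDomain ℤ ℤ fun p => (1, p.1 :: p.2)

theorem barS_tens (h : G) (w : List G →₀ ℤ) : barS (tens h w) = tens 1 (pre h w) := by
  suffices barS ∘ₗ tens h = tens 1 ∘ₗ pre h from LinearMap.congr_fun this w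
  exact lin_ext fun u => by simp [tens_single, barS, pre_single]

theorem barAug_transL (h : G) (z : G × List G →₀ ℤ) : barAug (transL h z) = barAug z := by
  suffices barAug ∘ₗ transL h = barAug from LinearMap.congr_fun this z
  exact ext_single fun p => by rw [LinearMap.comp_apply, transL_single, barAug_single, barAug_single]

theorem faces_ne_nil (g h : G) (u : List G) : faces g (h :: u) [] = 0 := by
  rw [faces, Finsupp.sub_apply]
  have : ∀ w : List G →₀ ℤ, pre g w [] = 0 := aug_pre g
  rw [this]
  simp

theorem barAug_eqv_barD (z : G × List G →₀ ℤ) : barAug (eqv barD z) = 0 := by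
  suffices barAug ∘ₗ eqv (barD (G := G)) = 0 from LinearMap.congr_fun this z
  refine ext_single fun p => ?_
  rw [LinearMap.comp_apply, eqv_single, one_smul, barAug_transL]
  rcases p with ⟨g, _ | ⟨a, _ | ⟨b, u⟩⟩⟩
  · simp [barD]
  · simp [barD, barAug_single, barAug_tens, faces]
  · simp [barD, barAug_single, barAug_tens, faces_ne_nil]

/-- The usual contraction, which is not equivariant: it turns the group coordinate into the first
letter of the word. -/
theorem eqv_barD_barS (z : G × List G →₀ ℤ) :
    eqv barD (barS z) = z - barS (eqv barD z) - single (1, []) (barAug z) := by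
  suffices eqv barD ∘ₗ barS = LinearMap.id - barS ∘ₗ eqv (barD (G := G)) -
    lsingle (1, []) ∘ₗ barAug from LinearMap.congr_fun this z
  refine ext_single fun p => ?_
  obtain ⟨g, u⟩ := p
  have e : single (g, u) (1 : ℤ) = tens g (single u 1) := (tens_single _ _ _).symm
  simp only [LinearMap.comp_apply, LinearMap.sub_apply, LinearMap.id_apply, lsingle_apply]
  rw [e, barS_tens, eqv_barD_pre, one_mul, barAug_tens]
  rcases u with _ | ⟨a, u⟩
  · rw [facesL_nil, tens_single, tens_single, eqv_barD_nil]
    simp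
  · rw [cons_eq_pre, eqv_barD_pre, map_sub, barS_tens, barS_tens, facesL_pre, map_sub,
      show pre a (single u 1) [] = (0 : ℤ) from aug_pre a _]
    simp

/-- On basis elements `barD (g :: u)` is `D S (g, u)`, with `D` the differential and `S` the
contraction. So induction on the length and `eqv_barD_barS`, used twice, suffice. -/
theorem eqv_barD_eqv_barD (z : G × List G →₀ ℤ) : eqv barD (eqv barD z) = 0 := by
  suffices eqv barD ∘ₗ eqv (barD (G := G)) = 0 from LinearMap.congr_fun this z
  refine ext_one (fun h z => by simp [eqv_transL]) (fun h z => by simp) fun u => ?_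
  rw [LinearMap.comp_apply, eqv_one, LinearMap.zero_apply]
  induction u with
  | nil => simp [barD]
  | cons g u ih =>
    have e : barD (g :: u) = eqv barD (barS (single (g, u) 1)) := by
      rw [← tens_single, barS_tens, pre_single, tens_single, eqv_one]
    have h := eqv_barD_barS (eqv barD (single (g, u) 1))
    have h0 : eqv barD (eqv barD (single (g, u) 1)) = 0 := by
      rw [eqv_single, one_smul, eqv_transL, ih, map_zero]
    rw [h0, map_zero, sub_zero, barAug_eqv_barD, single_zero, sub_zero] at h
    rw [e, eqv_barD_barS, map_sub, map_sub, h, eqv_barD_nil, sub_self, sub_zero]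

theorem linearCombination_proj_barD :
    linearCombination ℤ (fun u => proj (barD u)) = lin (bdB (G := G)) := by
  refine lin_ext fun u => ?_
  rcases u with _ | ⟨g, u⟩
  · simp [barD, lin_single, bdB]
  · simp [barD, lin_single, bdB, proj_single, proj_tens]

/-! ### The resolution by forests and the chain map to the bar complex -/

variable (τ : G →* G) (x : G)

/-- The chain map from the complex of forests to the bar complex. -/
def theta : List ℕ → (List G →₀ ℤ)
  | [] => single [] 1
  | a :: l => (mapL τ)^[a] (lin (slide τ (τ.comp τ) x) (theta l))

/-- The linear extension of `theta`. -/
def thetaL : (List ℕ →₀ ℤ) →ₗ[ℤ] (List G →₀ ℤ) := lin (theta τ x)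

theorem thetaL_nil (c : ℤ) : thetaL τ x (single [] c) = single [] c := by
  simp [thetaL, lin_single, theta]

theorem thetaL_upL (w : List ℕ →₀ ℤ) : thetaL τ x (upL w) = mapL τ (thetaL τ x w) := by
  suffices thetaL τ x ∘ₗ upL = mapL τ ∘ₗ thetaL τ x from LinearMap.congr_fun this w
  refine lin_ext fun l => ?_
  rcases l with _ | ⟨a, l⟩
  · simp [thetaL_nil, upL_single, up, mapL_single]
  · simp only [LinearMap.comp_apply, upL_single, up, thetaL, lin_single, one_smul, theta]
    rw [Function.iterate_succ_apply']

theorem thetaL_pre (w : List ℕ →₀ ℤ) :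
    thetaL τ x (pre 0 w) = slideL τ (τ.comp τ) x (thetaL τ x w) := by
  suffices thetaL τ x ∘ₗ pre 0 = slideL τ (τ.comp τ) x ∘ₗ thetaL τ x from
    LinearMap.congr_fun this w
  exact lin_ext fun l => by simp [pre_single, thetaL, lin_single, theta, slideL]

/-- The differential of the resolution by forests. -/
def cubeD : List ℕ → (G × List ℕ →₀ ℤ)
  | [] => 0
  | a :: l => (lmapDomain ℤ ℤ (Prod.map τ up))^[a] (single (x, up (up l)) 1 - single (1, up l) 1 -
      lmapDomain ℤ ℤ (Prod.map τ (List.cons 0)) (cubeD l))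

/-- The semilinear extension of `up`. -/
def upE : (G × List ℕ →₀ ℤ) →ₗ[ℤ] (G × List ℕ →₀ ℤ) := lmapDomain ℤ ℤ (Prod.map τ up)

/-- The semilinear extension of `List.cons 0`. -/
def consE : (G × List ℕ →₀ ℤ) →ₗ[ℤ] (G × List ℕ →₀ ℤ) :=
  lmapDomain ℤ ℤ (Prod.map τ (List.cons 0))

theorem upE_single (g : G) (l : List ℕ) (c : ℤ) :
    upE τ (single (g, l) c) = single (τ g, up l) c := by simp [upE]

theorem consE_single (g : G) (l : List ℕ) (c : ℤ) :
    consE τ (single (g, l) c) = single (τ g, 0 :: l) c := by simp [consE]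

theorem upE_transL (g : G) (z : G × List ℕ →₀ ℤ) :
    upE τ (transL g z) = transL (τ g) (upE τ z) := by
  suffices upE τ ∘ₗ transL g = transL (τ g) ∘ₗ upE τ from LinearMap.congr_fun this z
  exact ext_single fun p => by simp [transL_single, upE]

theorem consE_transL (g : G) (z : G × List ℕ →₀ ℤ) :
    consE τ (transL g z) = transL (τ g) (consE τ z) := by
  suffices consE τ ∘ₗ transL g = transL (τ g) ∘ₗ consE τ from LinearMap.congr_fun this z
  exact ext_single fun p => by simp [transL_single, consE]

theorem cubeD_up (l : List ℕ) : cubeD τ x (up l) = upE τ (cubeD τ x l) := by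
  rcases l with _ | ⟨a, l⟩
  · simp [up, cubeD]
  · rw [up, cubeD, Function.iterate_succ_apply']
    rfl

theorem eqv_cubeD_upE (z : G × List ℕ →₀ ℤ) :
    eqv (cubeD τ x) (upE τ z) = upE τ (eqv (cubeD τ x) z) := by
  suffices eqv (cubeD τ x) ∘ₗ upE τ = upE τ ∘ₗ eqv (cubeD τ x) from LinearMap.congr_fun this z
  refine ext_single fun ⟨g, l⟩ => ?_
  simp only [LinearMap.comp_apply, upE_single, eqv_single, one_smul, cubeD_up, upE_transL]

variable {τ x}

/-- The equivariant form of `bdL_pre`. The face with the caret attached is displaced by `x`, and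
`hx` moves `x` past the coefficients, which `consE` has twisted by `τ`. -/
theorem eqv_cubeD_consE (hx : ∀ g, τ g * x = x * τ (τ g)) (z : G × List ℕ →₀ ℤ) :
    eqv (cubeD τ x) (consE τ z) =
      transL x (upE τ (upE τ z)) - upE τ z - consE τ (eqv (cubeD τ x) z) := by
  suffices eqv (cubeD τ x) ∘ₗ consE τ =
      transL x ∘ₗ upE τ ∘ₗ upE τ - upE τ - consE τ ∘ₗ eqv (cubeD τ x) from
    LinearMap.congr_fun this z
  refine ext_single fun ⟨g, l⟩ => ?_
  simp only [LinearMap.comp_apply, LinearMap.sub_apply, upE_single, consE_single, eqv_single,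
    one_smul, consE_transL, transL_single]
  rw [cubeD, Function.iterate_zero, id]
  simp only [map_sub, transL_single, hx, mul_one]
  rfl

theorem eqv_cubeD_eqv_cubeD (hx : ∀ g, τ g * x = x * τ (τ g)) (z : G × List ℕ →₀ ℤ) :
    eqv (cubeD τ x) (eqv (cubeD τ x) z) = 0 := by
  suffices eqv (cubeD τ x) ∘ₗ eqv (cubeD τ x) = 0 from LinearMap.congr_fun this z
  refine ext_one (fun h z => by simp [eqv_transL]) (fun h z => by simp) fun l => ?_
  rw [LinearMap.comp_apply, LinearMap.zero_apply]
  induction l with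
  | nil => simp [eqv_one, cubeD]
  | cons a l ih =>
    induction a with
    | zero =>
      have e : single ((1 : G), 0 :: l) (1 : ℤ) = consE τ (single (1, l) 1) := by
        rw [consE_single, map_one]
      rw [e, eqv_cubeD_consE hx, map_sub, map_sub, eqv_cubeD_consE hx, ih, eqv_transL]
      simp only [eqv_cubeD_upE]
      simp
    | succ a ih' =>
      have e : single ((1 : G), (a + 1) :: l) (1 : ℤ) = upE τ (single (1, a :: l) 1) := by
        rw [upE_single, map_one, up]
      rw [e, eqv_cubeD_upE, eqv_cubeD_upE, ih', map_zero]

variable (τ x) in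
theorem linearCombination_proj_cubeD :
    linearCombination ℤ (fun l => proj (cubeD τ x l)) = bdL := by
  have h1 : ∀ z, proj (upE τ z) = upL (proj z) := fun z => by
    suffices proj ∘ₗ upE τ = upL ∘ₗ proj from LinearMap.congr_fun this z
    exact ext_single fun p => by simp [upE, proj_single, upL_single]
  have h2 : ∀ z, proj (consE τ z) = pre 0 (proj z) := fun z => by
    suffices proj ∘ₗ consE τ = pre 0 ∘ₗ proj from LinearMap.congr_fun this z
    exact ext_single fun p => by simp [consE, proj_single, pre_single]
  refine lin_ext fun l => ?_
  rw [linearCombination_single, one_smul]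
  induction l with
  | nil => simp [cubeD, bdL_nil]
  | cons a l ih =>
    induction a with
    | zero =>
      rw [cons_eq_pre, bdL_pre, ← ih, ← h2, cubeD, Function.iterate_zero, id]
      simp only [map_sub, proj_single, upL_single]
      rfl
    | succ a ih' =>
      rw [show single ((a + 1) :: l) (1 : ℤ) = upL (single (a :: l) 1) by rw [upL_single, up],
        bdL_upL, ← ih', ← h1, ← cubeD_up, up]

/-! ### The chain map between the resolutions -/

/-- The semilinear extension of `mapL τ` to the bar resolution. -/
def mapE (τ : G →* G) : (G × List G →₀ ℤ) →ₗ[ℤ] (G × List G →₀ ℤ) :=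
  linearCombination ℤ fun p => tens (τ p.1) (mapL τ (single p.2 1))

/-- The semilinear extension of `slide` to the bar resolution. -/
def slideE (τ : G →* G) (x : G) : (G × List G →₀ ℤ) →ₗ[ℤ] (G × List G →₀ ℤ) :=
  linearCombination ℤ fun p => tens (τ p.1) (slideL τ (τ.comp τ) x (single p.2 1))

theorem mapE_tens (g : G) (w : List G →₀ ℤ) : mapE τ (tens g w) = tens (τ g) (mapL τ w) := by
  suffices mapE τ ∘ₗ tens g = tens (τ g) ∘ₗ mapL τ from LinearMap.congr_fun this w
  exact ext_single fun p => by simp [mapE, tens_single]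

theorem slideE_tens (g : G) (w : List G →₀ ℤ) :
    slideE τ x (tens g w) = tens (τ g) (slideL τ (τ.comp τ) x w) := by
  suffices slideE τ x ∘ₗ tens g = tens (τ g) ∘ₗ slideL τ (τ.comp τ) x from
    LinearMap.congr_fun this w
  exact ext_single fun p => by simp [slideE, tens_single]

theorem eqv_barD_mapE (z : G × List G →₀ ℤ) : eqv barD (mapE τ z) = mapE τ (eqv barD z) := by
  suffices eqv barD ∘ₗ mapE τ = mapE τ ∘ₗ eqv barD from LinearMap.congr_fun this z
  refine ext_single fun ⟨g, u⟩ => ?_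
  simp only [LinearMap.comp_apply]
  rw [← tens_single, mapE_tens]
  rcases u with _ | ⟨a, u⟩
  · simp [mapL_single, tens_single, eqv_barD_nil]
  · rw [cons_eq_pre, mapL_pre, eqv_barD_pre, eqv_barD_pre, map_sub, mapE_tens, mapE_tens,
      mapL_facesL, map_mul]

/-- `slideE` and `mapE` satisfy the same identity in the bar resolution as `consE` and `upE` in the
resolution by forests (`eqv_cubeD_consE`); this is why the recursively defined `thetaE` commutes
with the differentials. -/
theorem eqv_barD_slideE (hx : ∀ g, τ g * x = x * τ (τ g)) (z : G × List G →₀ ℤ) :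
    eqv barD (slideE τ x z) =
      transL x (mapE τ (mapE τ z)) - mapE τ z - slideE τ x (eqv barD z) := by
  suffices eqv barD ∘ₗ slideE τ x = transL x ∘ₗ mapE τ ∘ₗ mapE τ - mapE τ - slideE τ x ∘ₗ eqv barD
    from LinearMap.congr_fun this z
  refine ext_single fun ⟨g, u⟩ => ?_
  simp only [LinearMap.comp_apply, LinearMap.sub_apply]
  have hτ : ∀ g, τ g * x = x * (τ.comp τ) g := hx
  rw [← tens_single, slideE_tens, mapE_tens, mapE_tens, transL_tens, ← hx, mapL_mapL]
  rcases u with _ | ⟨a, u⟩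
  · rw [tens_single, eqv_barD_nil, slideL_nil, cons_eq_pre, eqv_barD_pre, facesL_nil]
    simp [mapL_single]
  · rw [cons_eq_pre, slideL_pre, map_sub, map_sub, eqv_barD_pre, eqv_barD_pre, eqv_barD_pre,
      map_sub, slideE_tens, slideE_tens, slideL_facesL hτ, mapL_pre, mapL_pre, facesL_pre,
      mapL_facesL]
    simp only [map_sub, map_add, map_mul]
    have : mapL (τ ∘ τ) (single u (1 : ℤ)) = mapL (τ.comp τ) (single u 1) := rfl
    rw [this]
    simp only [MonoidHom.comp_apply, Function.comp_apply]
    abel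

variable (τ x) in
/-- The equivariant extension of `theta`. -/
def thetaE : (G × List ℕ →₀ ℤ) →ₗ[ℤ] (G × List G →₀ ℤ) := eqv fun l => tens 1 (theta τ x l)

theorem thetaE_tens (g : G) (w : List ℕ →₀ ℤ) :
    thetaE τ x (tens g w) = tens g (thetaL τ x w) := by
  suffices thetaE τ x ∘ₗ tens g = tens g ∘ₗ thetaL τ x from LinearMap.congr_fun this w
  exact ext_single fun p => by
    simp [thetaE, thetaL, lin_single, tens_single, eqv_single, transL_tens]

theorem thetaE_upE (z : G × List ℕ →₀ ℤ) : thetaE τ x (upE τ z) = mapE τ (thetaE τ x z) := by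
  suffices thetaE τ x ∘ₗ upE τ = mapE τ ∘ₗ thetaE τ x from LinearMap.congr_fun this z
  refine ext_single fun ⟨g, l⟩ => ?_
  simp only [LinearMap.comp_apply, upE_single]
  rw [← tens_single, ← tens_single, thetaE_tens, thetaE_tens, mapE_tens, ← upL_single, thetaL_upL]

theorem thetaE_consE (z : G × List ℕ →₀ ℤ) :
    thetaE τ x (consE τ z) = slideE τ x (thetaE τ x z) := by
  suffices thetaE τ x ∘ₗ consE τ = slideE τ x ∘ₗ thetaE τ x from LinearMap.congr_fun this z
  refine ext_single fun ⟨g, l⟩ => ?_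
  simp only [LinearMap.comp_apply, consE_single]
  rw [← tens_single, ← tens_single, thetaE_tens, thetaE_tens, slideE_tens, cons_eq_pre,
    thetaL_pre]

theorem thetaE_transL (g : G) (z : G × List ℕ →₀ ℤ) :
    thetaE τ x (transL g z) = transL g (thetaE τ x z) := eqv_transL _ _ _

theorem eqv_barD_thetaE (hx : ∀ g, τ g * x = x * τ (τ g)) (z : G × List ℕ →₀ ℤ) :
    eqv barD (thetaE τ x z) = thetaE τ x (eqv (cubeD τ x) z) := by
  suffices eqv barD ∘ₗ thetaE τ x = thetaE τ x ∘ₗ eqv (cubeD τ x) from LinearMap.congr_fun this z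
  refine ext_one (fun h z => by simp [eqv_transL, thetaE_transL])
    (fun h z => by simp [eqv_transL, thetaE_transL]) fun l => ?_
  simp only [LinearMap.comp_apply]
  induction l with
  | nil =>
    rw [← tens_single, thetaE_tens, thetaL_nil, tens_single, eqv_barD_nil, tens_single, eqv_one]
    simp [cubeD]
  | cons a l ih =>
    induction a with
    | zero =>
      have e : single ((1 : G), 0 :: l) (1 : ℤ) = consE τ (single (1, l) 1) := by
        rw [consE_single, map_one]
      rw [e, thetaE_consE, eqv_barD_slideE hx, eqv_cubeD_consE hx, ih]
      simp only [map_sub, thetaE_transL, thetaE_upE, thetaE_consE]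
    | succ a ih' =>
      have e : single ((1 : G), (a + 1) :: l) (1 : ℤ) = upE τ (single (1, a :: l) 1) := by
        rw [upE_single, map_one, up]
      rw [e, thetaE_upE, eqv_barD_mapE, ih', eqv_cubeD_upE, thetaE_upE]

theorem bdB_thetaL (hx : ∀ g, τ g * x = x * τ (τ g)) (w : List ℕ →₀ ℤ) :
    lin bdB (thetaL τ x w) = thetaL τ x (bdL w) := by
  have h := congr_arg proj (eqv_barD_thetaE hx (tens 1 w))
  rw [thetaE_tens, thetaE, proj_eqv, proj_eqv, proj_eqv, proj_tens, proj_tens,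
    linearCombination_proj_barD, linearCombination_proj_cubeD] at h
  rw [h]
  suffices linearCombination ℤ (fun l => proj (tens (1 : G) (theta τ x l))) = thetaL τ x by
    rw [this]
  exact ext_single fun l => by simp [proj_tens, thetaL, lin_single]

end

end ForestComplex

end

noncomputable section

/-! ### Exactness of the resolution by forests -/

namespace ForestComplex

open Finsupp IntegralHomology FreeAction

/-- The positions of the carets of a cube. -/
def pos : List ℕ → Finset ℕ
  | [] => ∅
  | a :: l => insert a ((pos l).image (a + 1 + ·))

theorem mem_pos_up (i : ℕ) (l : List ℕ) : i ∈ pos (up l) ↔ ∃ j ∈ pos l, i = j + 1 := by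
  rcases l with _ | ⟨a, l⟩
  · simp [up, pos]
  · simp only [up, pos, Finset.mem_insert, Finset.mem_image]
    constructor
    · rintro (rfl | ⟨j, hj, rfl⟩)
      · exact ⟨a, Or.inl rfl, rfl⟩
      · exact ⟨a + 1 + j, Or.inr ⟨j, hj, rfl⟩, by omega⟩
    · rintro ⟨_, rfl | ⟨j, hj, rfl⟩, rfl⟩
      · exact Or.inl rfl
      · exact Or.inr ⟨j, hj, by omega⟩

theorem mem_pos_zero (i : ℕ) (l : List ℕ) : i ∈ pos (0 :: l) ↔ i = 0 ∨ ∃ j ∈ pos l, i = j + 1 := by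
  simp only [pos, Finset.mem_insert, Finset.mem_image]
  refine or_congr Iff.rfl (exists_congr fun j => and_congr Iff.rfl ?_)
  omega

theorem map_mem_of_mem_supported {X M : Type} [AddCommGroup M] (f : (X →₀ ℤ) →ₗ[ℤ] M)
    (N : Submodule ℤ M) {S : Set X} (hs : ∀ x ∈ S, f (single x 1) ∈ N) {z : X →₀ ℤ}
    (hz : z ∈ supported ℤ ℤ S) : f z ∈ N := by
  refine supported_induction (p := fun z => f z ∈ N) (by simp)
    (fun a b ha hb => by rw [map_add]; exact N.add_mem ha hb) (fun x hx c => ?_)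
    ((mem_supported ℤ z).1 hz)
  rw [← mul_one c, ← smul_eq_mul, ← smul_single, map_smul]
  exact N.smul_mem _ (hs x hx)

/-! ### Faces at the initial vertex and insertion of a caret -/

/-- The part of the boundary of a cube that consists of the faces containing the initial vertex. -/
def lower : List ℕ → (List ℕ →₀ ℤ)
  | [] => 0
  | a :: l => upL^[a] (- upL (single l 1) - pre 0 (lower l))

/-- The linear extension of `lower`. -/
def lowerL : (List ℕ →₀ ℤ) →ₗ[ℤ] (List ℕ →₀ ℤ) := lin lower

theorem lower_up (l : List ℕ) : lower (up l) = upL (lower l) := by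
  rcases l with _ | ⟨a, l⟩
  · simp [up, lower]
  · rw [up, lower, Function.iterate_succ_apply', lower]

theorem lowerL_upL (w : List ℕ →₀ ℤ) : lowerL (upL w) = upL (lowerL w) := by
  suffices lowerL ∘ₗ upL = upL ∘ₗ lowerL from LinearMap.congr_fun this w
  exact lin_ext fun l => by simp [lowerL, lin_single, upL_single, lower_up]

theorem lowerL_pre (w : List ℕ →₀ ℤ) : lowerL (pre 0 w) = - upL w - pre 0 (lowerL w) := by
  suffices lowerL ∘ₗ pre 0 = - upL - pre 0 ∘ₗ lowerL from LinearMap.congr_fun this w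
  exact lin_ext fun l => by simp [lowerL, lin_single, pre_single, lower]

/-- Insert a caret at the position `r`, if all carets come after that position. -/
def ins (r : ℕ) : (List ℕ →₀ ℤ) →ₗ[ℤ] (List ℕ →₀ ℤ) := lin fun
  | [] => single [r] (-1)
  | a :: l => if r < a then single (r :: (a - r - 1) :: l) (-1) else 0

theorem up_iterate_nil (n : ℕ) : up^[n] [] = [] := by
  induction n with
  | zero => rfl
  | succ n ih => rw [Function.iterate_succ_apply', ih, up]

theorem up_iterate_cons (n a : ℕ) (l : List ℕ) : up^[n] (a :: l) = (a + n) :: l := by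
  induction n with
  | zero => rfl
  | succ n ih => rw [Function.iterate_succ_apply', ih, up, add_assoc]

theorem upL_iterate_single (n : ℕ) (l : List ℕ) (c : ℤ) :
    upL^[n] (single l c) = single (up^[n] l) c := by
  induction n with
  | zero => rfl
  | succ n ih => rw [Function.iterate_succ_apply', ih, upL_single, Function.iterate_succ_apply']

theorem lowerL_upL_iterate (n : ℕ) (w : List ℕ →₀ ℤ) :
    lowerL (upL^[n] w) = upL^[n] (lowerL w) := by
  induction n with
  | zero => rfl
  | succ n ih => rw [Function.iterate_succ_apply', lowerL_upL, ih, Function.iterate_succ_apply']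

/-- A cube all of whose carets come after position `r` is an `(r + 1)`-fold shift; the sign makes
`ins` invert the sign in the leading term of `lower`. -/
theorem ins_upL_iterate_succ (r : ℕ) (w : List ℕ →₀ ℤ) :
    ins r (upL^[r + 1] w) = - upL^[r] (pre 0 w) := by
  rw [← Module.End.pow_apply, ← Module.End.pow_apply]
  suffices ins r ∘ₗ (upL ^ (r + 1)) = - ((upL ^ r) ∘ₗ pre 0) by
    have h := LinearMap.congr_fun this w
    rwa [LinearMap.neg_apply, LinearMap.comp_apply, LinearMap.comp_apply] at h
  refine lin_ext fun l => ?_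
  simp only [LinearMap.comp_apply, LinearMap.neg_apply]
  rw [Module.End.pow_apply, Module.End.pow_apply, upL_iterate_single, pre_single,
    upL_iterate_single, up_iterate_cons]
  rcases l with _ | ⟨a, l⟩
  · rw [up_iterate_nil]
    simp [ins, lin_single]
  · rw [up_iterate_cons]
    have h : r < a + (r + 1) := by omega
    have e : a + (r + 1) - r - 1 = a := by omega
    simp [ins, lin_single, h, e]

theorem ins_upL_iterate_pre (r : ℕ) (w : List ℕ →₀ ℤ) : ins r (upL^[r] (pre 0 w)) = 0 := by
  rw [← Module.End.pow_apply]
  suffices ins r ∘ₗ (upL ^ r) ∘ₗ pre 0 = 0 by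
    have h := LinearMap.congr_fun this w
    rwa [LinearMap.zero_apply, LinearMap.comp_apply, LinearMap.comp_apply] at h
  refine lin_ext fun l => ?_
  simp only [LinearMap.comp_apply, LinearMap.zero_apply]
  rw [Module.End.pow_apply, pre_single, upL_iterate_single, up_iterate_cons]
  simp [ins, lin_single]

/-- The faces at the initial vertex behave like those of a simplex whose vertices are the caret
positions, the empty word being the augmentation. Joining with the vertex `r` is then the standard
cone contraction. -/
theorem lowerL_ins_add {r : ℕ} {l : List ℕ} (hl : ∀ i ∈ pos l, r ≤ i) :
    lowerL (ins r (single l 1)) + ins r (lower l) = single l 1 := by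
  have e : lower l = lowerL (single l 1) := by simp [lowerL, lin_single]
  -- Either all carets come strictly after `r`, or the first caret is at `r` and `ins r` kills the
  -- cube.
  have h : (∃ l', l = up^[r + 1] l') ∨ ∃ l', l = up^[r] (0 :: l') := by
    rcases l with _ | ⟨a, l⟩
    · exact Or.inl ⟨[], (up_iterate_nil _).symm⟩
    · have ha := hl a (by simp [pos])
      rcases ha.eq_or_lt with rfl | ha
      · exact Or.inr ⟨l, by rw [up_iterate_cons, zero_add]⟩
      · refine Or.inl ⟨(a - (r + 1)) :: l, ?_⟩
        rw [up_iterate_cons]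
        congr 1
        omega
  rw [e]
  rcases h with ⟨l', rfl⟩ | ⟨l', rfl⟩
  · rw [← upL_iterate_single, ins_upL_iterate_succ, map_neg, lowerL_upL_iterate,
      lowerL_upL_iterate, ins_upL_iterate_succ, lowerL_pre, ← Module.End.pow_apply,
      ← Module.End.pow_apply, ← Module.End.pow_apply, map_sub, map_neg, Module.End.pow_apply,
      ← Function.iterate_succ_apply, ← Module.End.pow_apply]
    abel
  · rw [← upL_iterate_single, ← pre_single, ins_upL_iterate_pre, map_zero, zero_add,
      lowerL_upL_iterate, lowerL_pre, ← Module.End.pow_apply, map_sub, map_neg, map_sub, map_neg,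
      Module.End.pow_apply, Module.End.pow_apply, ins_upL_iterate_pre, sub_zero,
      ← Function.iterate_succ_apply, ins_upL_iterate_succ, neg_neg]

theorem ins_mem (r : ℕ) (l : List ℕ) :
    ins r (single l 1) ∈ supported ℤ ℤ {l' | pos l' ⊆ insert r (pos l)} := by
  rcases l with _ | ⟨a, l⟩
  · simp only [ins, lin_single, one_smul]
    exact single_mem_supported _ _ (by simp [pos])
  · simp only [ins, lin_single, one_smul]
    split_ifs with h
    · refine single_mem_supported _ _ fun i => ?_
      simp only [pos, Finset.mem_insert, Finset.mem_image]
      rintro (rfl | ⟨_, rfl | ⟨j, hj, rfl⟩, rfl⟩)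
      · exact Or.inl rfl
      · exact Or.inr (Or.inl (by omega))
      · exact Or.inr (Or.inr ⟨j, hj, by omega⟩)
    · exact Submodule.zero_mem _

variable {G : Type} [Group G]

/-! ### Abstract forest monoids -/

/-- The elements `x, τ x, τ (τ x), …`. -/
def gen (τ : G →* G) (x : G) (i : ℕ) : G := τ^[i] x

theorem gen_succ (τ : G →* G) (x : G) (i : ℕ) : gen τ x (i + 1) = τ (gen τ x i) :=
  Function.iterate_succ_apply' _ _ _

/-- A subset `P` of `G` that behaves like the monoid of forests in Thompson's group, `x` being the
first generator and `τ` the shift. -/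
structure IsForestMonoid (τ : G →* G) (x : G) (P : Set G) : Prop where
  map_mul : ∀ g, τ g * x = x * τ (τ g)
  mul_mem : ∀ p ∈ P, ∀ q ∈ P, p * q ∈ P
  -- The common multiple meant here is `gen i * gen (j + 1) = gen j * gen i` (`gen_mul_gen`).
  lcm : ∀ p ∈ P, ∀ i j, i < j → (gen τ x i)⁻¹ * p ∈ P → (gen τ x j)⁻¹ * p ∈ P →
    (gen τ x (j + 1))⁻¹ * ((gen τ x i)⁻¹ * p) ∈ P
  exists_divisor : ∀ p ∈ P, p ≠ 1 → ∃ i, (gen τ x i)⁻¹ * p ∈ P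
  inv_notMem : ∀ i, (gen τ x i)⁻¹ ∉ P
  exists_length : ∃ len : G → ℕ, ∀ p ∈ P, ∀ i, (gen τ x i)⁻¹ * p ∈ P →
    len ((gen τ x i)⁻¹ * p) < len p
  exists_fraction : ∀ f, ∃ q ∈ P, f * q ∈ P

/-- The relation between a cube and its faces not containing the initial vertex. -/
def IsUpperFace (τ : G →* G) (x : G) (l : List ℕ) (c : G × List ℕ) : Prop :=
  ∃ i ∈ pos l, c.1 = gen τ x i ∧
    ∀ j ∈ pos c.2, (j < i ∧ j ∈ pos l) ∨ ∃ k ∈ pos l, i < k ∧ j = k + 1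

/-- Attaching the caret at leaf `i` creates one more leaf, so in the opposite face the carets before
`i` stay in place and those after `i` move one place to the right. -/
theorem cubeD_sub_lower_mem (τ : G →* G) (x : G) (l : List ℕ) :
    cubeD τ x l - tens 1 (lower l) ∈ supported ℤ ℤ {c | IsUpperFace τ x l c} := by
  have hu : ∀ w : List ℕ →₀ ℤ, tens 1 (upL w) = upE τ (tens 1 w) := fun w => by
    suffices tens 1 ∘ₗ upL = upE τ ∘ₗ tens 1 from LinearMap.congr_fun this w
    exact lin_ext fun l => by simp [tens_single, upL_single, upE_single]
  have hc : ∀ w : List ℕ →₀ ℤ, tens 1 (pre 0 w) = consE τ (tens 1 w) := fun w => by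
    suffices tens 1 ∘ₗ pre 0 = consE τ ∘ₗ tens 1 from LinearMap.congr_fun this w
    exact lin_ext fun l => by simp [tens_single, pre_single, consE_single]
  induction l with
  | nil => simp [cubeD, lower]
  | cons a l ih =>
    induction a with
    | zero =>
      rw [lower, Function.iterate_zero, id, cubeD, Function.iterate_zero, id, map_sub, map_neg,
        hc, upL_single, tens_single]
      have e : single (x, up (up l)) 1 - single (1, up l) 1 -
          (lmapDomain ℤ ℤ (Prod.map τ (List.cons 0))) (cubeD τ x l) -
          (- single (1, up l) 1 - consE τ (tens 1 (lower l))) =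
          single (x, up (up l)) (1 : ℤ) - consE τ (cubeD τ x l - tens 1 (lower l)) := by
        rw [map_sub, consE]
        abel
      rw [e]
      refine Submodule.sub_mem _ ?_ ?_
      · refine single_mem_supported _ _ ⟨0, by simp [pos], rfl, fun j hj => Or.inr ?_⟩
        obtain ⟨k, hk, rfl⟩ := (mem_pos_up _ _).1 hj
        refine ⟨k, ?_, ?_, rfl⟩
        · obtain ⟨m, hm, rfl⟩ := (mem_pos_up _ _).1 hk
          exact (mem_pos_zero _ _).2 (Or.inr ⟨m, hm, rfl⟩)
        · obtain ⟨m, hm, rfl⟩ := (mem_pos_up _ _).1 hk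
          omega
      · refine map_mem_of_mem_supported _ _ ?_ ih
        rintro ⟨g, l'⟩ ⟨i, hi, hg, h⟩
        rw [consE_single]
        refine single_mem_supported _ _ ⟨i + 1, (mem_pos_zero _ _).2 (Or.inr ⟨i, hi, rfl⟩), ?_, ?_⟩
        · rw [gen_succ]
          exact congr_arg τ hg
        · intro j hj
          rcases (mem_pos_zero _ _).1 hj with rfl | ⟨k, hk, rfl⟩
          · exact Or.inl ⟨Nat.succ_pos _, by simp [pos]⟩
          · rcases h k hk with ⟨h1, h2⟩ | ⟨m, hm, him, rfl⟩
            · exact Or.inl ⟨by omega, (mem_pos_zero _ _).2 (Or.inr ⟨k, h2, rfl⟩)⟩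
            · exact Or.inr ⟨m + 1, (mem_pos_zero _ _).2 (Or.inr ⟨m, hm, rfl⟩), by omega, rfl⟩
    | succ a ih' =>
      change cubeD τ x (up (a :: l)) - tens 1 (lower (up (a :: l))) ∈
        supported ℤ ℤ {c | IsUpperFace τ x (up (a :: l)) c}
      rw [lower_up, cubeD_up, hu, ← map_sub]
      refine map_mem_of_mem_supported _ _ ?_ ih'
      rintro ⟨g, l'⟩ ⟨i, hi, hg, h⟩
      rw [upE_single]
      refine single_mem_supported _ _ ⟨i + 1, (mem_pos_up _ _).2 ⟨i, hi, rfl⟩, ?_, ?_⟩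
      · rw [gen_succ]
        exact congr_arg τ hg
      · intro j hj
        obtain ⟨k, hk, rfl⟩ := (mem_pos_up _ _).1 hj
        rcases h k hk with ⟨h1, h2⟩ | ⟨m, hm, him, rfl⟩
        · exact Or.inl ⟨by omega, (mem_pos_up _ _).2 ⟨k, h2, rfl⟩⟩
        · exact Or.inr ⟨m + 1, (mem_pos_up _ _).2 ⟨m, hm, rfl⟩, by omega, rfl⟩

/-- Thompson's relations between the generators: carets at different leaves can be attached in
either order, up to renumbering. -/
theorem gen_mul_gen {τ : G →* G} {x : G} (hx : ∀ g, τ g * x = x * τ (τ g)) {i j : ℕ} (h : i < j) :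
    gen τ x j * gen τ x i = gen τ x i * gen τ x (j + 1) := by
  induction i generalizing j with
  | zero =>
    obtain ⟨j, rfl⟩ := Nat.exists_eq_add_of_lt h
    rw [zero_add, gen_succ, gen_succ, gen_succ]
    exact hx _
  | succ i ih =>
    obtain ⟨j, rfl⟩ : ∃ k, j = k + 1 := ⟨j - 1, by omega⟩
    rw [gen_succ, gen_succ, gen_succ τ x (j + 1), ← map_mul, ← map_mul, ih (by omega)]

/-! ### Contraction of the cubes below a vertex -/

/-- The cubes with final vertex below `u` whose distance from `u` is less than `m`. -/
def cells (τ : G →* G) (x : G) (P : Set G) (len : G → ℕ) (u : G) (m : ℕ) : Set (G × List ℕ) :=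
  {c | c.1⁻¹ * u ∈ P ∧ (∀ i ∈ pos c.2, (gen τ x i)⁻¹ * (c.1⁻¹ * u) ∈ P) ∧ len (c.1⁻¹ * u) < m}

section

variable {τ : G →* G} {x : G} {P : Set G} {len : G → ℕ}

/-- Faces not at the initial vertex start at `v * gen i`, which is strictly nearer to `u` by `hlen`.
The least common multiple property keeps their remaining edges below `u`. -/
theorem upper_mem (hP : IsForestMonoid τ x P)
    (hlen : ∀ p ∈ P, ∀ i, (gen τ x i)⁻¹ * p ∈ P → len ((gen τ x i)⁻¹ * p) < len p)
    {u : G} {m : ℕ} {c : G × List ℕ} (hc : c ∈ cells τ x P len u m) :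
    transL c.1 (cubeD τ x c.2 - tens 1 (lower c.2)) ∈
      supported ℤ ℤ (cells τ x P len u (len (c.1⁻¹ * u))) := by
  obtain ⟨v, l⟩ := c
  obtain ⟨h1, h2, -⟩ := hc
  simp only at h1 h2 ⊢
  refine map_mem_of_mem_supported _ _ ?_ (cubeD_sub_lower_mem τ x l)
  rintro ⟨g, l'⟩ ⟨i, hi, hg, h⟩
  simp only at hg h
  rw [transL_single]
  have e : (v * g)⁻¹ * u = (gen τ x i)⁻¹ * (v⁻¹ * u) := by rw [hg]; group
  refine single_mem_supported _ _ ⟨?_, fun j hj => ?_, ?_⟩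
  · simp only [e]
    exact h2 i hi
  · simp only [e]
    rcases h j hj with ⟨hji, hj⟩ | ⟨k, hk, hik, rfl⟩
    · have := hP.lcm _ h1 j i hji (h2 j hj) (h2 i hi)
      -- For a caret at `j < i` the roles are exchanged: the multiple supplied by `lcm` is rewritten
      -- with `gen_mul_gen`.
      have e' : (gen τ x j)⁻¹ * ((gen τ x i)⁻¹ * (v⁻¹ * u)) =
          (gen τ x (i + 1))⁻¹ * ((gen τ x j)⁻¹ * (v⁻¹ * u)) := by
        rw [← mul_assoc, ← mul_assoc _ (gen τ x j)⁻¹, ← mul_inv_rev, ← mul_inv_rev,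
          gen_mul_gen hP.map_mul hji]
      rwa [e']
    · exact hP.lcm _ h1 i k hik (h2 i hi) (h2 k hk)
  · simp only [e]
    exact hlen _ h1 i (h2 i hi)

theorem tens_mem {u v : G} {m : ℕ} (h1 : v⁻¹ * u ∈ P) (h3 : len (v⁻¹ * u) < m) {S : Set (List ℕ)}
    (hS : ∀ l ∈ S, ∀ i ∈ pos l, (gen τ x i)⁻¹ * (v⁻¹ * u) ∈ P) {w : List ℕ →₀ ℤ}
    (hw : w ∈ supported ℤ ℤ S) : tens v w ∈ supported ℤ ℤ (cells τ x P len u m) :=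
  map_mem_of_mem_supported _ _ (fun l hl => by
    rw [tens_single]
    exact single_mem_supported _ _ ⟨h1, hS l hl, h3⟩) hw

theorem cells_mono {u : G} {m n : ℕ} (h : m ≤ n) : cells τ x P len u m ⊆ cells τ x P len u n :=
  fun _ hc => ⟨hc.1, hc.2.1, hc.2.2.trans_le h⟩

open Classical in
variable (τ x P) in
/-- The contraction onto the vertex `u`, up to cubes nearer to `u`. -/
def contract (u : G) : (G × List ℕ →₀ ℤ) →ₗ[ℤ] (G × List ℕ →₀ ℤ) :=
  linearCombination ℤ fun c => if c.1⁻¹ * u = 1 then 0 else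
    tens c.1 (ins (sInf {i | (gen τ x i)⁻¹ * (c.1⁻¹ * u) ∈ P}) (single c.2 1))

theorem contract_single_of_eq {u : G} {l : List ℕ} : contract τ x P u (single (u, l) 1) = 0 := by
  simp [contract]

/-- The infimum in `contract` is attained because a nontrivial element of `P` is divisible by some
generator. Its minimality is the hypothesis that `lowerL_ins_add` needs. -/
theorem exists_contract_single (hP : IsForestMonoid τ x P) {u v : G} (hv : v⁻¹ * u ∈ P)
    (hne : v⁻¹ * u ≠ 1) :
    ∃ r, (gen τ x r)⁻¹ * (v⁻¹ * u) ∈ P ∧ (∀ i, (gen τ x i)⁻¹ * (v⁻¹ * u) ∈ P → r ≤ i) ∧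
      ∀ w, contract τ x P u (tens v w) = tens v (ins r w) := by
  refine ⟨sInf {i | (gen τ x i)⁻¹ * (v⁻¹ * u) ∈ P}, Nat.sInf_mem (hP.exists_divisor _ hv hne),
    fun i hi => Nat.sInf_le hi, fun w => ?_⟩
  generalize hr : sInf {i | (gen τ x i)⁻¹ * (v⁻¹ * u) ∈ P} = r
  suffices contract τ x P u ∘ₗ tens v = tens v ∘ₗ ins r from LinearMap.congr_fun this w
  exact lin_ext fun l => by simp [contract, tens_single, hne, hr]

theorem contract_mem (hP : IsForestMonoid τ x P) {u : G} {m : ℕ} {c : G × List ℕ}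
    (hc : c ∈ cells τ x P len u m) :
    contract τ x P u (single c 1) ∈ supported ℤ ℤ (cells τ x P len u m) := by
  obtain ⟨v, l⟩ := c
  obtain ⟨h1, h2, h3⟩ := hc
  by_cases hne : v⁻¹ * u = 1
  · obtain rfl := inv_mul_eq_one.1 hne
    rw [contract_single_of_eq]
    exact Submodule.zero_mem _
  · obtain ⟨r, hr, -, h⟩ := exists_contract_single hP h1 hne
    rw [← tens_single, h]
    refine tens_mem h1 h3 (fun l' hl' i hi => ?_) (ins_mem r l)
    rcases Finset.mem_insert.1 (hl' hi) with rfl | hi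
    · exact hr
    · exact h2 i hi

/-- On the faces at the initial vertex `contract` is an exact contraction by `lowerL_ins_add`. The
error in the homotopy identity therefore comes only from the other faces, which are nearer to `u` by
`upper_mem`. -/
theorem sub_contract_mem (hP : IsForestMonoid τ x P)
    (hlen : ∀ p ∈ P, ∀ i, (gen τ x i)⁻¹ * p ∈ P → len ((gen τ x i)⁻¹ * p) < len p)
    {u : G} {m : ℕ} {c : G × List ℕ} (hc : c ∈ insert (u, []) (cells τ x P len u (m + 1))) :
    single c 1 - eqv (cubeD τ x) (contract τ x P u (single c 1)) -
      contract τ x P u (eqv (cubeD τ x) (single c 1)) ∈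
        supported ℤ ℤ (insert (u, []) (cells τ x P len u m)) := by
  have base : single (u, []) 1 - eqv (cubeD τ x) (contract τ x P u (single (u, []) 1)) -
      contract τ x P u (eqv (cubeD τ x) (single (u, []) 1)) ∈
        supported ℤ ℤ (insert (u, []) (cells τ x P len u m)) := by
    rw [contract_single_of_eq, eqv_single, cubeD]
    simp only [map_zero, smul_zero, sub_zero]
    exact single_mem_supported _ _ (Set.mem_insert _ _)
  rcases Set.mem_insert_iff.1 hc with rfl | hc
  · exact base
  obtain ⟨v, l⟩ := c
  have hc' := hc
  obtain ⟨h1, h2, h3⟩ := hc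
  simp only at h1 h2 h3
  by_cases hne : v⁻¹ * u = 1
  · obtain rfl : v = u := inv_mul_eq_one.1 hne
    -- A caret on a cube starting at `u` would place the inverse of a generator in `P`.
    obtain rfl : l = [] := by
      rcases l with _ | ⟨a, l⟩
      · rfl
      · have := h2 a (by simp [pos])
        rw [hne, mul_one] at this
        exact absurd this (hP.inv_notMem a)
    exact base
  refine (supported_mono (M := ℤ) (R := ℤ) (Set.subset_insert (u, []) (cells τ x P len u m))) ?_
  obtain ⟨r, hr, hmin, h⟩ := exists_contract_single hP h1 hne
  have hD : ∀ w : List ℕ →₀ ℤ, eqv (cubeD τ x) (tens v w) - tens v (lowerL w) =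
      linearCombination ℤ (fun l => transL v (cubeD τ x l - tens 1 (lower l))) w := by
    intro w
    suffices eqv (cubeD τ x) ∘ₗ tens v - tens v ∘ₗ lowerL =
      linearCombination ℤ (fun l => transL v (cubeD τ x l - tens 1 (lower l))) from
      LinearMap.congr_fun this w
    exact lin_ext fun l => by
      simp [tens_single, eqv_single, lowerL, lin_single, transL_tens]
  have hle : len (v⁻¹ * u) ≤ m := Nat.lt_succ_iff.1 h3
  have hlow : ∀ S : Set (List ℕ), (∀ l ∈ S, ∀ i ∈ pos l, (gen τ x i)⁻¹ * (v⁻¹ * u) ∈ P) →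
      ∀ w ∈ supported ℤ ℤ S, eqv (cubeD τ x) (tens v w) - tens v (lowerL w) ∈
        supported ℤ ℤ (cells τ x P len u m) := by
    intro S hS w hw
    rw [hD]
    refine map_mem_of_mem_supported _ _ (fun l hl => ?_) hw
    rw [linearCombination_single, one_smul]
    exact supported_mono (cells_mono hle)
      (upper_mem hP hlen (c := (v, l)) (m := m + 1) ⟨h1, hS l hl, h3⟩)
  have hins := hlow _ (fun l' hl' i hi => by
    rcases Finset.mem_insert.1 (hl' hi) with rfl | hi
    · exact hr
    · exact h2 i hi) _ (ins_mem r l)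
  have hl := hlow {l} (fun l' hl' => by rw [Set.mem_singleton_iff.1 hl']; exact h2) (single l 1)
    (single_mem_supported _ _ rfl)
  have hcl := map_mem_of_mem_supported (contract τ x P u) _ (fun c hc => contract_mem hP hc) hl
  have e : single (v, l) (1 : ℤ) =
      tens v (lowerL (ins r (single l 1))) + tens v (ins r (lower l)) := by
    rw [← map_add, lowerL_ins_add fun i hi => hmin i (h2 i hi), tens_single]
  have e1 : lowerL (single l 1) = lower l := by simp [lowerL, lin_single]
  rw [map_sub, h, e1] at hcl
  have := Submodule.neg_mem _ (Submodule.add_mem _ hins hcl)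
  rw [← tens_single, h, tens_single]
  nth_rw 1 [e]
  rw [← tens_single]
  convert this using 1
  abel

/-- A cycle supported below `u` is homologous to a multiple of the vertex `u`. -/
theorem exists_of_mem_cells (hP : IsForestMonoid τ x P)
    (hlen : ∀ p ∈ P, ∀ i, (gen τ x i)⁻¹ * p ∈ P → len ((gen τ x i)⁻¹ * p) < len p) (u : G)
    (m : ℕ) (z : G × List ℕ →₀ ℤ) (hz : z ∈ supported ℤ ℤ (insert (u, []) (cells τ x P len u m)))
    (hd : eqv (cubeD τ x) z = 0) :
    ∃ y c, z = eqv (cubeD τ x) y + single (u, []) c := by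
  induction m generalizing z with
  | zero =>
    have : insert (u, []) (cells τ x P len u 0) = {(u, [])} := by
      rw [Set.eq_empty_of_forall_notMem (s := cells τ x P len u 0)
        fun c hc => absurd hc.2.2 (Nat.not_lt_zero _)]
      simp
    rw [this, mem_supported] at hz
    refine ⟨0, z (u, []), ?_⟩
    rw [map_zero, zero_add]
    exact (Finsupp.support_subset_singleton.1 (by exact_mod_cast hz))
  | succ m ih =>
    -- For a cycle the last term vanishes, so the corrected chain is homologous to `z` and one step
    -- nearer to `u`.
    obtain ⟨y, c, h⟩ := ih (z - eqv (cubeD τ x) (contract τ x P u z) -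
        contract τ x P u (eqv (cubeD τ x) z))
      (map_mem_of_mem_supported (LinearMap.id - eqv (cubeD τ x) ∘ₗ contract τ x P u -
        contract τ x P u ∘ₗ eqv (cubeD τ x)) _ (fun c hc => sub_contract_mem hP hlen hc) hz)
      (by rw [hd, map_zero, sub_zero, map_sub, hd, eqv_cubeD_eqv_cubeD hP.map_mul, sub_zero])
    rw [hd, map_zero, sub_zero] at h
    refine ⟨y + contract τ x P u z, c, ?_⟩
    rw [map_add, add_right_comm, ← h, sub_add_cancel]

/-- Directedness of the order: `exists_fraction` enlarges the bound found so far by a right factor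
from `P`, and closure under products preserves the earlier inequalities. -/
theorem exists_upper_bound (hP : IsForestMonoid τ x P) (S : Finset G) :
    ∃ u, ∀ w ∈ S, w⁻¹ * u ∈ P := by
  classical
  induction S using Finset.induction_on with
  | empty => exact ⟨1, by simp⟩
  | insert w S _ ih =>
    obtain ⟨u, hu⟩ := ih
    obtain ⟨q, hq, h⟩ := hP.exists_fraction (w⁻¹ * u)
    refine ⟨u * q, fun v hv => ?_⟩
    rw [← mul_assoc]
    rcases Finset.mem_insert.1 hv with rfl | hv
    · exact h
    · exact hP.mul_mem _ (hu v hv) _ hq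

theorem exists_of_eqv_cubeD_eq_zero (hP : IsForestMonoid τ x P) (z : G × List ℕ →₀ ℤ)
    (hd : eqv (cubeD τ x) z = 0) : ∃ y u c, z = eqv (cubeD τ x) y + single (u, []) c := by
  classical
  obtain ⟨len, hlen⟩ := hP.exists_length
  -- The bound has to dominate the initial vertices and also the far ends of the edges there, as
  -- `cells` demands.
  obtain ⟨u, hu⟩ := exists_upper_bound hP
    (z.support.biUnion fun c => insert c.1 ((pos c.2).image fun i => c.1 * gen τ x i))
  obtain ⟨y, c, h⟩ := exists_of_mem_cells hP hlen u (z.support.sup (fun c => len (c.1⁻¹ * u)) + 1) z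
    (by
      rw [mem_supported]
      intro c hc
      refine Or.inr ⟨hu _ (Finset.mem_biUnion.2 ⟨c, hc, by simp⟩), fun i hi => ?_, ?_⟩
      · have := hu (c.1 * gen τ x i) (Finset.mem_biUnion.2 ⟨c, hc, by
          exact Finset.mem_insert_of_mem (Finset.mem_image_of_mem _ hi)⟩)
        rwa [mul_inv_rev, mul_assoc] at this
      · exact Nat.lt_succ_of_le (Finset.le_sup (f := fun c => len (c.1⁻¹ * u)) hc)) hd
  exact ⟨y, u, c, h⟩

end

end ForestComplex

end

noncomputable section

/-! ### The homology of the complex of forests -/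

namespace IntegralHomology

open Finsupp

/-- The linear combinations of words of length `n`. -/
def homog (α : Type) (n : ℕ) : Submodule ℤ (List α →₀ ℤ) := supported ℤ ℤ {u | u.length = n}

theorem single_mem_homog {α : Type} {n : ℕ} {u : List α} (h : u.length = n) (c : ℤ) :
    single u c ∈ homog α n := single_mem_supported _ _ h

end IntegralHomology

namespace ForestComplex

open Finsupp IntegralHomology FreeAction

section

variable {α β : Type}

theorem map_mem_homog {f : (List α →₀ ℤ) →ₗ[ℤ] (List β →₀ ℤ)} {n m : ℕ}
    (h : ∀ u : List α, u.length = n → f (single u 1) ∈ homog β m) {w : List α →₀ ℤ}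
    (hw : w ∈ homog α n) : f w ∈ homog β m :=
  map_mem_of_mem_supported f _ h hw

theorem pre_mem_homog (x : α) {n : ℕ} {w : List α →₀ ℤ} (hw : w ∈ homog α n) :
    pre x w ∈ homog α (n + 1) :=
  map_mem_homog (fun u hu => by rw [pre_single]; exact single_mem_homog (by simp [hu]) _) hw

theorem mapL_mem_homog (f : α → β) {n : ℕ} {w : List α →₀ ℤ} (hw : w ∈ homog α n) :
    mapL f w ∈ homog β n :=
  map_mem_homog (fun u hu => by rw [mapL_single]; exact single_mem_homog (by simp [hu]) _) hw

theorem slide_mem_homog (φ ψ : α → β) (h : β) (u : List α) :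
    slide φ ψ h u ∈ homog β (u.length + 1) := by
  induction u with
  | nil => exact single_mem_homog rfl _
  | cons g u ih =>
    exact Submodule.sub_mem _ (single_mem_homog (by simp) _) (pre_mem_homog _ ih)

theorem slideL_mem_homog (φ ψ : α → β) (h : β) {n : ℕ} {w : List α →₀ ℤ} (hw : w ∈ homog α n) :
    slideL φ ψ h w ∈ homog β (n + 1) :=
  map_mem_homog (fun u hu => by
    rw [slideL, lin_single, one_smul, ← hu]; exact slide_mem_homog φ ψ h u) hw

end

/-! The mapping cone of `thetaE` -/

section

variable {G A B : Type}

/-- The inclusion of the first summand of the cone. -/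
def inB : (G × A →₀ ℤ) →ₗ[ℤ] (G × (A ⊕ B) →₀ ℤ) := lmapDomain ℤ ℤ (Prod.map id Sum.inl)

/-- The inclusion of the second summand of the cone. -/
def inK : (G × B →₀ ℤ) →ₗ[ℤ] (G × (A ⊕ B) →₀ ℤ) := lmapDomain ℤ ℤ (Prod.map id Sum.inr)

theorem inB_single (g : G) (a : A) (c : ℤ) :
    inB (B := B) (single (g, a) c) = single (g, Sum.inl a) c := by simp [inB]

theorem inK_single (g : G) (b : B) (c : ℤ) :
    inK (A := A) (single (g, b) c) = single (g, Sum.inr b) c := by simp [inK]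

theorem exists_inB_add_inK (z : G × (A ⊕ B) →₀ ℤ) : ∃ b k, z = inB b + inK k := by
  induction z using Finsupp.induction_linear with
  | zero => exact ⟨0, 0, by simp⟩
  | add f g hf hg =>
    obtain ⟨b, k, rfl⟩ := hf
    obtain ⟨b', k', rfl⟩ := hg
    exact ⟨b + b', k + k', by simp only [map_add]; abel⟩
  | single p c =>
    obtain ⟨g, a | b⟩ := p
    · exact ⟨single (g, a) c, 0, by rw [inB_single, map_zero, add_zero]⟩
    · exact ⟨0, single (g, b) c, by rw [inK_single, map_zero, zero_add]⟩

theorem inB_add_inK_eq_zero {b : G × A →₀ ℤ} {k : G × B →₀ ℤ} (h : inB b + inK k = 0) :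
    b = 0 ∧ k = 0 := by
  let pB : (G × (A ⊕ B) →₀ ℤ) →ₗ[ℤ] (G × A →₀ ℤ) :=
    linearCombination ℤ fun p => p.2.elim (fun a => single (p.1, a) 1) fun _ => 0
  let pK : (G × (A ⊕ B) →₀ ℤ) →ₗ[ℤ] (G × B →₀ ℤ) :=
    linearCombination ℤ fun p => p.2.elim (fun _ => 0) fun b => single (p.1, b) 1
  have h1 : pB ∘ₗ inB = LinearMap.id := ext_single fun ⟨g, a⟩ => by simp [inB_single, pB]
  have h2 : pB ∘ₗ inK = 0 := ext_single fun ⟨g, a⟩ => by simp [inK_single, pB]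
  have h3 : pK ∘ₗ inB = 0 := ext_single fun ⟨g, a⟩ => by simp [inB_single, pK]
  have h4 : pK ∘ₗ inK = LinearMap.id := ext_single fun ⟨g, a⟩ => by simp [inK_single, pK]
  constructor
  · have := congr_arg pB h
    rwa [map_add, ← LinearMap.comp_apply, ← LinearMap.comp_apply, h1, h2, map_zero,
      LinearMap.zero_apply, add_zero] at this
  · have := congr_arg pK h
    rwa [map_add, ← LinearMap.comp_apply, ← LinearMap.comp_apply, h3, h4, map_zero,
      LinearMap.zero_apply, zero_add] at this

end

variable {G : Type} [Group G]

theorem faces_mem_homog (g : G) (u : List G) : faces g u ∈ homog G u.length := by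
  induction u generalizing g with
  | nil => exact single_mem_homog rfl _
  | cons h u ih =>
    exact Submodule.sub_mem _ (single_mem_homog (by simp) _) (pre_mem_homog _ (ih h))

theorem theta_mem_homog (τ : G →* G) (x : G) (l : List ℕ) : theta τ x l ∈ homog G l.length := by
  induction l with
  | nil => exact single_mem_homog rfl _
  | cons a l ih =>
    rw [theta]
    induction a with
    | zero => exact slideL_mem_homog _ _ _ ih
    | succ a ih' =>
      rw [Function.iterate_succ_apply']
      exact mapL_mem_homog _ ih'

theorem barD_mem (u : List G) : barD u ∈ supported ℤ ℤ {p : G × List G | p.2.length < u.length} := by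
  rcases u with _ | ⟨g, u⟩
  · exact Submodule.zero_mem _
  · refine Submodule.sub_mem _ (single_mem_supported _ _ (by simp)) ?_
    refine map_mem_of_mem_supported _ _ (fun v hv => ?_) (faces_mem_homog g u)
    rw [tens_single]
    exact single_mem_supported _ _ (by simp [show v.length = u.length from hv])

theorem length_up (l : List ℕ) : (up l).length = l.length := by cases l <;> simp [up]

theorem cubeD_mem (τ : G →* G) (x : G) (l : List ℕ) :
    cubeD τ x l ∈ supported ℤ ℤ {p : G × List ℕ | p.2.length < l.length} := by
  induction l with
  | nil => exact Submodule.zero_mem _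
  | cons a l ih =>
    rw [cubeD]
    induction a with
    | zero =>
      refine Submodule.sub_mem _ (Submodule.sub_mem _ (single_mem_supported _ _ (by simp [length_up]))
        (single_mem_supported _ _ (by simp [length_up]))) ?_
      refine map_mem_of_mem_supported _ _ (fun p hp => ?_) ih
      have hp' : p.2.length < l.length := hp
      rw [lmapDomain_apply, mapDomain_single]
      exact single_mem_supported _ _ (by simpa using hp')
    | succ a ih' =>
      rw [Function.iterate_succ_apply']
      refine map_mem_of_mem_supported _ _ (fun p hp => ?_) ih'
      have hp' : p.2.length < l.length + 1 := by simpa using hp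
      rw [lmapDomain_apply, mapDomain_single]
      exact single_mem_supported _ _ (by simpa [length_up] using hp')

section

variable {A B : Type}

theorem transL_inB (g : G) (z : G × A →₀ ℤ) :
    transL g (inB (B := B) z) = inB (transL g z) := by
  suffices transL g ∘ₗ inB (B := B) = inB ∘ₗ transL (X := A) g from LinearMap.congr_fun this z
  exact ext_single fun p => by simp [inB, transL_single]

theorem transL_inK (g : G) (z : G × B →₀ ℤ) :
    transL g (inK (A := A) z) = inK (transL g z) := by
  suffices transL g ∘ₗ inK (A := A) = inK ∘ₗ transL (X := B) g from LinearMap.congr_fun this z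
  exact ext_single fun p => by simp [inK, transL_single]

end

/-- The differential of the mapping cone. -/
def coneD (τ : G →* G) (x : G) : List G ⊕ List ℕ → (G × (List G ⊕ List ℕ) →₀ ℤ)
  | .inl u => inB (barD u)
  | .inr l => inB (tens 1 (theta τ x l)) - inK (cubeD τ x l)

/-- The degree of the cells of the mapping cone. -/
def coneDeg : List G ⊕ List ℕ → ℕ := Sum.elim List.length fun l => l.length + 1

variable {τ : G →* G} {x : G} {P : Set G}

theorem eqv_coneD_inB (z : G × List G →₀ ℤ) : eqv (coneD τ x) (inB z) = inB (eqv barD z) := by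
  suffices eqv (coneD τ x) ∘ₗ inB = inB ∘ₗ eqv barD from LinearMap.congr_fun this z
  exact ext_single fun ⟨g, u⟩ => by simp [inB_single, eqv_single, coneD, transL_inB]

theorem eqv_coneD_inK (z : G × List ℕ →₀ ℤ) :
    eqv (coneD τ x) (inK z) = inB (thetaE τ x z) - inK (eqv (cubeD τ x) z) := by
  suffices eqv (coneD τ x) ∘ₗ inK = inB ∘ₗ thetaE τ x - inK ∘ₗ eqv (cubeD τ x) from
    LinearMap.congr_fun this z
  exact ext_single fun ⟨g, u⟩ => by
    simp [inK_single, eqv_single, coneD, transL_inB, transL_inK, thetaE]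

theorem eqv_coneD_eqv_coneD (hx : ∀ g, τ g * x = x * τ (τ g)) (z : G × (List G ⊕ List ℕ) →₀ ℤ) :
    eqv (coneD τ x) (eqv (coneD τ x) z) = 0 := by
  obtain ⟨b, k, rfl⟩ := exists_inB_add_inK z
  simp only [map_add, map_sub, eqv_coneD_inB, eqv_coneD_inK, eqv_barD_eqv_barD,
    eqv_cubeD_eqv_cubeD hx, eqv_barD_thetaE hx, map_zero]
  abel

/-- A cycle of the cone consists of a forest cycle and a bar chain bounding its image. The forest
cycle bounds up to a multiple of a vertex, which the augmentation excludes; what remains is a bar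
cycle, to which the bar contraction applies. -/
theorem exists_eqv_coneD_eq (hP : IsForestMonoid τ x P) (z : G × (List G ⊕ List ℕ) →₀ ℤ)
    (hz : eqv (coneD τ x) z = 0) : ∃ y, eqv (coneD τ x) y = z := by
  obtain ⟨b, k, rfl⟩ := exists_inB_add_inK z
  have h0 : inB (eqv barD b + thetaE τ x k) + inK (- eqv (cubeD τ x) k) = 0 := by
    rw [← hz, map_add (eqv (coneD τ x)), eqv_coneD_inB, eqv_coneD_inK, map_add, map_neg]
    abel
  obtain ⟨h1, h2⟩ := inB_add_inK_eq_zero h0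
  rw [neg_eq_zero] at h2
  obtain ⟨y, u, c, rfl⟩ := exists_of_eqv_cubeD_eq_zero hP k h2
  have hu : ∀ v : G, ∀ c : ℤ, thetaE τ x (single (v, []) c) = single (v, []) c := fun v c => by
    rw [← tens_single, thetaE_tens, thetaL_nil, tens_single]
  rw [map_add, hu, ← eqv_barD_thetaE hP.map_mul] at h1
  have hc : c = 0 := by
    have := congr_arg barAug h1
    rw [map_add, map_add, barAug_eqv_barD, barAug_eqv_barD, barAug_single] at this
    simpa using this
  rw [hc, single_zero, add_zero] at h1 ⊢
  rw [← map_add] at h1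
  have h := eqv_barD_barS (b + thetaE τ x y)
  rw [h1, map_zero, sub_zero] at h
  -- The contraction leaves a multiple of the base point, and this is the image under `thetaE` of
  -- the same multiple of a forest vertex.
  refine ⟨inB (barS (b + thetaE τ x y)) + inK (single (1, []) (barAug (b + thetaE τ x y)) - y), ?_⟩
  rw [map_add, eqv_coneD_inB, eqv_coneD_inK, h, map_sub (thetaE τ x), hu,
    map_sub (eqv (cubeD τ x)), eqv_single _ ((1 : G), ([] : List ℕ)), cubeD, map_zero, smul_zero]
  simp only [map_sub, map_add, map_zero]
  abel

theorem coneDeg_lt (u : List G ⊕ List ℕ) : ∀ p ∈ (coneD τ x u).support, coneDeg p.2 < coneDeg u := by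
  suffices coneD τ x u ∈ supported ℤ ℤ {p | coneDeg p.2 < coneDeg u} from
    fun p hp => (mem_supported _ _).1 this hp
  rcases u with u | l
  · refine map_mem_of_mem_supported _ _ (fun p hp => ?_) (barD_mem u)
    rw [inB_single]
    exact single_mem_supported _ _ hp
  · refine Submodule.sub_mem _ ?_ ?_
    · have : tens (1 : G) (theta τ x l) ∈ supported ℤ ℤ {p | p.2.length = l.length} :=
        map_mem_of_mem_supported _ _ (fun p hp => by
          rw [tens_single]; exact single_mem_supported _ _ hp) (theta_mem_homog τ x l)
      refine map_mem_of_mem_supported _ _ (fun p hp => ?_) this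
      rw [inB_single]
      exact single_mem_supported _ _ (Nat.lt_succ_of_le (le_of_eq hp))
    · refine map_mem_of_mem_supported _ _ (fun p hp => ?_) (cubeD_mem τ x l)
      rw [inK_single]
      exact single_mem_supported _ _ (Nat.succ_lt_succ hp)

/-! ### The chain map from forests to bar chains is an isomorphism on homology -/

/-- The differential of the coinvariants of the mapping cone. -/
def coneBd (τ : G →* G) (x : G) : (List G ⊕ List ℕ →₀ ℤ) →ₗ[ℤ] (List G ⊕ List ℕ →₀ ℤ) :=
  linearCombination ℤ fun u => proj (coneD τ x u)

/-- The coinvariants of the mapping cone are exact. -/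
theorem exact_cone (hP : IsForestMonoid τ x P) {b : List G →₀ ℤ} {k : List ℕ →₀ ℤ}
    (hk : bdL k = 0) (hb : lin bdB b + thetaL τ x k = 0) :
    ∃ w p, b = lin bdB w + thetaL τ x p ∧ k = - bdL p := by
  let jB : (List G →₀ ℤ) →ₗ[ℤ] (List G ⊕ List ℕ →₀ ℤ) := lmapDomain ℤ ℤ Sum.inl
  let jK : (List ℕ →₀ ℤ) →ₗ[ℤ] (List G ⊕ List ℕ →₀ ℤ) := lmapDomain ℤ ℤ Sum.inr
  have pB : ∀ b : G × List G →₀ ℤ, proj (inB b) = jB (proj b) := fun b => by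
    suffices proj ∘ₗ inB = jB ∘ₗ proj (G := G) from LinearMap.congr_fun this b
    exact ext_single fun p => by simp [inB, proj_single, jB]
  have pK : ∀ b : G × List ℕ →₀ ℤ, proj (inK b) = jK (proj b) := fun b => by
    suffices proj ∘ₗ inK = jK ∘ₗ proj (G := G) from LinearMap.congr_fun this b
    exact ext_single fun p => by simp [inK, proj_single, jK]
  have hB : ∀ b, coneBd τ x (jB b) = jB (lin bdB b) := fun b => by
    rw [← linearCombination_proj_barD]
    suffices coneBd τ x ∘ₗ jB = jB ∘ₗ linearCombination ℤ fun u => proj (barD u) from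
      LinearMap.congr_fun this b
    exact ext_single fun u => by simp [coneBd, jB, coneD, pB]
  have hK : ∀ k, coneBd τ x (jK k) = jB (thetaL τ x k) - jK (bdL k) := fun b => by
    rw [← linearCombination_proj_cubeD τ x]
    suffices coneBd τ x ∘ₗ jK = jB ∘ₗ thetaL τ x -
      jK ∘ₗ linearCombination ℤ fun u => proj (cubeD τ x u) from LinearMap.congr_fun this b
    exact ext_single fun u => by simp [coneBd, jK, coneD, pB, pK, proj_tens, thetaL, lin_single]
  have hdec : ∀ y : List G ⊕ List ℕ →₀ ℤ, ∃ w p, y = jB w + jK p := fun y => by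
    obtain ⟨w, p, h⟩ := exists_inB_add_inK (tens (1 : G) y)
    refine ⟨proj w, proj p, ?_⟩
    rw [← pB, ← pK, ← map_add, ← h, proj_tens]
  have hzero : ∀ w p, jB w + jK p = 0 → w = 0 ∧ p = 0 := fun w p h => by
    have tB : tens (1 : G) (jB w) = inB (tens 1 w) := by
      suffices tens (1 : G) ∘ₗ jB = inB ∘ₗ tens 1 from LinearMap.congr_fun this w
      exact ext_single fun u => by simp [tens_single, jB, inB]
    have tK : tens (1 : G) (jK p) = inK (tens 1 p) := by
      suffices tens (1 : G) ∘ₗ jK = inK ∘ₗ tens 1 from LinearMap.congr_fun this p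
      exact ext_single fun u => by simp [tens_single, jK, inK]
    have h' := congr_arg (tens (1 : G)) h
    rw [map_add, tB, tK, map_zero] at h'
    obtain ⟨h1, h2⟩ := inB_add_inK_eq_zero h'
    rw [← proj_tens (1 : G) w, ← proj_tens (1 : G) p, h1, h2]
    simp
  obtain ⟨y, hy⟩ := exact_coinvariants (coneD τ x) coneDeg coneDeg_lt
    (eqv_coneD_eqv_coneD hP.map_mul) (exists_eqv_coneD_eq hP) (jB b + jK k) (by
      change coneBd τ x _ = 0
      rw [map_add, hB, hK, hk, map_zero, sub_zero, ← map_add, hb, map_zero])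
  obtain ⟨w, p, rfl⟩ := hdec y
  change coneBd τ x _ = _ at hy
  rw [map_add, hB, hK] at hy
  obtain ⟨h1, h2⟩ := hzero (lin bdB w + thetaL τ x p - b) (- bdL p - k) (by
    rw [← sub_eq_zero] at hy
    rw [← hy]
    simp only [map_add, map_sub, map_neg]
    abel)
  exact ⟨w, p, (sub_eq_zero.1 h1).symm, (sub_eq_zero.1 h2).symm⟩

/-- Injectivity on homology: `-w` and `k` together form a cycle of the cone. -/
theorem exists_bdL_eq_of_thetaL (hP : IsForestMonoid τ x P) {k : List ℕ →₀ ℤ} (hk : bdL k = 0)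
    {w : List G →₀ ℤ} (h : thetaL τ x k = lin bdB w) : ∃ p, k = bdL p := by
  obtain ⟨-, p, -, hp⟩ := exact_cone hP hk (b := -w) (by rw [map_neg, h, neg_add_cancel])
  exact ⟨-p, by rw [hp, map_neg]⟩

/-- Surjectivity on homology: a bar cycle is a cycle of the cone with zero forest component. -/
theorem exists_thetaL_eq (hP : IsForestMonoid τ x P) {b : List G →₀ ℤ} (hb : lin bdB b = 0) :
    ∃ k w, bdL k = 0 ∧ b = thetaL τ x k + lin bdB w := by
  obtain ⟨w, p, h, hp⟩ := exact_cone hP (map_zero bdL) (b := b) (by rw [hb, map_zero, add_zero])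
  exact ⟨p, w, by rw [← neg_eq_zero, ← hp], by rw [h, add_comm]⟩

end ForestComplex

end

noncomputable section

/-! ### Standard dyadic intervals and Thompson's group -/

namespace Thompson

open ForestComplex

/-- The affine map of `[0,1]` onto the standard dyadic interval with address `w`. -/
def ev : List Bool → I → I
  | [], t => t
  | false :: w, t => halfL (ev w t)
  | true :: w, t => halfR (ev w t)

theorem coe_halfL (t : I) : (halfL t : ℝ) = t / 2 := rfl

theorem coe_halfR (t : I) : (halfR t : ℝ) = (t + 1) / 2 := rfl

theorem halfL_injective : Function.Injective halfL := fun s t h => Subtype.ext (by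
  have := congr_arg Subtype.val h
  rw [coe_halfL, coe_halfL] at this
  linarith)

theorem halfR_injective : Function.Injective halfR := fun s t h => Subtype.ext (by
  have := congr_arg Subtype.val h
  rw [coe_halfR, coe_halfR] at this
  linarith)

theorem exists_half (t : I) : (∃ s, t = halfL s) ∨ ∃ s, t = halfR s := by
  rcases le_total (t : ℝ) (1 / 2) with h | h
  · obtain ⟨s, hs⟩ := exists_double t h
    exact Or.inl ⟨s, Subtype.ext (by rw [coe_halfL, hs]; ring)⟩
  · obtain ⟨s, hs⟩ := exists_double_sub t h
    exact Or.inr ⟨s, Subtype.ext (by rw [coe_halfR, hs]; ring)⟩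

theorem ev_append (v w : List Bool) (t : I) : ev (v ++ w) t = ev v (ev w t) := by
  induction v with
  | nil => rfl
  | cons b v ih => cases b <;> simp [ev, ih]

theorem ev_false_cons (w : List Bool) (t : I) : ev (false :: w) t = halfL (ev w t) := rfl

theorem ev_true_cons (w : List Bool) (t : I) : ev (true :: w) t = halfR (ev w t) := rfl

theorem halfL_ne_halfR_of_lt {s t : I} (h : (s : ℝ) < 1 ∨ 0 < (t : ℝ)) : halfL s ≠ halfR t := by
  intro e
  have := congr_arg Subtype.val e
  rw [coe_halfL, coe_halfR] at this
  have := s.2.2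
  have := t.2.1
  rcases h with h | h <;> linarith

theorem exists_coe_ev (w : List Bool) :
    ∃ a : ℕ, a < 2 ^ w.length ∧ ∀ t : I, (ev w t : ℝ) = (a + t) / 2 ^ w.length := by
  induction w with
  | nil => exact ⟨0, by simp, fun t => by simp [ev]⟩
  | cons b w ih =>
    obtain ⟨a, ha, h⟩ := ih
    cases b
    · refine ⟨a, by rw [List.length_cons, pow_succ]; omega, fun t => ?_⟩
      rw [ev_false_cons, coe_halfL, h, List.length_cons, pow_succ]
      field_simp
    · refine ⟨a + 2 ^ w.length, by rw [List.length_cons, pow_succ]; omega, fun t => ?_⟩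
      rw [ev_true_cons, coe_halfR, h, List.length_cons, pow_succ]
      push_cast
      field_simp
      ring

theorem exists_word (d a : ℕ) (h : a < 2 ^ d) :
    ∃ w : List Bool, w.length = d ∧ ∀ t : I, (ev w t : ℝ) = (a + t) / 2 ^ d := by
  induction d generalizing a with
  | zero =>
    obtain rfl : a = 0 := by simpa using h
    exact ⟨[], rfl, fun t => by simp [ev]⟩
  | succ d ih =>
    rw [pow_succ] at h
    by_cases ha : a < 2 ^ d
    · obtain ⟨w, rfl, hw⟩ := ih a ha
      refine ⟨false :: w, rfl, fun t => ?_⟩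
      rw [ev_false_cons, coe_halfL, hw, pow_succ]
      field_simp
    · obtain ⟨w, rfl, hw⟩ := ih (a - 2 ^ d) (by omega)
      refine ⟨true :: w, rfl, fun t => ?_⟩
      rw [ev_true_cons, coe_halfR, hw, pow_succ, Nat.cast_sub (not_lt.1 ha)]
      push_cast
      field_simp
      ring

theorem ev_zero_lt_one (w : List Bool) : (ev w 0 : ℝ) < ev w 1 := by
  obtain ⟨a, -, h⟩ := exists_coe_ev w
  rw [h, h]
  have : ((0 : I) : ℝ) < (1 : I) := by norm_num
  gcongr

theorem ev_injective {v w : List Bool} (h : ∀ t, ev v t = ev w t) : v = w := by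
  have h0 : ∀ t : I, (0 : ℝ) ≤ t := fun t => t.2.1
  have h1 : ∀ t : I, (t : ℝ) ≤ 1 := fun t => t.2.2
  have key : ∀ v w : List Bool, ¬ ∀ t, ev (false :: v) t = ev (true :: w) t := by
    intro v w h
    exact halfL_ne_halfR_of_lt (Or.inl ((ev_zero_lt_one v).trans_le (h1 _))) (h 0)
  have keyL : ∀ w : List Bool, ¬ ∀ t, ev [] t = ev (false :: w) t := by
    intro w h
    have := congr_arg Subtype.val (h 1)
    rw [ev_false_cons, coe_halfL] at this
    have h2 := h1 (ev w 1)
    have h3 : (ev [] 1 : ℝ) = 1 := rfl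
    linarith
  have keyR : ∀ w : List Bool, ¬ ∀ t, ev [] t = ev (true :: w) t := by
    intro w h
    have := congr_arg Subtype.val (h 0)
    rw [ev_true_cons, coe_halfR] at this
    have h2 := h0 (ev w 0)
    have h3 : (ev [] 0 : ℝ) = 0 := rfl
    linarith
  induction v generalizing w with
  | nil =>
    rcases w with _ | ⟨_ | _, w⟩
    · rfl
    · exact absurd h (keyL w)
    · exact absurd h (keyR w)
  | cons b v ih =>
    cases b <;> rcases w with _ | ⟨_ | _, w⟩
    · exact absurd (fun t => (h t).symm) (keyL v)
    · rw [ih fun t => halfL_injective (h t)]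
    · exact absurd h (key v w)
    · exact absurd (fun t => (h t).symm) (keyR v)
    · exact absurd (fun t => (h t).symm) (key w v)
    · rw [ih fun t => halfR_injective (h t)]

/-! The action of elements of `F` on standard dyadic intervals -/

theorem mu_halfL (f g : F) (s : I) : (mu (f, g)).1 (halfL s) = halfL (f.1 s) :=
  Subtype.ext (glueFun_left f.1 g.1 (halfL s) s (by rw [coe_halfL]; linarith [s.2.2])
    (by rw [coe_halfL]; ring))

theorem mu_halfR (f g : F) (s : I) : (mu (f, g)).1 (halfR s) = halfR (g.1 s) :=
  Subtype.ext (glueFun_right f.1 g.1 (halfR s) s (by rw [coe_halfR]; linarith [s.2.1])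
    (by rw [coe_halfR]; ring))

theorem x0_halfL (s : I) : x0.1 (halfL s) = halfL (halfL s) := Subtype.ext (by
  change x0Fun (s / 2) = s / 2 / 2
  rw [x0Fun, if_pos (by linarith [s.2.2])])

theorem x0_halfR_halfL (s : I) : x0.1 (halfR (halfL s)) = halfL (halfR s) := Subtype.ext (by
  have h0 := s.2.1
  have h1 := s.2.2
  change x0Fun ((s / 2 + 1) / 2) = (s + 1) / 2 / 2
  unfold x0Fun
  split_ifs <;> linarith)

theorem x0_halfR_halfR (s : I) : x0.1 (halfR (halfR s)) = halfR s := Subtype.ext (by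
  have h0 := s.2.1
  have h1 := s.2.2
  change x0Fun (((s + 1) / 2 + 1) / 2) = (s + 1) / 2
  unfold x0Fun
  split_ifs <;> linarith)

theorem F_ext {f g : F} (h : ∀ t, f.1 t = g.1 t) : f = g := Subtype.ext (OrderIso.ext (funext h))

theorem mul_apply (f g : F) (t : I) : (f * g).1 t = f.1 (g.1 t) := rfl

theorem F_ext_three {f g : F} (hL : ∀ s, f.1 (halfL s) = g.1 (halfL s))
    (hRL : ∀ s, f.1 (halfR (halfL s)) = g.1 (halfR (halfL s)))
    (hRR : ∀ s, f.1 (halfR (halfR s)) = g.1 (halfR (halfR s))) : f = g := by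
  refine F_ext fun t => ?_
  rcases exists_half t with ⟨s, rfl⟩ | ⟨s, rfl⟩
  · exact hL s
  · rcases exists_half s with ⟨s, rfl⟩ | ⟨s, rfl⟩
    · exact hRL s
    · exact hRR s

/-- The shift `f ↦ 1 * f` of Thompson's group. -/
def shift : F →* F := mu.comp (MonoidHom.inr F F)

theorem shift_apply (f : F) : shift f = mu (1, f) := rfl

theorem one_apply (t : I) : (1 : F).1 t = t := rfl

theorem shift_halfL (f : F) (s : I) : (shift f).1 (halfL s) = halfL s := mu_halfL _ _ _

theorem shift_halfR (f : F) (s : I) : (shift f).1 (halfR s) = halfR (f.1 s) := mu_halfR _ _ _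

/-- Conjugation by `x₀` reassociates the product. -/
theorem mu_mu_mul_x0 (f g h : F) : mu (mu (f, g), h) * x0 = x0 * mu (f, mu (g, h)) := by
  refine F_ext_three (fun s => ?_) (fun s => ?_) fun s => ?_ <;>
  simp only [mul_apply, mu_halfL, mu_halfR, x0_halfL, x0_halfR_halfL, x0_halfR_halfR]

theorem shift_mul_x0 (g : F) : shift g * x0 = x0 * shift (shift g) := by
  have h := mu_mu_mul_x0 1 1 g
  rwa [show mu (1, 1) = 1 from map_one mu] at h

/-- The pentagon relation. -/
theorem pentagon : mu (x0, 1) * (x0 * shift x0) = x0 * x0 := by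
  refine F_ext_three (fun s => ?_) (fun s => ?_) fun s => ?_
  · simp only [mul_apply, mu_halfL, x0_halfL, shift_halfL]
  · simp only [mul_apply, mu_halfL, x0_halfL, shift_halfR, x0_halfR_halfL]
  · rcases exists_half s with ⟨s, rfl⟩ | ⟨s, rfl⟩
    · simp only [mul_apply, mu_halfL, shift_halfR, x0_halfR_halfL, x0_halfR_halfR]
    · simp only [mul_apply, mu_halfR, shift_halfR, x0_halfR_halfR, one_apply]

/-! ### Leaves, generators and forests -/

/-- `f` maps the interval with address `w` affinely onto the interval with address `v`. -/
def Sends (f : F) (w v : List Bool) : Prop := ∀ t, f.1 (ev w t) = ev v t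

theorem Sends.append {f : F} {w v : List Bool} (h : Sends f w v) (u : List Bool) :
    Sends f (w ++ u) (v ++ u) := fun t => by rw [ev_append, ev_append, h]

theorem Sends.mul {f g : F} {w v u : List Bool} (hf : Sends f v u) (hg : Sends g w v) :
    Sends (f * g) w u := fun t => by rw [mul_apply, hg, hf]

theorem Sends.inv {f : F} {w v : List Bool} (h : Sends f w v) : Sends f⁻¹ v w := fun t => by
  rw [← h t, ← mul_apply, inv_mul_cancel, one_apply]

theorem Sends.unique {f : F} {w v v' : List Bool} (h : Sends f w v) (h' : Sends f w v') :
    v = v' := ev_injective fun t => by rw [← h, ← h']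

theorem Sends.unique_left {f : F} {w w' v : List Bool} (h : Sends f w v) (h' : Sends f w' v) :
    w = w' := h.inv.unique h'.inv

theorem sends_one (w : List Bool) : Sends 1 w w := fun _ => rfl

/-- The address of the interval `[1 - 2⁻ⁿ, 1 - 2⁻⁽ⁿ⁺¹⁾]`. -/
def leaf (n : ℕ) : List Bool := List.replicate n true ++ [false]

theorem leaf_zero : leaf 0 = [false] := rfl

theorem leaf_succ (n : ℕ) : leaf (n + 1) = true :: leaf n := rfl

/-- The generators `x₀, x₁, …` of Thompson's group. -/
abbrev xgen (n : ℕ) : F := gen shift x0 n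

theorem xgen_zero : xgen 0 = x0 := rfl

theorem xgen_succ (n : ℕ) : xgen (n + 1) = shift (xgen n) := gen_succ _ _ _

theorem sends_shift_false (f : F) (w : List Bool) : Sends (shift f) (false :: w) (false :: w) :=
  fun t => by rw [ev_false_cons, shift_halfL]

theorem sends_shift_true {f : F} {w v : List Bool} (h : Sends f w v) :
    Sends (shift f) (true :: w) (true :: v) :=
  fun t => by rw [ev_true_cons, ev_true_cons, shift_halfR, h]

theorem sends_x0_L (w : List Bool) : Sends x0 (false :: w) (false :: false :: w) :=
  fun t => by simp only [ev_false_cons, x0_halfL]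

theorem sends_x0_RL (w : List Bool) : Sends x0 (true :: false :: w) (false :: true :: w) :=
  fun t => by simp only [ev_false_cons, ev_true_cons, x0_halfR_halfL]

theorem sends_x0_RR (w : List Bool) : Sends x0 (true :: true :: w) (true :: w) :=
  fun t => by simp only [ev_true_cons, x0_halfR_halfR]

theorem map_one_eq (f : F) : f.1 1 = 1 := map_top f.1

theorem map_zero_eq (f : F) : f.1 0 = 0 := map_bot f.1

/-- The preimage of the interval `leaf n` under `xgen n` is the union of `leaf n` and `leaf (n +
1)`, which is not a standard dyadic interval. -/
theorem not_sends_xgen_leaf (n : ℕ) (w : List Bool) : ¬ Sends (xgen n) w (leaf n) := by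
  have hlt : ∀ w v : List Bool, ∀ f : F, ev w 1 = 1 → ev v 1 ≠ 1 → ¬ Sends f w v := by
    intro w v f hw hv h
    exact hv (by rw [← h 1, hw, map_one_eq])
  have hone : ∀ w : List Bool, ev (false :: w) 1 ≠ 1 := fun w h => by
    have := congr_arg Subtype.val h
    rw [ev_false_cons, coe_halfL] at this
    have h2 := (ev w 1).2.2
    have h3 : ((1 : I) : ℝ) = 1 := rfl
    linarith
  have hR : halfR 1 = 1 := Subtype.ext (by rw [coe_halfR]; norm_num)
  induction n generalizing w with
  | zero =>
    rw [xgen_zero, leaf_zero]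
    rcases w with _ | ⟨_ | _, _ | ⟨_ | _, w⟩⟩
    · exact hlt _ _ _ rfl (hone _)
    · exact fun h => by simpa using h.unique (sends_x0_L _)
    · exact fun h => by simpa using h.unique (sends_x0_L _)
    · exact fun h => by simpa using h.unique (sends_x0_L _)
    · exact hlt _ _ _ hR (hone _)
    · exact fun h => by simpa using h.unique (sends_x0_RL _)
    · exact fun h => by simpa using h.unique (sends_x0_RR _)
  | succ n ih =>
    rw [xgen_succ, leaf_succ]
    rcases w with _ | ⟨_ | _, w⟩
    · intro h
      have := congr_arg Subtype.val (h 0)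
      rw [show ev [] 0 = 0 from rfl, map_zero_eq, ev_true_cons, coe_halfR] at this
      have h2 := (ev (leaf n) 0).2.1
      have h3 : ((0 : I) : ℝ) = 0 := rfl
      linarith
    · exact fun h => by simpa using h.unique (sends_shift_false _ _)
    · refine fun h => ih w fun t => halfR_injective ?_
      rw [← shift_halfR, ← ev_true_cons, ← ev_true_cons, h]

/-- With `not_sends_xgen_leaf` this says that the inverse of `xgen n` breaks exactly one standard
interval not ending at `1`. The condition `false ∈ v` excludes the intervals ending at `1`
(`ev_one_eq_one_iff`). -/
theorem exists_sends_xgen (n : ℕ) {v : List Bool} (h1 : false ∈ v) (h2 : v ≠ leaf n) :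
    ∃ w, Sends (xgen n) w v := by
  induction n generalizing v with
  | zero =>
    rw [xgen_zero]
    rcases v with _ | ⟨_ | _, _ | ⟨_ | _, v⟩⟩
    · simp at h1
    · exact absurd rfl h2
    · exact ⟨_, sends_x0_L _⟩
    · exact ⟨_, sends_x0_RL _⟩
    · simp at h1
    · exact ⟨_, sends_x0_RR _⟩
    · exact ⟨_, sends_x0_RR _⟩
  | succ n ih =>
    rw [xgen_succ]
    rcases v with _ | ⟨_ | _, v⟩
    · simp at h1
    · exact ⟨_, sends_shift_false _ _⟩
    · obtain ⟨w, hw⟩ := ih (v := v) (by simpa using h1) fun h => h2 (by rw [h, leaf_succ])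
      exact ⟨_, sends_shift_true hw⟩

theorem ev_one_eq_one_iff (w : List Bool) : ev w 1 = 1 ↔ false ∉ w := by
  induction w with
  | nil => simp [ev]
  | cons b w ih =>
    cases b
    · simp only [List.mem_cons, true_or, not_true, iff_false]
      intro h
      have := congr_arg Subtype.val h
      rw [ev_false_cons, coe_halfL] at this
      have h2 := (ev w 1).2.2
      have h3 : ((1 : I) : ℝ) = 1 := rfl
      linarith
    · simp only [List.mem_cons, Bool.false_eq_true, false_or, ← ih, ev_true_cons]
      constructor
      · intro h
        have := congr_arg Subtype.val h
        rw [coe_halfR] at this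
        refine Subtype.ext ?_
        have h3 : ((1 : I) : ℝ) = 1 := rfl
        linarith
      · intro h
        rw [h]
        exact Subtype.ext (by rw [coe_halfR]; norm_num)

theorem Sends.false_mem {f : F} {w v : List Bool} (h : Sends f w v) (hw : false ∈ w) :
    false ∈ v := by
  by_contra hv
  rw [← ev_one_eq_one_iff, ← h 1] at hv
  have : f.1 (ev w 1) = f.1 1 := by rw [hv, map_one_eq]
  exact (ev_one_eq_one_iff w).1 (f.1.injective this) hw

theorem false_mem_leaf (n : ℕ) : false ∈ leaf n := by simp [leaf]

theorem exists_leaf_append {w : List Bool} (h : false ∈ w) : ∃ n u, w = leaf n ++ u := by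
  induction w with
  | nil => simp at h
  | cons b w ih =>
    cases b
    · exact ⟨0, w, rfl⟩
    · obtain ⟨n, u, rfl⟩ := ih (by simpa using h)
      exact ⟨n + 1, u, rfl⟩

theorem exists_sends_of_false_mem (n : ℕ) {w : List Bool} (h : false ∈ w) :
    ∃ v, Sends (xgen n) w v := by
  induction n generalizing w with
  | zero =>
    rw [xgen_zero]
    rcases w with _ | ⟨_ | _, _ | ⟨_ | _, w⟩⟩
    · simp at h
    · exact ⟨_, sends_x0_L _⟩
    · exact ⟨_, sends_x0_L _⟩
    · exact ⟨_, sends_x0_L _⟩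
    · simp at h
    · exact ⟨_, sends_x0_RL _⟩
    · exact ⟨_, sends_x0_RR _⟩
  | succ n ih =>
    rw [xgen_succ]
    rcases w with _ | ⟨_ | _, w⟩
    · simp at h
    · exact ⟨_, sends_shift_false _ _⟩
    · obtain ⟨v, hv⟩ := ih (w := w) (by simpa using h)
      exact ⟨_, sends_shift_true hv⟩

theorem sends_xgen_leaf {i j : ℕ} (h : i < j) : Sends (xgen i) (leaf (j + 1)) (leaf j) := by
  induction i generalizing j with
  | zero =>
    obtain ⟨j, rfl⟩ : ∃ k, j = k + 1 := ⟨j - 1, by omega⟩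
    exact sends_x0_RR _
  | succ i ih =>
    obtain ⟨j, rfl⟩ : ∃ k, j = k + 1 := ⟨j - 1, by omega⟩
    rw [xgen_succ]
    exact sends_shift_true (ih (by omega))

theorem sends_xgen_replicate {i j : ℕ} (h : i < j) :
    Sends (xgen i) (List.replicate (j + 1) true) (List.replicate j true) := by
  induction i generalizing j with
  | zero =>
    obtain ⟨j, rfl⟩ : ∃ k, j = k + 1 := ⟨j - 1, by omega⟩
    exact sends_x0_RR _
  | succ i ih =>
    obtain ⟨j, rfl⟩ : ∃ k, j = k + 1 := ⟨j - 1, by omega⟩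
    rw [xgen_succ]
    exact sends_shift_true (ih (by omega))

/-- The elements of `F` mapping each interval `[1 - 2⁻ⁿ, 1 - 2⁻⁽ⁿ⁺¹⁾]` affinely onto a standard
dyadic interval. -/
def forests : Set F := {f | ∀ n, ∃ v, Sends f (leaf n) v}

theorem exists_sends_of_mem_forests {f : F} (hf : f ∈ forests) {w : List Bool} (hw : false ∈ w) :
    ∃ v, Sends f w v := by
  obtain ⟨n, u, rfl⟩ := exists_leaf_append hw
  obtain ⟨v, hv⟩ := hf n
  exact ⟨_, hv.append u⟩

theorem one_mem_forests : 1 ∈ forests := fun n => ⟨_, sends_one (leaf n)⟩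

theorem mul_mem_forests {f g : F} (hf : f ∈ forests) (hg : g ∈ forests) : f * g ∈ forests := by
  intro n
  obtain ⟨v, hv⟩ := hg n
  obtain ⟨u, hu⟩ := exists_sends_of_mem_forests hf (hv.false_mem (false_mem_leaf n))
  exact ⟨u, hu.mul hv⟩

theorem xgen_mem_forests (n : ℕ) : xgen n ∈ forests :=
  fun m => exists_sends_of_false_mem n (false_mem_leaf m)

/-- The generator with index `i` divides a forest on the left exactly when the `i`-th tree is not a
single leaf. All divisibility properties below are deduced from this criterion. -/
theorem xgen_inv_mul_mem_iff {p : F} (hp : p ∈ forests) (i : ℕ) :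
    (xgen i)⁻¹ * p ∈ forests ↔ ∀ n, ¬ Sends p (leaf n) (leaf i) := by
  constructor
  · intro h n hn
    obtain ⟨v, hv⟩ := h n
    have : Sends (xgen i)⁻¹ (leaf i) v := by
      have h2 := hv.mul hn.inv
      rwa [mul_inv_cancel_right] at h2
    have h3 := this.inv
    rw [inv_inv] at h3
    exact not_sends_xgen_leaf i v h3
  · intro h n
    obtain ⟨v, hv⟩ := hp n
    obtain ⟨w, hw⟩ := exists_sends_xgen i (hv.false_mem (false_mem_leaf n))
      fun e => h n (by rw [← e]; exact hv)
    exact ⟨w, hw.inv.mul hv⟩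

end Thompson

end

noncomputable section

/-! ### The monoid of forests in Thompson's group -/

namespace Thompson

open ForestComplex

theorem coe_ev_leaf (n : ℕ) (t : I) : (ev (leaf n) t : ℝ) = 1 - 1 / 2 ^ n + t / 2 ^ (n + 1) := by
  induction n with
  | zero => simp [leaf_zero, ev, coe_halfL]
  | succ n ih =>
    rw [leaf_succ, ev_true_cons, coe_halfR, ih]
    field_simp
    ring

theorem exists_ev_leaf {t : I} (h : t ≠ 1) : ∃ i s, t = ev (leaf i) s := by
  have key : ∀ (N : ℕ) (t : I), (t : ℝ) ≤ 1 - 1 / 2 ^ N → ∃ i s, t = ev (leaf i) s := by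
    intro N
    induction N with
    | zero =>
      intro t ht
      refine ⟨0, 0, Subtype.ext ?_⟩
      rw [coe_ev_leaf]
      have := t.2.1
      norm_num at ht ⊢
      exact Subtype.ext (by linarith [show ((0 : I) : ℝ) = 0 from rfl])
    | succ N ih =>
      intro t ht
      rcases exists_half t with ⟨s, rfl⟩ | ⟨s, rfl⟩
      · exact ⟨0, s, rfl⟩
      · obtain ⟨i, r, rfl⟩ := ih s (by
          rw [coe_halfR, pow_succ] at ht
          have : (1 : ℝ) / (2 ^ N * 2) = 1 / 2 ^ N / 2 := by field_simp
          linarith)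
        exact ⟨i + 1, r, rfl⟩
  have h1 : (t : ℝ) < 1 := lt_of_le_of_ne t.2.2 fun e => h (Subtype.ext e)
  obtain ⟨N, hN⟩ := exists_pow_lt_of_lt_one (sub_pos.2 h1) (show (1 / 2 : ℝ) < 1 by norm_num)
  refine key N t ?_
  rw [one_div_pow] at hN
  linarith

/-- A forest with only trivial trees is the identity. Inductively `p` fixes the left end of `leaf
i`; the leaf mapped onto `leaf i` has the same left end, so it is `leaf i` itself, and `p` fixes the
right end too. -/
theorem eq_one_of_sends_leaf {p : F} (h : ∀ i, ∃ n, Sends p (leaf n) (leaf i)) : p = 1 := by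
  have key : ∀ i, p.1 (ev (leaf i) 0) = ev (leaf i) 0 → Sends p (leaf i) (leaf i) := by
    intro i hi
    obtain ⟨n, hn⟩ := h i
    have e := congr_arg Subtype.val (p.1.injective ((hn 0).trans hi.symm))
    rw [coe_ev_leaf, coe_ev_leaf] at e
    simp only [Set.Icc.coe_zero, zero_div, add_zero, sub_right_inj, one_div, inv_inj] at e
    rwa [pow_right_injective₀ (by norm_num) (by norm_num) e] at hn
  have key' : ∀ i, Sends p (leaf i) (leaf i) := by
    intro i
    induction i with
    | zero => exact key 0 (by rw [show ev (leaf 0) 0 = 0 from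
        Subtype.ext (by rw [coe_ev_leaf]; norm_num), map_zero_eq])
    | succ i ih =>
      refine key _ ?_
      rw [show ev (leaf (i + 1)) 0 = ev (leaf i) 1 from Subtype.ext (by
        rw [coe_ev_leaf, coe_ev_leaf, Set.Icc.coe_zero, Set.Icc.coe_one]; field_simp; ring), ih]
  refine F_ext fun t => ?_
  by_cases ht : t = 1
  · rw [ht, map_one_eq, map_one_eq]
  · obtain ⟨i, s, rfl⟩ := exists_ev_leaf ht
    exact key' i s

/-- `xgen i` maps `leaf (j + 1)` onto `leaf j`, so a trivial tree at `j + 1` after dividing by `xgen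
i` would have been a trivial tree of `p` at `j`. -/
theorem lcm_mem_forests {p : F} (hp : p ∈ forests) {i j : ℕ} (h : i < j)
    (hi : (xgen i)⁻¹ * p ∈ forests) (hj : (xgen j)⁻¹ * p ∈ forests) :
    (xgen (j + 1))⁻¹ * ((xgen i)⁻¹ * p) ∈ forests := by
  rw [xgen_inv_mul_mem_iff hi]
  intro n hn
  have := (sends_xgen_leaf h).mul hn
  rw [mul_inv_cancel_left] at this
  exact (xgen_inv_mul_mem_iff hp j).1 hj n this

theorem exists_xgen_inv_mul_mem {p : F} (hp : p ∈ forests) (h : p ≠ 1) :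
    ∃ i, (xgen i)⁻¹ * p ∈ forests := by
  by_contra! hc
  refine h (eq_one_of_sends_leaf fun i => ?_)
  have := hc i
  rw [xgen_inv_mul_mem_iff hp] at this
  push Not at this
  exact this

theorem xgen_inv_notMem (i : ℕ) : (xgen i)⁻¹ ∉ forests := by
  rw [← mul_one (xgen i)⁻¹, xgen_inv_mul_mem_iff one_mem_forests]
  exact fun h => h i (sends_one _)

theorem exists_common_denominator (S : Finset I) (hS : ∀ s ∈ S, IsDyadic (s : ℝ)) :
    ∃ r : ℕ, ∀ s ∈ S, ∃ c : ℤ, (s : ℝ) = c / 2 ^ r := by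
  choose! m n h using hS
  refine ⟨S.sup n, fun s hs => ⟨m s * 2 ^ (S.sup n - n s), ?_⟩⟩
  have hle : n s ≤ S.sup n := Finset.le_sup hs
  nth_rw 1 [h s hs]
  push_cast
  rw [div_eq_div_iff (by positivity) (by positivity), mul_assoc, ← pow_add,
    Nat.sub_add_cancel hle]

/-- An element of `F` maps every sufficiently small standard dyadic interval affinely onto a
standard dyadic interval. -/
theorem exists_depth (f : F) : ∃ m, ∀ w : List Bool, m ≤ w.length → ∃ v, Sends f w v := by
  obtain ⟨S, hS, hA⟩ := f.2
  obtain ⟨r, hr⟩ := exists_common_denominator S fun s hs => (hS s hs).1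
  have key : ∀ u : List Bool, u.length = r →
      ∃ d₀, ∀ w : List Bool, d₀ ≤ w.length → ∃ v, Sends f (u ++ w) v := by
    intro u hu
    obtain ⟨a, -, ha⟩ := exists_coe_ev u
    rw [hu] at ha
    have hpos : (0 : ℝ) < 2 ^ r := by positivity
    have h0 : ((0 : I) : ℝ) = 0 := rfl
    have h1 : ((1 : I) : ℝ) = 1 := rfl
    have hmono : ∀ s t : I, s ≤ t → ev u s ≤ ev u t := fun s t hst => by
      change (ev u s : ℝ) ≤ ev u t
      rw [ha, ha]
      have : (s : ℝ) ≤ t := hst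
      gcongr
    -- All breakpoints are multiples of `1 / 2 ^ r`, so none lies inside the interval with address
    -- `u`.
    obtain ⟨k, hk⟩ := hA (ev u 0) (ev u 1) (hmono 0 1 zero_le_one) (by
      rintro s hs ⟨hs0, hs1⟩
      obtain ⟨c, hc⟩ := hr s hs
      have hs0 : (ev u 0 : ℝ) < s := hs0
      have hs1 : (s : ℝ) < ev u 1 := hs1
      rw [ha, hc, div_lt_div_iff_of_pos_right hpos, h0, add_zero] at hs0
      rw [ha, hc, div_lt_div_iff_of_pos_right hpos, h1] at hs1
      have hs0 : (a : ℤ) < c := by exact_mod_cast hs0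
      have hs1 : c < (a : ℤ) + 1 := by exact_mod_cast hs1
      omega)
    obtain ⟨m, n, hmn⟩ := IsDyadicPL.isDyadic f.2 (x := ev u 0) ⟨a, r, by rw [ha, h0]; simp⟩
    -- The image interval has length `1 / 2 ^ D` with `D = w.length + r - k`. It is standard once `D
    -- ≥ n`, for then its left end is a multiple of `1 / 2 ^ D`; this bound on the length of `w`
    -- guarantees that.
    refine ⟨(n + k - r).toNat, fun w hw => ?_⟩
    obtain ⟨b, -, hb⟩ := exists_coe_ev w
    obtain ⟨D, hD⟩ : ∃ D : ℕ, (D : ℤ) = w.length + r - k :=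
      ⟨(w.length + r - k).toNat, Int.toNat_of_nonneg (by omega)⟩
    have hnD : n ≤ D := by omega
    have hval : ∀ t : I, (f.1 (ev (u ++ w) t) : ℝ) =
        ((m * 2 ^ (D - n) + b : ℤ) + t) / 2 ^ D := by
      intro t
      rw [ev_append, hk _ (hmono _ _ (ev w t).2.1) (hmono _ _ (ev w t).2.2), hmn, ha, ha, hb, h0]
      have e1 : (2 : ℝ) ^ k = 2 ^ w.length * 2 ^ r / 2 ^ D := by
        rw [eq_div_iff (by positivity), ← zpow_natCast, ← zpow_natCast, ← zpow_natCast,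
          ← zpow_add₀ (by norm_num), ← zpow_add₀ (by norm_num), hD]
        congr 1
        ring
      have e2 : (2 : ℝ) ^ D = 2 ^ n * 2 ^ (D - n) := by rw [← pow_add, Nat.add_sub_cancel' hnD]
      rw [e1, e2]
      push_cast
      field_simp
      ring
    have hDpos : (0 : ℝ) < 2 ^ D := by positivity
    have hA0 : 0 ≤ m * 2 ^ (D - n) + (b : ℤ) := by
      have := (f.1 (ev (u ++ w) 0)).2.1
      rw [hval, h0, add_zero] at this
      replace this := mul_nonneg this hDpos.le
      rw [div_mul_cancel₀ _ hDpos.ne'] at this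
      exact_mod_cast this
    have hA1 : m * 2 ^ (D - n) + (b : ℤ) + 1 ≤ 2 ^ D := by
      have := (f.1 (ev (u ++ w) 1)).2.2
      rw [hval, h1, div_le_one hDpos] at this
      exact_mod_cast this
    obtain ⟨A, hA'⟩ := Int.eq_ofNat_of_zero_le hA0
    rw [hA'] at hA1 hval
    obtain ⟨v, -, hv⟩ := exists_word D A (by exact_mod_cast Int.lt_of_add_one_le hA1)
    exact ⟨v, fun t => Subtype.ext (by rw [hval, hv]; simp)⟩
  choose! d₀ hd using key
  -- There are finitely many addresses of length `r`, so one bound serves for all of them.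
  obtain ⟨M, hM⟩ := ((List.finite_length_eq Bool r).image d₀).bddAbove
  refine ⟨r + M, fun w hw => ?_⟩
  have hlen : (w.take r).length = r := by rw [List.length_take]; omega
  rw [← List.take_append_drop r w]
  refine hd _ hlen _ (le_trans (hM ⟨_, hlen, rfl⟩) ?_)
  rw [List.length_drop]
  omega

/-- The addresses of intervals not ending at `1` which `f` does not send to standard dyadic
intervals. -/
def bad (f : F) : Set (List Bool) := {w | false ∈ w ∧ ∀ v, ¬ Sends f w v}

theorem finite_bad (f : F) : (bad f).Finite := by
  obtain ⟨m, hm⟩ := exists_depth f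
  refine (List.finite_length_lt Bool m).subset fun w hw => ?_
  by_contra h
  obtain ⟨v, hv⟩ := hm w (not_lt.1 h)
  exact hw.2 v hv

/-- `xgen n` carries the bad addresses of `f * xgen n` injectively to bad addresses of `f` and never
hits `leaf n`. This makes the induction in `exists_mul_mem_forests` terminate. -/
theorem ncard_bad_mul_xgen_lt {f : F} {n : ℕ} (h : leaf n ∈ bad f) :
    (bad (f * xgen n)).ncard < (bad f).ncard := by
  choose! τ hτ using fun (w : List Bool) (h : false ∈ w) => exists_sends_of_false_mem n h
  have hle : (bad (f * xgen n)).ncard ≤ (bad f \ {leaf n}).ncard := by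
    refine Set.ncard_le_ncard_of_injOn τ (fun w hw => ⟨⟨(hτ w hw.1).false_mem hw.1, fun v hv =>
      hw.2 v (hv.mul (hτ w hw.1))⟩, fun e => ?_⟩) (fun w hw w' hw' e => ?_)
      ((finite_bad f).subset Set.sdiff_subset)
    · have := hτ w hw.1
      rw [show τ w = leaf n from e] at this
      exact not_sends_xgen_leaf n w this
    · have := hτ w hw.1
      rw [e] at this
      exact this.unique_left (hτ w' hw'.1)
  exact hle.trans_lt (Set.ncard_sdiff_singleton_lt_of_mem h (finite_bad f))

theorem exists_mul_mem_forests (f : F) : ∃ q ∈ forests, f * q ∈ forests := by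
  induction h : (bad f).ncard using Nat.strong_induction_on generalizing f with
  | _ N ih =>
  by_cases hf : f ∈ forests
  · exact ⟨1, one_mem_forests, by rwa [mul_one]⟩
  · obtain ⟨n, hn⟩ := not_forall.1 hf
    obtain ⟨q, hq, hfq⟩ := ih _ (h ▸ ncard_bad_mul_xgen_lt (n := n) (f := f)
      ⟨false_mem_leaf n, not_exists.1 hn⟩) (f * xgen n) rfl
    exact ⟨xgen n * q, mul_mem_forests (xgen_mem_forests n) hq, by rwa [← mul_assoc]⟩

/-! ### The length of a forest -/

/-- The address of the interval `[1 - 2⁻ⁿ, 1]`. -/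
def ray (n : ℕ) : List Bool := List.replicate n true

theorem ray_append (m n : ℕ) : ray m ++ ray n = ray (m + n) :=
  List.replicate_append_replicate

theorem ray_append_leaf (m n : ℕ) : ray m ++ leaf n = leaf (m + n) := by
  rw [leaf, ← List.append_assoc]
  exact congr_arg (· ++ [false]) (ray_append m n)

theorem coe_ev_ray (n : ℕ) (t : I) : (ev (ray n) t : ℝ) = 1 - 1 / 2 ^ n + t / 2 ^ n := by
  induction n with
  | zero => simp [ray, ev]
  | succ n ih =>
    rw [show ray (n + 1) = true :: ray n from rfl, ev_true_cons, coe_halfR, ih]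
    field_simp
    ring

theorem exists_sends_ray (f : F) : ∃ N M, Sends f (ray N) (ray M) := by
  obtain ⟨N, hN⟩ := exists_depth f
  obtain ⟨v, hv⟩ := hN (ray N) (by simp [ray])
  have h1 : false ∉ v := by
    rw [← ev_one_eq_one_iff, ← hv 1, (ev_one_eq_one_iff _).2 (by simp [ray]), map_one_eq]
  refine ⟨N, v.length, ?_⟩
  rwa [show ray v.length = v from (List.eq_replicate_iff.2 ⟨rfl, fun b hb => by
    cases b
    · exact absurd hb h1
    · rfl⟩).symm]

/-- The slope of `f` at `1` is $2^{N-M}$, so $N-M$ depends on `f` only; the equation is stated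
without subtraction. -/
theorem Sends.ray_unique {f : F} {N M N' M' : ℕ} (h : Sends f (ray N) (ray M))
    (h' : Sends f (ray N') (ray M')) : M + N' = M' + N := by
  have e := h.append (ray N')
  have e' := h'.append (ray N)
  rw [ray_append, ray_append] at e e'
  rw [add_comm] at e'
  simpa [ray] using congr_arg List.length (e.unique e')

/-- Induction on `n`. The image of `leaf n` is a standard interval not ending at `1`. If it is
longer than $2^{-(n+1)}$, its right end is at least its own length away from `1`; otherwise its
length is added to the bound for its left end. -/
theorem apply_le_of_mem_forests {p : F} (hp : p ∈ forests) (n : ℕ) :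
    (p.1 (ev (ray n) 0) : ℝ) ≤ 1 - 1 / 2 ^ n := by
  have h0 : ((0 : I) : ℝ) = 0 := rfl
  have h1 : ((1 : I) : ℝ) = 1 := rfl
  induction n with
  | zero => simp [ray, ev, map_zero_eq]
  | succ n ih =>
    obtain ⟨v, hv⟩ := hp n
    have e0 : ev (ray n) 0 = ev (leaf n) 0 :=
      Subtype.ext (by rw [coe_ev_ray, coe_ev_leaf, h0]; simp)
    have e1 : ev (ray (n + 1)) 0 = ev (leaf n) 1 :=
      Subtype.ext (by rw [coe_ev_ray, coe_ev_leaf, h0, h1]; field_simp; ring)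
    have hv1 := hv.false_mem (false_mem_leaf n)
    rw [← not_not (a := false ∈ v), ← ev_one_eq_one_iff] at hv1
    obtain ⟨a, ha, h⟩ := exists_coe_ev v
    rw [e0, hv, h, h0, add_zero] at ih
    rw [e1, hv, h, h1]
    have hpos : (0 : ℝ) < 2 ^ v.length := by positivity
    have hlt : a + 1 < 2 ^ v.length := by
      refine lt_of_le_of_ne ha fun e => hv1 (Subtype.ext ?_)
      rw [h, h1, div_eq_one_iff_eq hpos.ne']
      exact_mod_cast e
    have hle : ((a : ℝ) + 1) + 1 ≤ 2 ^ v.length := by exact_mod_cast hlt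
    rcases le_total v.length (n + 1) with hd | hd
    · calc ((a : ℝ) + 1) / 2 ^ v.length ≤ (2 ^ v.length - 1) / 2 ^ v.length := by
            gcongr; linarith
        _ = 1 - 1 / 2 ^ v.length := by field_simp
        _ ≤ 1 - 1 / 2 ^ (n + 1) := by gcongr; norm_num
    · calc ((a : ℝ) + 1) / 2 ^ v.length = a / 2 ^ v.length + 1 / 2 ^ v.length := by ring
        _ ≤ (1 - 1 / 2 ^ n) + 1 / 2 ^ (n + 1) := by gcongr; norm_num
        _ = 1 - 1 / 2 ^ (n + 1) := by field_simp; ring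

theorem Sends.ray_le {p : F} (hp : p ∈ forests) {N M : ℕ} (h : Sends p (ray N) (ray M)) :
    M ≤ N := by
  have := apply_le_of_mem_forests hp N
  rw [h 0, coe_ev_ray, show ((0 : I) : ℝ) = 0 from rfl, zero_div, add_zero, sub_le_sub_iff_left,
    one_div_le_one_div (by positivity) (by positivity)] at this
  exact (pow_le_pow_iff_right₀ (by norm_num : (1 : ℝ) < 2)).1 this

/-- The logarithm of the slope at `1` serves as the number of carets. By `Sends.ray_le` the
truncated subtraction is exact on forests, and division by a generator raises `M` by one while `N`
stays. -/
theorem exists_length_forests : ∃ len : F → ℕ, ∀ p ∈ forests, ∀ i,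
    (xgen i)⁻¹ * p ∈ forests → len ((xgen i)⁻¹ * p) < len p := by
  choose N M h using exists_sends_ray
  refine ⟨fun f => N f - M f, fun p hp i hi => ?_⟩
  have hMN := (h p).ray_le hp
  -- Beyond the ray everything is a translate of leaves, so for `i ≥ M p` some leaf is mapped onto
  -- `leaf i` and `xgen i` could not divide `p`.
  have hiM : i < M p := by
    by_contra hc
    have := (h p).append (leaf (i - M p))
    rw [ray_append_leaf, ray_append_leaf, Nat.add_sub_cancel' (not_lt.1 hc)] at this
    exact (xgen_inv_mul_mem_iff hp i).1 hi _ this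
  have hq := Sends.mul (sends_xgen_replicate hiM).inv (h p)
  have h1 := Sends.ray_le hi (M := M p + 1) hq
  have h2 := Sends.ray_unique (M := M p + 1) hq (h ((xgen i)⁻¹ * p))
  dsimp only
  omega

theorem isForestMonoid_forests : IsForestMonoid shift x0 forests where
  map_mul := shift_mul_x0
  mul_mem _ hp _ hq := mul_mem_forests hp hq
  lcm _ hp _ _ h hi hj := lcm_mem_forests hp h hi hj
  exists_divisor _ hp h := exists_xgen_inv_mul_mem hp h
  inv_notMem := xgen_inv_notMem
  exists_length := exists_length_forests
  exists_fraction := exists_mul_mem_forests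

end Thompson

end

noncomputable section

/-! ### Associativity of shuffles -/

namespace IntegralHomology

open Finsupp

section

variable {α β γ δ : Type}

theorem mapL_slideL (f : β → γ) (φ ψ : α → β) (h : β) (w : List α →₀ ℤ) :
    mapL f (slideL φ ψ h w) = slideL (f ∘ φ) (f ∘ ψ) (f h) w := by
  suffices mapL f ∘ₗ slideL φ ψ h = slideL (f ∘ φ) (f ∘ ψ) (f h) from LinearMap.congr_fun this w
  refine lin_ext fun u => ?_
  simp only [LinearMap.comp_apply]
  induction u with
  | nil => simp [slideL_nil, mapL_single]
  | cons g u ih => rw [cons_eq_pre, slideL_pre, slideL_pre, map_sub, mapL_pre, mapL_pre, mapL_pre,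
      mapL_mapL, ih]; rfl

theorem slideL_mapL (f : γ → α) (φ ψ : α → β) (h : β) (w : List γ →₀ ℤ) :
    slideL φ ψ h (mapL f w) = slideL (φ ∘ f) (ψ ∘ f) h w := by
  suffices slideL φ ψ h ∘ₗ mapL f = slideL (φ ∘ f) (ψ ∘ f) h from LinearMap.congr_fun this w
  refine lin_ext fun u => ?_
  simp only [LinearMap.comp_apply]
  induction u with
  | nil => simp [slideL_nil, mapL_single]
  | cons g u ih => rw [cons_eq_pre, mapL_pre, slideL_pre, slideL_pre, mapL_mapL, ih]; rfl

theorem shuffle_nil_left [One α] [One β] (v : List β) :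
    shuffle ([] : List α) v = single (v.map fun y => ((1 : α), y)) 1 := by
  induction v with
  | nil => rw [shuffle, List.map_nil]
  | cons y v ih => rw [shuffle, ih, pre_single, List.map_cons]

theorem shuffle_nil_right [One α] [One β] (u : List α) :
    shuffle u ([] : List β) = single (u.map fun x => (x, (1 : β))) 1 := by
  induction u with
  | nil => rw [shuffle, List.map_nil]
  | cons x u ih => rw [shuffle, ih, pre_single, List.map_cons]

theorem bilin_shuffle_nil_left [One α] [One β] (w : List β →₀ ℤ) :
    bilin shuffle (single ([] : List α) 1) w = mapL (fun y => ((1 : α), y)) w := by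
  suffices bilin shuffle (single ([] : List α) 1) = mapL (fun y => ((1 : α), y)) from
    LinearMap.congr_fun this w
  exact lin_ext fun u => by simp [bilin_single, shuffle_nil_left, mapL_single]

theorem bilin_shuffle_nil_right [One α] [One β] (w : List α →₀ ℤ) :
    bilin shuffle w (single ([] : List β) 1) = mapL (fun x => (x, (1 : β))) w := by
  suffices (bilin shuffle).flip (single ([] : List β) 1) = mapL (fun x => (x, (1 : β))) from
    LinearMap.congr_fun this w
  exact lin_ext fun u => by simp [bilin_single, shuffle_nil_right, mapL_single]

theorem bilin_shuffle_pre_pre [One α] [One β] (x : α) (y : β) (v : List α →₀ ℤ)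
    (w : List β →₀ ℤ) :
    bilin shuffle (pre x v) (pre y w) = pre (x, 1) (bilin shuffle v (pre y w)) +
      pre (1, y) (bilin shuffle (sgn (pre x v)) w) := by
  suffices (bilin shuffle).compl₁₂ (pre x) (pre y) =
      ((bilin shuffle).compl₁₂ .id (pre y)).compr₂ (pre (x, 1)) +
        ((bilin shuffle).compl₁₂ (sgn ∘ₗ pre x) .id).compr₂ (pre (1, y)) from
    LinearMap.congr_fun₂ this v w
  refine bilin_ext fun u v => ?_
  simp [pre_single, bilin_single, sgn, lin_single, shuffle]

theorem mapL_bilin_shuffle [One α] [One β] [One γ] [One δ] {f : α → γ} {g : β → δ} (hf : f 1 = 1)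
    (hg : g 1 = 1) (v : List α →₀ ℤ) (w : List β →₀ ℤ) :
    mapL (Prod.map f g) (bilin shuffle v w) = bilin shuffle (mapL f v) (mapL g w) := by
  suffices (bilin shuffle).compr₂ (mapL (Prod.map f g)) =
      (bilin shuffle).compl₁₂ (mapL f) (mapL g) from LinearMap.congr_fun₂ this v w
  refine bilin_ext fun u v => ?_
  simp only [LinearMap.compr₂_apply, LinearMap.compl₁₂_apply, mapL_single, bilin_single, mul_one,
    one_smul]
  induction hn : u.length + v.length using Nat.strong_induction_on generalizing u v with
  | _ n ih =>
  rcases u with _ | ⟨x, u⟩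
  · have e : Prod.map f g ∘ (fun y => ((1 : α), y)) = (fun y => ((1 : γ), y)) ∘ g := by
      funext y
      simp [hf]
    rw [List.map_nil, shuffle_nil_left, shuffle_nil_left, mapL_single, List.map_map, List.map_map,
      e]
  rcases v with _ | ⟨y, v⟩
  · have e : Prod.map f g ∘ (fun x => (x, (1 : β))) = (fun x => (x, (1 : δ))) ∘ f := by
      funext x
      simp [hg]
    rw [List.map_nil, shuffle_nil_right, shuffle_nil_right, mapL_single, List.map_map,
      List.map_map, e]
  rw [List.map_cons, List.map_cons, shuffle, shuffle, map_add, map_smul, mapL_pre, mapL_pre,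
    ih (u.length + (y :: v).length) (by simp at hn ⊢; omega) u (y :: v) rfl,
    ih ((x :: u).length + v.length) (by simp at hn ⊢; omega) (x :: u) v rfl]
  simp [hf, hg]

theorem sgn_bilin_shuffle [One α] [One β] (v : List α →₀ ℤ) (w : List β →₀ ℤ) :
    sgn (bilin shuffle v w) = bilin shuffle (sgn v) (sgn w) := by
  suffices (bilin shuffle).compr₂ sgn = (bilin shuffle).compl₁₂ (sgn (α := α)) (sgn (α := β)) from
    LinearMap.congr_fun₂ this v w
  refine bilin_ext fun u v => ?_
  have h := sgn_emb (u.length + v.length) (tup (u.length + v.length) (shuffle u v))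
  rw [emb_tup_shuffle _ u v rfl] at h
  simp [bilin_single, sgn, lin_single, ← pow_add] at h ⊢
  exact h

/-- Both sides are the signed sum of the shuffles of three words. Sorted by the word supplying the
first letter, each becomes three terms with the same signs, and induction on the total length
applies. -/
theorem bilin_shuffle_assoc [One α] [One β] [One γ] (u : List α →₀ ℤ) (v : List β →₀ ℤ)
    (w : List γ →₀ ℤ) :
    mapL (Equiv.prodAssoc α β γ) (bilin shuffle (bilin shuffle u v) w) =
      bilin shuffle u (bilin shuffle v w) := by
  have nilL : ∀ (v : List β →₀ ℤ) (w : List γ →₀ ℤ),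
      mapL (Equiv.prodAssoc α β γ) (bilin shuffle (bilin shuffle (single [] 1) v) w) =
        bilin shuffle (single [] 1) (bilin shuffle v w) := by
    intro v w
    have h := mapL_bilin_shuffle (α := β) (β := γ) (f := fun y => ((1 : α), y)) (g := id) rfl rfl
      v w
    rw [show mapL (id : γ → γ) w = w by simp [mapL]] at h
    rw [bilin_shuffle_nil_left, bilin_shuffle_nil_left, ← h, mapL_mapL]
    rfl
  have nilM : ∀ (u : List α →₀ ℤ) (w : List γ →₀ ℤ),
      mapL (Equiv.prodAssoc α β γ) (bilin shuffle (bilin shuffle u (single [] 1)) w) =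
        bilin shuffle u (bilin shuffle (single [] 1) w) := by
    intro u w
    have h := mapL_bilin_shuffle (α := α) (β := γ) (f := fun x => (x, (1 : β))) (g := id) rfl rfl
      u w
    have h' := mapL_bilin_shuffle (α := α) (β := γ) (f := id) (g := fun y => ((1 : β), y)) rfl rfl
      u w
    rw [show mapL (id : γ → γ) w = w by simp [mapL]] at h
    rw [show mapL (id : α → α) u = u by simp [mapL]] at h'
    rw [bilin_shuffle_nil_left, bilin_shuffle_nil_right, ← h, ← h', mapL_mapL]
    rfl
  have nilR : ∀ (u : List α →₀ ℤ) (v : List β →₀ ℤ),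
      mapL (Equiv.prodAssoc α β γ) (bilin shuffle (bilin shuffle u v) (single [] 1)) =
        bilin shuffle u (bilin shuffle v (single [] 1)) := by
    intro u v
    have h := mapL_bilin_shuffle (α := α) (β := β) (f := id) (g := fun y => (y, (1 : γ))) rfl rfl
      u v
    rw [show mapL (id : α → α) u = u by simp [mapL]] at h
    rw [bilin_shuffle_nil_right, bilin_shuffle_nil_right, ← h, mapL_mapL]
    rfl
  have key : ∀ (n : ℕ) (u : List α) (v : List β) (w : List γ), u.length + v.length + w.length = n →
      mapL (Equiv.prodAssoc α β γ) (bilin shuffle (bilin shuffle (single u 1) (single v 1))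
        (single w 1)) = bilin shuffle (single u 1) (bilin shuffle (single v 1) (single w 1)) := by
    intro n
    induction n using Nat.strong_induction_on with
    | _ n ih =>
    intro u v w hn
    rcases u with _ | ⟨x, u⟩
    · exact nilL _ _
    rcases v with _ | ⟨y, v⟩
    · exact nilM _ _
    rcases w with _ | ⟨z, w⟩
    · exact nilR _ _
    have h1 := ih _ (by simp at hn ⊢; omega) u (y :: v) (z :: w) rfl
    have h2 := ih _ (by simp at hn ⊢; omega) (x :: u) v (z :: w) rfl
    have h3 := ih _ (by simp at hn ⊢; omega) (x :: u) (y :: v) w rfl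
    have sg : ∀ {α : Type} (u : List α), sgn (single u (1 : ℤ)) = (-1 : ℤ) ^ u.length • single u 1 :=
      fun u => by simp [sgn, lin_single]
    have h2' : mapL (Equiv.prodAssoc α β γ) (bilin shuffle (bilin shuffle
        (sgn (single (x :: u) 1)) (single v 1)) (single (z :: w) 1)) =
        bilin shuffle (sgn (single (x :: u) 1)) (bilin shuffle (single v 1)
          (single (z :: w) 1)) := by
      simp only [sg, map_smul, LinearMap.smul_apply, h2]
    have h3' : mapL (Equiv.prodAssoc α β γ) (bilin shuffle (bilin shuffle
        (sgn (single (x :: u) 1)) (sgn (single (y :: v) 1))) (single w 1)) =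
        bilin shuffle (sgn (single (x :: u) 1)) (bilin shuffle (sgn (single (y :: v) 1))
          (single w 1)) := by
      simp only [sg, map_smul, LinearMap.smul_apply, h3]
    have e : bilin shuffle (bilin shuffle (single (x :: u) 1) (single (y :: v) 1))
        (single (z :: w) 1) =
        pre ((x, 1), 1) (bilin shuffle (bilin shuffle (single u 1) (single (y :: v) 1))
          (single (z :: w) 1)) +
        pre ((1, y), 1) (bilin shuffle (bilin shuffle (sgn (single (x :: u) 1)) (single v 1))
          (single (z :: w) 1)) +
        pre ((1, 1), z) (bilin shuffle (bilin shuffle (sgn (single (x :: u) 1))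
          (sgn (single (y :: v) 1))) (single w 1)) := by
      rw [← sgn_bilin_shuffle]
      simp only [cons_eq_pre]
      rw [bilin_shuffle_pre_pre, map_add, LinearMap.add_apply, bilin_shuffle_pre_pre,
        bilin_shuffle_pre_pre, map_add sgn, map_add (bilin shuffle), LinearMap.add_apply, map_add]
      simp only [Prod.mk_one_one]
      abel
    rw [e, map_add, map_add, mapL_pre, mapL_pre, mapL_pre, h1, h2', h3']
    simp only [cons_eq_pre]
    rw [bilin_shuffle_pre_pre y z, map_add (bilin shuffle (pre x (single u 1))),
      bilin_shuffle_pre_pre, bilin_shuffle_pre_pre, map_add (bilin shuffle _), map_add (pre _)]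
    simp only [Equiv.prodAssoc_apply, Prod.mk_one_one]
    abel
  suffices (mapL (Equiv.prodAssoc α β γ) ∘ₗ (bilin shuffle).flip w) ∘ₗ (bilin shuffle).flip v =
      (bilin shuffle).flip (bilin shuffle v w) from LinearMap.congr_fun this u
  refine lin_ext fun u => ?_
  suffices (mapL (Equiv.prodAssoc α β γ) ∘ₗ (bilin shuffle).flip w) ∘ₗ
      bilin shuffle (single u 1) = bilin shuffle (single u 1) ∘ₗ (bilin shuffle).flip w from
    LinearMap.congr_fun this v
  refine lin_ext fun v => ?_
  suffices mapL (Equiv.prodAssoc α β γ) ∘ₗ bilin shuffle (bilin shuffle (single u 1) (single v 1)) =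
      bilin shuffle (single u 1) ∘ₗ bilin shuffle (single v 1) from LinearMap.congr_fun this w
  exact lin_ext fun w => key _ u v w rfl

end

end IntegralHomology

/-! ### The product on chains of Thompson's group -/

namespace Thompson

open Finsupp IntegralHomology ForestComplex

/-- The product of bar chains of Thompson's group. -/
def chainMul : (List F →₀ ℤ) →ₗ[ℤ] (List F →₀ ℤ) →ₗ[ℤ] (List F →₀ ℤ) :=
  (bilin shuffle).compr₂ (mapL mu)

theorem chainMul_apply (v w : List F →₀ ℤ) : chainMul v w = mapL mu (bilin shuffle v w) := rfl

/-- The product of cycles is associative up to a boundary. -/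
theorem chainMul_assoc {u v w : List F →₀ ℤ} (hu : lin bdB u = 0) (hv : lin bdB v = 0)
    (hw : lin bdB w = 0) : ∃ y, chainMul (chainMul u v) w = chainMul u (chainMul v w) +
      lin bdB y := by
  let φ : F × F × F →* F := (mu.comp (mu.prodMap (MonoidHom.id F))).comp
    (MulEquiv.prodAssoc (M := F) (N := F) (P := F)).symm.toMonoidHom
  let ψ : F × F × F →* F := mu.comp ((MonoidHom.id F).prodMap mu)
  -- The two ways of bracketing are conjugate by `x0`, so on the cycle given by the triple shuffle
  -- they differ by the boundary of a `slide`.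
  have hφ : ∀ g, φ g * x0 = x0 * ψ g := fun g => mu_mu_mul_x0 g.1 g.2.1 g.2.2
  have mid : ∀ w : List F →₀ ℤ, mapL id w = w := fun w => by simp [mapL]
  have h1 : chainMul (chainMul u v) w = mapL φ (bilin shuffle u (bilin shuffle v w)) := by
    rw [← bilin_shuffle_assoc, mapL_mapL, chainMul_apply, chainMul_apply]
    nth_rw 1 [← mid w]
    rw [← mapL_bilin_shuffle (map_one mu) rfl, mapL_mapL]
    rfl
  have h2 : chainMul u (chainMul v w) = mapL ψ (bilin shuffle u (bilin shuffle v w)) := by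
    rw [chainMul_apply, chainMul_apply]
    nth_rw 1 [← mid u]
    rw [← mapL_bilin_shuffle rfl (map_one mu), mapL_mapL]
    rfl
  have h := bdB_slideL hφ (bilin shuffle u (bilin shuffle v w))
  rw [bdB_shuffle, bdB_shuffle, hu, hv, hw] at h
  refine ⟨-slideL φ ψ x0 (bilin shuffle u (bilin shuffle v w)), ?_⟩
  rw [h1, h2, map_neg, eq_comm, ← sub_eq_add_neg, sub_eq_iff_eq_add, ← sub_eq_iff_eq_add', ← h]
  simp

theorem chainMul_nil_left (w : List F →₀ ℤ) : chainMul (single [] 1) w = mapL shift w := by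
  rw [chainMul_apply, bilin_shuffle_nil_left, mapL_mapL]
  rfl

theorem chainMul_nil_right (w : List F →₀ ℤ) :
    chainMul w (single [] 1) = mapL (fun f => mu (f, 1)) w := by
  rw [chainMul_apply, bilin_shuffle_nil_right, mapL_mapL]
  rfl

/-- Shuffling a single letter into a word inserts it at every place with alternating signs, which is
how `slide` is defined. Both homomorphisms are the shift because `mu (x0, 1)` commutes with its
image. -/
theorem chainMul_x0_left (w : List F →₀ ℤ) :
    chainMul (single [x0] 1) w = slideL shift shift (mu (x0, 1)) w := by
  suffices chainMul (single [x0] 1) = slideL shift shift (mu (x0, 1)) from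
    LinearMap.congr_fun this w
  refine lin_ext fun u => ?_
  induction u with
  | nil => rw [chainMul_nil_right, slideL_nil, mapL_single]; rfl
  | cons g u ih =>
    have h := bilin_shuffle_pre_pre x0 g (single [] 1) (single u (1 : ℤ))
    rw [cons_eq_pre, cons_eq_pre, slideL_pre, ← ih, ← cons_eq_pre x0, chainMul_apply,
      cons_eq_pre x0, h, bilin_shuffle_nil_left, map_add, mapL_pre, mapL_pre, mapL_pre, mapL_mapL,
      sgn_pre, map_neg, LinearMap.neg_apply, map_neg, map_neg, ← sub_eq_add_neg]
    rw [show sgn (single ([] : List F) (1 : ℤ)) = single [] 1 by simp [sgn, lin_single],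
      ← cons_eq_pre x0, mapL_pre, ← chainMul_apply]
    rfl

theorem mu_x0_one_comm (g : F) : shift g * mu (x0, 1) = mu (x0, 1) * shift g := by
  rw [shift_apply, ← map_mul, ← map_mul]
  simp

/-- By the pentagon relation, multiplication by `x₀` measures the failure of the shift to commute
with the homotopy belonging to `x₀`. -/
theorem exists_twist {b : List F →₀ ℤ} (hb : lin bdB b = 0) :
    ∃ y, mapL shift (slideL shift (shift.comp shift) x0 b) -
      slideL shift (shift.comp shift) x0 (mapL shift b) =
        lin bdB y - chainMul (single [x0] 1) b := by
  let τ₂ : F →* F := shift.comp shift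
  let τ₃ : F →* F := shift.comp τ₂
  have c1 : ∀ g, shift g * x0 = x0 * τ₂ g := shift_mul_x0
  have c2 : ∀ g, τ₂ g * x0 = x0 * τ₃ g := fun g => shift_mul_x0 (shift g)
  have c3 : ∀ g, τ₂ g * shift x0 = shift x0 * τ₃ g := fun g => by
    change shift (shift g) * shift x0 = shift x0 * shift (shift (shift g))
    rw [← map_mul, ← map_mul, shift_mul_x0]
  have c4 : ∀ g, shift g * (x0 * shift x0) = x0 * shift x0 * τ₃ g := fun g => by
    rw [← mul_assoc, c1, mul_assoc, c3, mul_assoc]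
  have h1 := bdB_slide₂L c1 c2 b
  have h2 := bdB_slide₂L c1 c3 b
  have h3 := bdB_slide₂L mu_x0_one_comm c4 b
  rw [pentagon] at h3
  rw [hb, map_zero, sub_zero] at h1 h2 h3
  -- The three summands express the homotopies of the products `x0 * shift x0`, `x0 * x0` and `mu
  -- (x0, 1) * (x0 * shift x0)` through those of their factors. By the pentagon the product
  -- homotopies cancel, and so do the two copies of the homotopy of `x0` from `shift` to `τ₂`.
  refine ⟨slide₂L shift τ₂ τ₃ x0 (shift x0) b - slide₂L shift τ₂ τ₃ x0 x0 b +
    slide₂L shift shift τ₃ (mu (x0, 1)) (x0 * shift x0) b, ?_⟩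
  rw [map_add, map_sub, h1, h2, h3, chainMul_x0_left, mapL_slideL, slideL_mapL]
  change slideL τ₂ τ₃ (shift x0) b - slideL τ₂ τ₃ x0 b = _
  abel

/-- Every cycle is homologous to the product of `x₀` with a cycle, up to multiples of `x₀` and of
a point. -/
theorem exists_eq_chainMul_x0 {c : List F →₀ ℤ} (hc : lin bdB c = 0) :
    ∃ b s r y, lin bdB b = 0 ∧
      c = chainMul (single [x0] 1) b + single [x0] s + single [] r + lin bdB y := by
  have hP := isForestMonoid_forests
  obtain ⟨k, w, hk, rfl⟩ := exists_thetaL_eq hP hc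
  obtain ⟨Y, b, s, r, hb, rfl⟩ := exists_of_bdL_eq_zero k hk
  have hB : lin bdB (thetaL shift x0 b) = 0 := by rw [bdB_thetaL shift_mul_x0, hb, map_zero]
  obtain ⟨y, hy⟩ := exists_twist hB
  -- The minus sign is the one in front of the product in `exists_twist`.
  refine ⟨-thetaL shift x0 b, s, r, thetaL shift x0 Y + y + w, by rw [map_neg, hB, neg_zero], ?_⟩
  have e : single [0] s = pre 0 (single ([] : List ℕ) s) := cons_eq_pre _ _ _
  rw [map_add, map_add, map_add, map_sub, thetaL_upL, thetaL_pre, thetaL_pre, thetaL_upL, e,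
    thetaL_pre, thetaL_nil, thetaL_nil, slideL_nil, ← bdB_thetaL shift_mul_x0, map_add (lin bdB),
    map_add (lin bdB), map_neg, hy]
  abel

/-- The decomposition of cycles by means of `x₀` is unique up to boundaries. -/
theorem eq_zero_of_chainMul_x0 {b : List F →₀ ℤ} (hb : lin bdB b = 0) {s r : ℤ}
    {w : List F →₀ ℤ}
    (h : chainMul (single [x0] 1) b + single [x0] s + single [] r = lin bdB w) :
    s = 0 ∧ r = 0 ∧ ∃ y, b = lin bdB y := by
  have hP := isForestMonoid_forests
  obtain ⟨k, u, hk, rfl⟩ := exists_thetaL_eq hP hb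
  have hB : lin bdB (thetaL shift x0 k) = 0 := by rw [bdB_thetaL shift_mul_x0, hk, map_zero]
  obtain ⟨y, hy⟩ := exists_twist hB
  have hu := bdB_slideL mu_x0_one_comm u
  rw [sub_self, ← chainMul_x0_left (lin bdB u)] at hu
  have e : ∀ s : ℤ, single [0] s = pre 0 (single ([] : List ℕ) s) := fun s => cons_eq_pre _ _ _
  have hK : thetaL shift x0 (pre 0 (upL k) - upL (pre 0 k) + single [0] s + single [] r) =
      lin bdB (w - y + slideL shift shift (mu (x0, 1)) u) := by
    rw [map_add, map_add, map_sub, thetaL_upL, thetaL_pre, thetaL_pre, thetaL_upL, e,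
      thetaL_pre, thetaL_nil, thetaL_nil, slideL_nil, map_add (lin bdB), map_sub (lin bdB), ← h,
      map_add]
    have := congr_arg (fun z => -z) hy
    simp only [neg_sub] at this
    rw [this, eq_neg_of_add_eq_zero_right hu]
    abel
  have hK0 : bdL (pre 0 (upL k) - upL (pre 0 k) + single [0] s + single [] r) = 0 := by
    rw [map_add, map_add, map_sub, bdL_upL, bdL_pre, bdL_pre, bdL_upL, e, bdL_pre, bdL_nil, hk]
    simp [upL_single, up, bdL_nil]
  obtain ⟨p, hp⟩ := exists_bdL_eq_of_thetaL hP hK0 hK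
  -- Multiplication by `x0` corresponds to the negative of the twist, so all terms change sign.
  obtain ⟨hs, hr, q, rfl⟩ := eq_bdL_of_twist k (-p) (-s) (-r) (by
    rw [map_neg, ← hp, single_neg, single_neg]
    abel)
  refine ⟨neg_eq_zero.1 hs, neg_eq_zero.1 hr, thetaL shift x0 q + u, ?_⟩
  rw [map_add, bdB_thetaL shift_mul_x0]

/-- In the abelianization the pentagon relation reads `mu (x0, 1) + x0 + shift x0 = 2 x0`; the chain
`y` makes this explicit by one 2-chain for each multiplication involved. -/
theorem exists_chainMul_nil_x0 : ∃ y, chainMul (single [] 1) (single [x0] 1) +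
    chainMul (single [x0] 1) (single [] 1) = single [x0] 1 + lin bdB y := by
  have hd : ∀ g h : F, lin bdB (single [g, h] (1 : ℤ)) = single [h] 1 - single [g * h] 1 +
      single [g] 1 := fun g h => by
    simp [lin_single, bdB, faces, pre_single]
    abel
  refine ⟨single [mu (x0, 1), x0 * shift x0] 1 + single [x0, shift x0] 1 - single [x0, x0] 1, ?_⟩
  rw [map_sub, map_add, hd, hd, hd, pentagon, chainMul_nil_left, chainMul_nil_right, mapL_single,
    mapL_single]
  change single [shift x0] 1 + single [mu (x0, 1)] 1 = _
  abel

end Thompson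

end

noncomputable section

/-! ### Cycles and homology classes of arbitrary degrees -/

namespace IntegralHomology

open Finsupp CategoryTheory

section

variable {α : Type}

/-- The decomposition of a combination of words according to the length. -/
def parts : (List α →₀ ℤ) →ₗ[ℤ] ⨁ n, ((Fin n → α) →₀ ℤ) :=
  lin fun u => DirectSum.of (fun n => (Fin n → α) →₀ ℤ) u.length (single u.get 1)

theorem parts_emb (n : ℕ) (v : (Fin n → α) →₀ ℤ) :
    parts (emb n v) = DirectSum.of (fun n => (Fin n → α) →₀ ℤ) n v := by
  have key : ∀ (l : List α) (n : ℕ) (u : Fin n → α), List.ofFn u = l →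
      DirectSum.of (fun n => (Fin n → α) →₀ ℤ) l.length (single l.get 1) =
        DirectSum.of (fun n => (Fin n → α) →₀ ℤ) n (single u 1) := by
    intro l n u h
    have hl : l.length = n := by simp [← h]
    subst hl
    rw [List.ofFn_injective (h.trans (List.ofFn_get l).symm)]
  suffices parts.toAddMonoidHom.comp (emb n).toAddMonoidHom =
    DirectSum.of (fun n => (Fin n → α) →₀ ℤ) n from DFunLike.congr_fun this v
  refine Finsupp.addHom_ext fun u c => ?_
  change parts (emb n (single u c)) = _
  rw [emb_single, parts, lin_single, key _ n u rfl, ← map_zsmul, smul_single, smul_eq_mul, mul_one]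

theorem parts_emb_self (n : ℕ) (v : (Fin n → α) →₀ ℤ) : parts (emb n v) n = v := by
  rw [parts_emb, DirectSum.of_eq_same]

theorem parts_emb_of_ne {m n : ℕ} (h : m ≠ n) (v : (Fin m → α) →₀ ℤ) :
    parts (emb m v) n = 0 := by
  rw [parts_emb, DirectSum.of_eq_of_ne _ _ _ h.symm]

theorem emb_induction {p : (List α →₀ ℤ) → Prop} (h0 : p 0) (hadd : ∀ v w, p v → p w → p (v + w))
    (h : ∀ n v, p (emb n v)) (w : List α →₀ ℤ) : p w := by
  induction w using Finsupp.induction_linear with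
  | zero => exact h0
  | add v w hv hw => exact hadd v w hv hw
  | single u c =>
    have := h u.length (single u.get c)
    rwa [emb_single, List.ofFn_get] at this

theorem exists_sum_emb_parts (w : List α →₀ ℤ) :
    ∃ s : Finset ℕ, w = ∑ n ∈ s, emb n (parts w n) := by
  -- Allowing all larger index sets makes the statement additive in `w`.
  have key : ∃ s : Finset ℕ, ∀ t, s ⊆ t → w = ∑ n ∈ t, emb n (parts w n) := by
    induction w using emb_induction with
    | h0 => exact ⟨∅, fun t _ => by simp⟩
    | hadd v w hv hw =>
      obtain ⟨s, hs⟩ := hv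
      obtain ⟨t, ht⟩ := hw
      refine ⟨s ∪ t, fun r hr => ?_⟩
      simp only [map_add, DirectSum.add_apply, Finset.sum_add_distrib]
      rw [← hs r (Finset.union_subset_left hr), ← ht r (Finset.union_subset_right hr)]
    | h n v =>
      refine ⟨{n}, fun t ht => ?_⟩
      rw [Finset.sum_eq_single_of_mem n (by simpa using ht) fun m _ hm => by
        rw [parts_emb_of_ne hm.symm, map_zero], parts_emb_self]
  obtain ⟨s, hs⟩ := key
  exact ⟨s, hs s subset_rfl⟩

end

section

variable {G H : Type} [Group G] [Group H]

theorem emb_parts_bdB (n : ℕ) (w : List G →₀ ℤ) :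
    emb n (parts (lin bdB w) n) = lin bdB (emb (n + 1) (parts w (n + 1))) := by
  induction w using emb_induction with
  | h0 => simp
  | hadd v w hv hw => simp only [map_add, DirectSum.add_apply, hv, hw]
  | h k v =>
    rcases k with _ | k
    · rw [bdB_emb_zero, parts_emb_of_ne (by omega)]
      simp
    · rw [← emb_dd]
      by_cases h : k = n
      · subst h
        rw [parts_emb_self, parts_emb_self, emb_dd]
      · rw [parts_emb_of_ne h, parts_emb_of_ne (by omega)]
        simp

variable (G) in
/-- The combination of words underlying a cycle. -/
def totalChain : (⨁ n, ZZ G n) →+ (List G →₀ ℤ) :=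
  DirectSum.toAddMonoid fun n => (emb n).toAddMonoidHom.comp (toChain n)

variable (G) in
/-- The homology class of a cycle. -/
def totalClass : (⨁ n, ZZ G n) →+ ⨁ n, HZ G n := DirectSum.map fun n => toClass n

theorem totalChain_of (n : ℕ) (x : ZZ G n) :
    totalChain G (DirectSum.of (fun n => ZZ G n) n x) = emb n (toChain n x) := by
  rw [totalChain, DirectSum.toAddMonoid_of]
  rfl

theorem totalClass_of (n : ℕ) (x : ZZ G n) :
    totalClass G (DirectSum.of (fun n => ZZ G n) n x) =
      DirectSum.of (fun n => HZ G n) n (toClass n x) := DirectSum.map_of _ _ _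

theorem totalClass_apply (z : ⨁ n, ZZ G n) (n : ℕ) : totalClass G z n = toClass n (z n) := rfl

theorem bdB_totalChain (z : ⨁ n, ZZ G n) : lin bdB (totalChain G z) = 0 := by
  induction z using DirectSum.induction_on with
  | zero => simp
  | of n x => rw [totalChain_of, bdB_toChain]
  | add x y hx hy => rw [map_add, map_add, hx, hy, add_zero]

theorem parts_totalChain (z : ⨁ n, ZZ G n) (n : ℕ) : parts (totalChain G z) n = toChain n (z n) := by
  induction z using DirectSum.induction_on with
  | zero => simp
  | of m x =>
    rw [totalChain_of]
    by_cases h : m = n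
    · subst h
      rw [parts_emb_self, DirectSum.of_eq_same]
    · rw [parts_emb_of_ne h, DirectSum.of_eq_of_ne _ _ _ (Ne.symm h), map_zero]
  | add x y hx hy => simp only [map_add, DirectSum.add_apply, hx, hy]

theorem exists_totalChain_eq {w : List G →₀ ℤ} (hw : lin bdB w = 0) : ∃ z, totalChain G z = w := by
  have h : ∀ n, ∃ x : ZZ G n, toChain n x = parts w n := fun n => by
    refine exists_cycle n _ ?_
    rcases n with _ | n
    · exact bdB_emb_zero _
    · rw [← emb_parts_bdB, hw]
      simp
  choose x hx using h
  obtain ⟨s, hs⟩ := exists_sum_emb_parts w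
  refine ⟨∑ n ∈ s, DirectSum.of (fun n => ZZ G n) n (x n), ?_⟩
  rw [map_sum, hs]
  exact Finset.sum_congr rfl fun n _ => by rw [totalChain_of, hx]

theorem totalClass_surjective : Function.Surjective (totalClass G) :=
  (DirectSum.map_surjective _).2 fun n => toClass_surjective n

/-- The boundary lowers the length by exactly one (`emb_parts_bdB`), so an inhomogeneous bounding
chain can be split into homogeneous ones. This lets all degrees be treated at once. -/
theorem totalClass_eq_zero_iff (z : ⨁ n, ZZ G n) :
    totalClass G z = 0 ↔ ∃ w, totalChain G z = lin bdB w := by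
  classical
  constructor
  · intro h
    have h' : ∀ n, ∃ v : (Fin (n + 1) → G) →₀ ℤ,
        emb n (toChain n (z n)) = lin bdB (emb (n + 1) v) := fun n =>
      (toClass_eq_zero_iff n (z n)).1 (by rw [← totalClass_apply, h, DirectSum.zero_apply])
    choose v hv using h'
    refine ⟨∑ n ∈ DFinsupp.support z, emb (n + 1) (v n), ?_⟩
    nth_rw 1 [← DirectSum.sum_support_of z]
    rw [map_sum, map_sum]
    exact Finset.sum_congr rfl fun n _ => by rw [totalChain_of, hv]
  · rintro ⟨w, hw⟩
    refine DFinsupp.ext fun n => ?_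
    refine (toClass_eq_zero_iff n (z n)).2 ⟨parts w (n + 1), ?_⟩
    rw [← parts_totalChain, hw, emb_parts_bdB]

/-! Compatibility with the constructions in homology -/

/-- The map on cycles induced by a group homomorphism. -/
def cycleMap (f : G →* H) (n : ℕ) : ZZ G n →+ ZZ H n :=
  (groupHomology.cyclesMap (A := triv G) (B := triv H) f
    (Rep.ofHom ⟨LinearMap.id, fun _ => rfl⟩) n).hom.toAddMonoidHom

theorem pushforward_toClass (f : G →* H) (n : ℕ) (x : ZZ G n) :
    pushforward f n (toClass n x) = toClass n (cycleMap f n x) :=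
  LinearMap.congr_fun (ModuleCat.hom_ext_iff.1 (groupHomology.π_map (A := triv G) (B := triv H) f
    (Rep.ofHom ⟨LinearMap.id, fun _ => rfl⟩) n)) x

theorem emb_toChain_cycleMap (f : G →* H) (n : ℕ) (x : ZZ G n) :
    emb n (toChain n (cycleMap f n x)) = mapL f (emb n (toChain n x)) := by
  have h := LinearMap.congr_fun (ModuleCat.hom_ext_iff.1 (HomologicalComplex.cyclesMap_i
    (groupHomology.chainsMap (A := triv G) (B := triv H) f
      (Rep.ofHom ⟨LinearMap.id, fun _ => rfl⟩)) n)) x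
  have h' : toChain n (cycleMap f n x) = ((groupHomology.chainsMap (A := triv G) (B := triv H) f
      (Rep.ofHom ⟨LinearMap.id, fun _ => rfl⟩)).f n).hom (toChain n x) := h
  rw [h']
  generalize toChain n x = v
  suffices (emb n).toAddMonoidHom.comp ((groupHomology.chainsMap (A := triv G) (B := triv H) f
      (Rep.ofHom ⟨LinearMap.id, fun _ => rfl⟩)).f n).hom.toAddMonoidHom =
      (mapL f).toAddMonoidHom.comp (emb n).toAddMonoidHom from DFunLike.congr_fun this v
  refine Finsupp.addHom_ext fun u c => ?_
  have e := groupHomology.chainsMap_f_single (A := triv G) (B := triv H) f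
      (Rep.ofHom ⟨LinearMap.id, fun _ => rfl⟩) n u c
  refine (congr_arg (emb n) e).trans ?_
  change emb n (single (f ∘ u) c) = mapL f (emb n (single u c))
  rw [emb_single, emb_single, mapL_single, List.map_ofFn]

variable (G) in
theorem exists_toClass_eq_pointClass :
    ∃ x : ZZ G 0, toClass 0 x = pointClass G ∧ emb 0 (toChain 0 x) = single [] 1 := by
  refine ⟨(groupHomology.cyclesIso₀ (triv G)).inv (1 : ℤ), rfl, ?_⟩
  have h := LinearMap.congr_fun (ModuleCat.hom_ext_iff.1
    (groupHomology.cyclesIso₀_inv_comp_iCycles (triv G))) (1 : ℤ)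
  refine (congr_arg (emb 0) h).trans ?_
  change emb 0 ((groupHomology.chainsIso₀ (triv G)).inv (1 : ℤ)) = _
  have e : (groupHomology.chainsIso₀ (triv G)).inv (1 : ℤ) = single (default : Fin 0 → G) 1 := by
    rw [groupHomology.chainsIso₀]
    simp [LinearEquiv.toModuleIso]
  rw [e]
  exact emb_single _ _ _

theorem exists_toClass_eq_elementClass (g : G) :
    ∃ x : ZZ G 1, toClass 1 x = elementClass g ∧ emb 1 (toChain 1 x) = single [g] 1 := by
  refine ⟨(groupHomology.isoCycles₁ (triv G)).inv
    ((groupHomology.cycles₁IsoOfIsTrivial (triv G)).inv (single g (1 : ℤ))), rfl, ?_⟩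
  have h := LinearMap.congr_fun (ModuleCat.hom_ext_iff.1
    (groupHomology.isoCycles₁_inv_comp_iCycles (triv G)))
      ((groupHomology.cycles₁IsoOfIsTrivial (triv G)).inv (single g (1 : ℤ)))
  refine (congr_arg (emb 1) h).trans ?_
  have e : ((groupHomology.chainsIso₁ (triv G)).inv (single g (1 : ℤ))) =
      single (fun _ : Fin 1 => g) (1 : ℤ) := by
    rw [groupHomology.chainsIso₁]
    simp [LinearEquiv.toModuleIso]
    congr 1
  refine (congr_arg (emb 1) e).trans ?_
  rw [emb_single]
  simp

end

end IntegralHomology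

/-! ### The homology ring in terms of chains -/

namespace Thompson

open Finsupp IntegralHomology

/-- The dictionary between the ring and chains: by biadditivity it is enough to take homogeneous
cycles, where the product is the image under `mu` of the cross product cycle. -/
theorem exists_totalChain_eq_chainMul (z z' : ⨁ n, ZZ F n) :
    ∃ y, totalChain F y = chainMul (totalChain F z) (totalChain F z') ∧
      totalClass F y = totalClass F z * totalClass F z' := by
  induction z using DirectSum.induction_on with
  | zero => exact ⟨0, by simp, by simp⟩
  | add x x' hx hx' =>
    obtain ⟨y, h1, h2⟩ := hx
    obtain ⟨y', h1', h2'⟩ := hx'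
    exact ⟨y + y', by simp [h1, h1'], by rw [map_add, map_add, h2, h2', add_mul]⟩
  | of p x =>
    induction z' using DirectSum.induction_on with
    | zero => exact ⟨0, by simp, by simp⟩
    | add x x' hx hx' =>
      obtain ⟨y, h1, h2⟩ := hx
      obtain ⟨y', h1', h2'⟩ := hx'
      exact ⟨y + y', by simp [h1, h1'], by rw [map_add, map_add, h2, h2', mul_add]⟩
    | of q x' =>
      refine ⟨DirectSum.of (fun n => ZZ F n) (p + q) (cycleMap mu (p + q) (crossCycle p q x x')),
        ?_, ?_⟩
      · rw [totalChain_of, totalChain_of, totalChain_of, emb_toChain_cycleMap, toChain_crossCycle,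
          emb_crossChain rfl, chainMul_apply]
      · rw [totalClass_of, totalClass_of, totalClass_of, DirectSum.of_mul_of,
          ← pushforward_toClass, ← cross_toClass]
        rfl

theorem totalClass_eq_mul {x y z : ⨁ n, ZZ F n} {w : List F →₀ ℤ}
    (h : totalChain F z = chainMul (totalChain F x) (totalChain F y) + lin bdB w) :
    totalClass F z = totalClass F x * totalClass F y := by
  obtain ⟨y', h1, h2⟩ := exists_totalChain_eq_chainMul x y
  rw [← h2, ← sub_eq_zero, ← map_sub, totalClass_eq_zero_iff]
  exact ⟨w, by rw [map_sub, h, h1, add_sub_cancel_left]⟩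

end Thompson

end

noncomputable section

/-! ### The structure of the homology ring -/

namespace Thompson

open Finsupp IntegralHomology

theorem HF_mul_assoc (x y z : HF) : x * y * z = x * (y * z) := by
  obtain ⟨x, rfl⟩ := totalClass_surjective x
  obtain ⟨y, rfl⟩ := totalClass_surjective y
  obtain ⟨z, rfl⟩ := totalClass_surjective z
  obtain ⟨u, hu, hu'⟩ := exists_totalChain_eq_chainMul x y
  obtain ⟨v, hv, hv'⟩ := exists_totalChain_eq_chainMul u z
  obtain ⟨s, hs, hs'⟩ := exists_totalChain_eq_chainMul y z
  obtain ⟨w, hw⟩ := chainMul_assoc (bdB_totalChain x) (bdB_totalChain y) (bdB_totalChain z)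
  rw [← hu, ← hs, ← hv] at hw
  rw [← hu', ← hs', ← hv', totalClass_eq_mul hw]

instance : NonUnitalRing HF :=
  { (inferInstance : NonUnitalNonAssocRing HF) with mul_assoc := HF_mul_assoc }

theorem exists_totalClass_eq_epsilon :
    ∃ x : ⨁ n, ZZ F n, totalClass F x = epsilon ∧ totalChain F x = single [] 1 := by
  obtain ⟨x, h, h'⟩ := exists_toClass_eq_pointClass F
  exact ⟨DirectSum.of (fun n => ZZ F n) 0 x, by rw [totalClass_of, h]; rfl,
    by rw [totalChain_of, h']⟩

theorem exists_totalClass_eq_x0Class :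
    ∃ x : ⨁ n, ZZ F n, totalClass F x = x0Class ∧ totalChain F x = single [x0] 1 := by
  obtain ⟨x, h, h'⟩ := exists_toClass_eq_elementClass x0
  exact ⟨DirectSum.of (fun n => ZZ F n) 1 x, by rw [totalClass_of, h]; rfl,
    by rw [totalChain_of, h']⟩

theorem epsilon_mul_epsilon : epsilon * epsilon = epsilon := by
  obtain ⟨x, h, h'⟩ := exists_totalClass_eq_epsilon
  rw [← h]
  refine (totalClass_eq_mul (w := 0) ?_).symm
  rw [h', chainMul_nil_left, mapL_single, map_zero, add_zero, List.map_nil]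

theorem epsilon_mul_x0Class : epsilon * x0Class = x0Class - x0Class * epsilon := by
  obtain ⟨e, h, h'⟩ := exists_totalClass_eq_epsilon
  obtain ⟨x, k, k'⟩ := exists_totalClass_eq_x0Class
  rw [← h, ← k, eq_sub_iff_add_eq]
  obtain ⟨y, hy, hy'⟩ := exists_totalChain_eq_chainMul e x
  obtain ⟨z, hz, hz'⟩ := exists_totalChain_eq_chainMul x e
  obtain ⟨w, hw⟩ := exists_chainMul_nil_x0
  rw [← hy', ← hz', ← map_add, ← sub_eq_zero, ← map_sub, totalClass_eq_zero_iff]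
  refine ⟨w, ?_⟩
  rw [map_sub, map_add, hy, hz, h', k', hw, add_sub_cancel_left]

theorem exists_eq_x0Class_mul (x : HF) :
    ∃ (b : HF) (s r : ℤ), x = x0Class * b + s • x0Class + r • epsilon := by
  obtain ⟨e, h, h'⟩ := exists_totalClass_eq_epsilon
  obtain ⟨g, k, k'⟩ := exists_totalClass_eq_x0Class
  obtain ⟨x, rfl⟩ := totalClass_surjective x
  obtain ⟨b, s, r, y, hb, hx⟩ := exists_eq_chainMul_x0 (bdB_totalChain x)
  obtain ⟨b, rfl⟩ := exists_totalChain_eq hb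
  obtain ⟨z, hz, hz'⟩ := exists_totalChain_eq_chainMul g b
  refine ⟨totalClass F b, s, r, ?_⟩
  rw [← h, ← k, ← hz', ← map_zsmul, ← map_zsmul, ← map_add, ← map_add, ← sub_eq_zero, ← map_sub,
    totalClass_eq_zero_iff]
  refine ⟨y, ?_⟩
  rw [map_sub, map_add, map_add, map_zsmul, map_zsmul, hz, h', k', hx]
  simp

/-- With `exists_eq_x0Class_mul` this makes $(b,s,r)\mapsto \zeta b+s\zeta+r\varepsilon$ a
bijection, which is all the topology that the remaining algebra requires besides the relations. -/
theorem eq_zero_of_x0Class_mul {b : HF} {s r : ℤ}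
    (hb : x0Class * b + s • x0Class + r • epsilon = 0) : s = 0 ∧ r = 0 ∧ b = 0 := by
  obtain ⟨e, h, h'⟩ := exists_totalClass_eq_epsilon
  obtain ⟨g, k, k'⟩ := exists_totalClass_eq_x0Class
  obtain ⟨b, rfl⟩ := totalClass_surjective b
  obtain ⟨z, hz, hz'⟩ := exists_totalChain_eq_chainMul g b
  rw [← h, ← k, ← hz', ← map_zsmul, ← map_zsmul, ← map_add, ← map_add,
    totalClass_eq_zero_iff] at hb
  obtain ⟨w, hw⟩ := hb
  rw [map_add, map_add, map_zsmul, map_zsmul, hz, h', k', smul_single, smul_single, smul_eq_mul,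
    smul_eq_mul, mul_one, mul_one] at hw
  rw [totalClass_eq_zero_iff]
  exact eq_zero_of_chainMul_x0 (bdB_totalChain b) hw

/-! The grading -/

/-- The homogeneous component of degree `n` of an element of the homology ring. -/
def proj (n : ℕ) (x : HF) : HF := incl n (x n)

theorem proj_add (n : ℕ) (x y : HF) : proj n (x + y) = proj n x + proj n y := by
  rw [proj, DirectSum.add_apply, map_add]; rfl

theorem proj_zero (n : ℕ) : proj n 0 = 0 := by
  rw [proj, DirectSum.zero_apply, map_zero]

theorem proj_zsmul (n : ℕ) (k : ℤ) (x : HF) : proj n (k • x) = k • proj n x :=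
  map_zsmul (AddMonoidHom.mk' (proj n) (proj_add n)) k x

theorem proj_incl_self {m n : ℕ} (h : m = n) (x : HZ F m) : proj n (incl m x) = incl m x := by
  subst h
  rw [proj, DirectSum.of_eq_same]

theorem proj_incl_of_ne {m n : ℕ} (h : m ≠ n) (x : HZ F m) : proj n (incl m x) = 0 := by
  rw [proj, DirectSum.of_eq_of_ne _ _ _ h.symm, map_zero]

/-- Used to read the decomposition of `IsFreeGenerator` one degree at a time. -/
theorem proj_succ_mul (n : ℕ) (x : HZ F 1) (y : HF) :
    proj (n + 1) (incl 1 x * y) = incl 1 x * proj n y := by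
  induction y using DirectSum.induction_on with
  | zero => rw [mul_zero, proj_zero, proj_zero, mul_zero]
  | add y z hy hz => rw [mul_add, proj_add, hy, hz, proj_add, mul_add]
  | of k y =>
    rw [DirectSum.of_mul_of]
    by_cases h : k = n
    · rw [proj_incl_self (by omega), proj_incl_self h, DirectSum.of_mul_of]
    · rw [proj_incl_of_ne (by omega), proj_incl_of_ne h, mul_zero]

theorem proj_zero_mul (x : HZ F 1) (y : HF) : proj 0 (incl 1 x * y) = 0 := by
  induction y using DirectSum.induction_on with
  | zero => rw [mul_zero, proj_zero]
  | add y z hy hz => rw [mul_add, proj_add, hy, hz, add_zero]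
  | of k y => rw [DirectSum.of_mul_of, proj_incl_of_ne (by omega)]

theorem exists_incl_eq_mul (x : HZ F 1) {n : ℕ} (y : HZ F n) :
    ∃ w : HZ F (n + 1), incl (n + 1) w = incl 1 x * incl n y := by
  have h := proj_succ_mul n x (incl n y)
  rw [proj_incl_self rfl] at h
  exact ⟨_, h⟩

theorem exists_incl_eq_mul_epsilon {n : ℕ} (x : HZ F n) :
    ∃ w : HZ F n, incl n w = incl n x * epsilon := by
  rw [epsilon, DirectSum.of_mul_of]
  exact ⟨_, rfl⟩

/-- The class `ζ` is homogeneous of degree `1` and every element can be written uniquely in the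
form `ζ b + s ζ + r ε`. -/
structure IsFreeGenerator (ζ : HF) : Prop where
  exists_incl : ∃ x, ζ = incl 1 x
  relation : epsilon * ζ = ζ - ζ * epsilon
  exists_eq (x : HF) : ∃ (b : HF) (s r : ℤ), x = ζ * b + s • ζ + r • epsilon
  eq_zero {b : HF} {s r : ℤ} (h : ζ * b + s • ζ + r • epsilon = 0) : s = 0 ∧ r = 0 ∧ b = 0

theorem isFreeGenerator_x0Class : IsFreeGenerator x0Class :=
  ⟨⟨_, rfl⟩, epsilon_mul_x0Class, exists_eq_x0Class_mul, eq_zero_of_x0Class_mul⟩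

theorem IsFreeGenerator.neg {ζ : HF} (h : IsFreeGenerator ζ) : IsFreeGenerator (-ζ) := by
  refine ⟨?_, ?_, fun x => ?_, fun {b s r} hb => ?_⟩
  · obtain ⟨x, hx⟩ := h.exists_incl
    exact ⟨-x, by rw [hx, map_neg]⟩
  · rw [mul_neg, h.relation, neg_mul]
    abel
  · obtain ⟨b, s, r, hx⟩ := h.exists_eq x
    exact ⟨-b, -s, r, by rw [hx, neg_mul_neg, neg_smul, smul_neg, neg_neg]⟩
  · obtain ⟨hs, hr, hb⟩ := h.eq_zero (b := -b) (s := -s) (r := r)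
      (by rw [← hb, neg_mul, mul_neg, neg_smul, smul_neg])
    exact ⟨neg_eq_zero.1 hs, hr, neg_eq_zero.1 hb⟩

namespace IsFreeGenerator

variable {ζ : HF}

theorem exists_eq_zsmul (h : IsFreeGenerator ζ) (x : HZ F 0) : ∃ r : ℤ, incl 0 x = r • epsilon := by
  obtain ⟨y, rfl⟩ := h.exists_incl
  obtain ⟨b, s, r, hx⟩ := h.exists_eq (incl 0 x)
  refine ⟨r, ?_⟩
  have := congr_arg (proj 0) hx
  rwa [proj_incl_self rfl, proj_add, proj_add, proj_zero_mul, proj_zsmul, proj_zsmul,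
    proj_incl_of_ne one_ne_zero, smul_zero, zero_add, zero_add, epsilon, proj_incl_self rfl] at this

theorem exists_eq_mul_add (h : IsFreeGenerator ζ) (x : HZ F 1) : ∃ s r : ℤ, incl 1 x = s • ζ + r • (ζ * epsilon) := by
  obtain ⟨y, hy⟩ := h.exists_incl
  obtain ⟨b, s, t, hx⟩ := h.exists_eq (incl 1 x)
  obtain ⟨r, hr⟩ := h.exists_eq_zsmul (b 0)
  refine ⟨s, r, ?_⟩
  have := congr_arg (proj 1) hx
  rwa [proj_incl_self rfl, proj_add, proj_add, hy, proj_succ_mul, proj_zsmul, proj_zsmul,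
    proj_incl_self rfl, epsilon, proj_incl_of_ne zero_ne_one, smul_zero, add_zero, proj, hr,
    mul_smul_comm, add_comm, ← hy] at this

/-- The terms `s • ζ` and `r • epsilon` live in degrees `1` and `0`, so in higher degrees only the
multiple of `ζ` remains. -/
theorem exists_eq_mul (h : IsFreeGenerator ζ) {n : ℕ} (x : HZ F (n + 2)) :
    ∃ b, incl (n + 2) x = ζ * incl (n + 1) b := by
  obtain ⟨y, rfl⟩ := h.exists_incl
  obtain ⟨b, s, t, hx⟩ := h.exists_eq (incl (n + 2) x)
  refine ⟨b (n + 1), ?_⟩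
  have := congr_arg (proj (n + 2)) hx
  rwa [proj_incl_self rfl, proj_add, proj_add, proj_succ_mul, proj_zsmul, proj_zsmul,
    proj_incl_of_ne (by omega), epsilon, proj_incl_of_ne (by omega), smul_zero, smul_zero, add_zero,
    add_zero] at this

/-- Descending through the degrees with `exists_eq_mul` shows that only left multiplication by `ζ`
is needed to generate everything additively from `epsilon` and `ζ`. -/
theorem induction (h : IsFreeGenerator ζ) {p : HF → Prop} (h0 : p 0)
    (hadd : ∀ x y, p x → p y → p (x + y))
    (hneg : ∀ x, p x → p (-x)) (hε : p epsilon) (hζ : p ζ) (hmul : ∀ x, p x → p (ζ * x)) (x : HF) :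
    p x := by
  let S : AddSubgroup HF :=
    { carrier := {x | p x}, zero_mem' := h0, add_mem' := hadd _ _, neg_mem' := hneg _ }
  have hS : ∀ n (x : HZ F n), incl n x ∈ S := by
    intro n
    induction n with
    | zero =>
      intro x
      obtain ⟨r, hr⟩ := h.exists_eq_zsmul x
      rw [hr]
      exact S.zsmul_mem hε r
    | succ n ih =>
      intro x
      rcases n with _ | n
      · obtain ⟨s, r, hx⟩ := h.exists_eq_mul_add x
        rw [hx]
        exact S.add_mem (S.zsmul_mem hζ s) (S.zsmul_mem (hmul _ hε) r)
      · obtain ⟨b, hb⟩ := h.exists_eq_mul x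
        rw [hb]
        exact hmul _ (ih b)
  induction x using DirectSum.induction_on with
  | zero => exact h0
  | add x y hx hy => exact hadd x y hx hy
  | of n x => exact hS n x

end IsFreeGenerator

end Thompson

end

noncomputable section

namespace IntegralHomology

/-! ### Rings generated by an idempotent `e` and an element `z` with `e z = z - z e` -/

theorem exists_basis_pair {M : Type} [AddCommGroup M] (x y : M)
    (hspan : ∀ m, ∃ s t : ℤ, m = s • x + t • y)
    (hind : ∀ s t : ℤ, s • x + t • y = 0 → s = 0 ∧ t = 0) :
    ∃ b : Module.Basis (Fin 2) ℤ M, b 0 = x ∧ b 1 = y := by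
  have hli : LinearIndependent ℤ ![x, y] := LinearIndependent.pair_iff.2 hind
  refine ⟨Module.Basis.mk hli fun m _ => ?_, by simp, by simp⟩
  obtain ⟨s, t, rfl⟩ := hspan m
  exact add_mem (Submodule.smul_mem _ s (Submodule.subset_span ⟨0, rfl⟩))
    (Submodule.smul_mem _ t (Submodule.subset_span ⟨1, rfl⟩))

theorem exists_basis_single {M : Type} [AddCommGroup M] (x : M) (hspan : ∀ m, ∃ r : ℤ, m = r • x)
    (hind : ∀ r : ℤ, r • x = 0 → r = 0) : ∃ b : Module.Basis Unit ℤ M, b () = x := by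
  have hli : LinearIndependent ℤ fun _ : Unit => x :=
    Fintype.linearIndependent_iff.2 fun g hg i => hind (g i) (by simpa using hg)
  refine ⟨Module.Basis.mk hli fun m _ => ?_, by simp⟩
  obtain ⟨r, rfl⟩ := hspan m
  exact Submodule.smul_mem _ r (Submodule.subset_span ⟨(), rfl⟩)

section

variable {R : Type*} [NonUnitalRing R] {e z : R}

theorem mul_mul_eq_zero_of_relation (he : e * e = e) (hz : e * z = z - z * e) : e * z * e = 0 := by
  rw [hz, sub_mul, mul_assoc, he, sub_self]

theorem mul_mul_idem_of_relation (he : e * e = e) (hz : e * z = z - z * e) :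
    z * e * (z * e) = 0 := by
  rw [mul_assoc, ← mul_assoc e z e, mul_mul_eq_zero_of_relation he hz, mul_zero]

theorem idem_mul_mul_of_relation (he : e * e = e) (hz : e * z = z - z * e) :
    e * z * (e * z) = 0 := by
  rw [← mul_assoc, mul_mul_eq_zero_of_relation he hz, zero_mul]

end

section

variable {R : Type} [NonUnitalRing R] {e a b : R}

theorem mul_powSucc (x : R) (n : ℕ) : x * powSucc x n = powSucc x (n + 1) := by
  induction n with
  | zero => rfl
  | succ n ih => rw [powSucc, ← mul_assoc, ih]; rfl

theorem mul_altProd_self (ha : a * a = 0) (n : ℕ) : a * altProd a b n = 0 := by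
  rcases n with _ | n
  · exact ha
  · rw [altProd, ← mul_assoc, ha, zero_mul]

/-- In the expansion of the power every word with a repeated neighbour vanishes, which leaves the
two alternating ones. -/
theorem powSucc_add (ha : a * a = 0) (hb : b * b = 0) (n : ℕ) :
    powSucc (a + b) n = altProd a b n + altProd b a n := by
  induction n with
  | zero => rfl
  | succ n ih =>
    rw [← mul_powSucc, ih, add_mul, mul_add, mul_add, mul_altProd_self ha, mul_altProd_self hb,
      zero_add, add_zero]
    rfl

/-- Right multiplication by `e` keeps the product ending in `a` and kills the one ending in `b`;
which is which depends on the parity of `n`. -/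
theorem altProd_mul_cases (hae : a * e = a) (hbe : b * e = 0) (n : ℕ) :
    (altProd a b n * e = altProd a b n ∧ altProd b a n * e = 0) ∨
      (altProd a b n * e = 0 ∧ altProd b a n * e = altProd b a n) := by
  induction n with
  | zero => exact Or.inl ⟨hae, hbe⟩
  | succ n ih =>
    simp only [altProd, mul_assoc]
    rcases ih with ⟨h1, h2⟩ | ⟨h1, h2⟩
    · exact Or.inr (by rw [h1, h2, mul_zero]; exact ⟨rfl, rfl⟩)
    · exact Or.inl (by rw [h1, h2, mul_zero]; exact ⟨rfl, rfl⟩)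

end

end IntegralHomology

/-! ### Bases and presentations of the homology ring -/

namespace Thompson

open IntegralHomology

namespace IsFreeGenerator

variable {ζ : HF}

theorem closure_eq_top (h : IsFreeGenerator ζ) :
    NonUnitalSubring.closure {epsilon, ζ} = (⊤ : NonUnitalSubring HF) := by
  have hε : epsilon ∈ NonUnitalSubring.closure {epsilon, ζ} :=
    NonUnitalSubring.subset_closure (by simp)
  have hζ : ζ ∈ NonUnitalSubring.closure {epsilon, ζ} :=
    NonUnitalSubring.subset_closure (by simp)
  refine eq_top_iff.2 fun x _ => ?_
  induction x using h.induction with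
  | h0 => exact zero_mem _
  | hadd x y hx hy => exact add_mem (hx trivial) (hy trivial)
  | hneg x hx => exact neg_mem (hx trivial)
  | hε => exact hε
  | hζ => exact hζ
  | hmul x hx => exact mul_mem hζ (hx trivial)

theorem exists_incl_powSucc (h : IsFreeGenerator ζ) (n : ℕ) :
    ∃ x y : HZ F (n + 1), incl (n + 1) x = powSucc ζ n ∧ incl (n + 1) y = powSucc ζ n * epsilon := by
  obtain ⟨g, hg⟩ := h.exists_incl
  have key : ∃ x : HZ F (n + 1), incl (n + 1) x = powSucc ζ n := by
    induction n with
    | zero => exact ⟨g, hg.symm⟩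
    | succ n ih =>
      obtain ⟨x, hx⟩ := ih
      rw [← mul_powSucc, ← hx, hg]
      exact exists_incl_eq_mul g x
  obtain ⟨x, hx⟩ := key
  obtain ⟨y, hy⟩ := exists_incl_eq_mul_epsilon x
  exact ⟨x, y, hx, by rw [hy, hx]⟩

theorem exists_eq_powSucc (h : IsFreeGenerator ζ) (n : ℕ) (m : HZ F (n + 1)) :
    ∃ s t : ℤ, incl (n + 1) m = s • powSucc ζ n + t • (powSucc ζ n * epsilon) := by
  induction n with
  | zero => exact h.exists_eq_mul_add m
  | succ n ih =>
    obtain ⟨b, hb⟩ := h.exists_eq_mul m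
    obtain ⟨s, t, hst⟩ := ih b
    refine ⟨s, t, ?_⟩
    rw [hb, hst, mul_add, mul_smul_comm, mul_smul_comm, ← mul_assoc, mul_powSucc]

theorem eq_zero_of_powSucc (h : IsFreeGenerator ζ) (n : ℕ) {s t : ℤ}
    (hst : s • powSucc ζ n + t • (powSucc ζ n * epsilon) = 0) : s = 0 ∧ t = 0 := by
  induction n with
  | zero =>
    obtain ⟨hs, -, hb⟩ := h.eq_zero (b := t • epsilon) (s := s) (r := 0)
      (by rw [zero_smul, add_zero, mul_smul_comm, add_comm]; exact hst)
    exact ⟨hs, (h.eq_zero (b := 0) (s := 0) (r := t) (by rw [hb]; simp)).2.1⟩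
  | succ n ih =>
    refine ih (h.eq_zero (s := 0) (r := 0) ?_).2.2
    rw [zero_smul, zero_smul, add_zero, add_zero, mul_add, mul_smul_comm, mul_smul_comm,
      ← mul_assoc, mul_powSucc, hst]

theorem exists_basis_of_pair (h : IsFreeGenerator ζ) (n : ℕ) {x y : HF}
    (hx : ∃ p q : ℤ, x = p • powSucc ζ n + q • (powSucc ζ n * epsilon))
    (hy : ∃ p q : ℤ, y = p • powSucc ζ n + q • (powSucc ζ n * epsilon))
    (hspan : ∀ s t : ℤ, ∃ s' t' : ℤ,
      s • powSucc ζ n + t • (powSucc ζ n * epsilon) = s' • x + t' • y)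
    (hind : ∀ s t : ℤ, s • x + t • y = 0 → s = 0 ∧ t = 0) :
    ∃ b : Module.Basis (Fin 2) ℤ (HZ F (n + 1)), incl (n + 1) (b 0) = x ∧ incl (n + 1) (b 1) = y := by
  have hinj : Function.Injective (incl (n + 1)) := DirectSum.of_injective _
  -- The `ℤ`-module structure carried by the homology object is replaced by that of the underlying
  -- abelian group, to which `exists_basis_pair` refers.
  have e : (HZ F (n + 1)).isModule = AddCommGroup.toIntModule _ := Subsingleton.elim _ _
  rw [e]
  obtain ⟨u, v, hu, hv⟩ := h.exists_incl_powSucc n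
  have lift : ∀ x : HF, (∃ p q : ℤ, x = p • powSucc ζ n + q • (powSucc ζ n * epsilon)) →
      ∃ x' : HZ F (n + 1), incl (n + 1) x' = x := by
    rintro x ⟨p, q, rfl⟩
    exact ⟨p • u + q • v, by rw [map_add, map_zsmul, map_zsmul, hu, hv]⟩
  obtain ⟨x, rfl⟩ := lift x hx
  obtain ⟨y, rfl⟩ := lift y hy
  obtain ⟨b, h0, h1⟩ := exists_basis_pair x y (fun m => by
    obtain ⟨s, t, hst⟩ := h.exists_eq_powSucc n m
    obtain ⟨s', t', hst'⟩ := hspan s t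
    exact ⟨s', t', hinj (by rw [hst, hst', map_add, map_zsmul, map_zsmul])⟩)
    fun s t hst => hind s t (by rw [← map_zsmul, ← map_zsmul, ← map_add, hst, map_zero])
  exact ⟨b, by rw [h0], by rw [h1]⟩

theorem exists_basis_powSucc (h : IsFreeGenerator ζ) (n : ℕ) :
    ∃ b : Module.Basis (Fin 2) ℤ (HZ F (n + 1)), incl (n + 1) (b 0) = powSucc ζ n ∧
      incl (n + 1) (b 1) = powSucc ζ n * epsilon :=
  h.exists_basis_of_pair n ⟨1, 0, by simp⟩ ⟨0, 1, by simp⟩ (fun s t => ⟨s, t, rfl⟩)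
    fun _ _ => h.eq_zero_of_powSucc n

/-- A unimodular change of basis: `powSucc ζ n` is the sum of the two alternating products, and its
product with `epsilon` is the one of them that ends in `ζ * epsilon`. -/
theorem exists_basis_altProd (h : IsFreeGenerator ζ) (n : ℕ) :
    ∃ b : Module.Basis (Fin 2) ℤ (HZ F (n + 1)),
      incl (n + 1) (b 0) = altProd (ζ * epsilon) (epsilon * ζ) n ∧
        incl (n + 1) (b 1) = altProd (epsilon * ζ) (ζ * epsilon) n := by
  have he := epsilon_mul_epsilon
  have hsum : ζ = ζ * epsilon + epsilon * ζ := by rw [h.relation]; abel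
  have h1 : powSucc ζ n = altProd (ζ * epsilon) (epsilon * ζ) n +
      altProd (epsilon * ζ) (ζ * epsilon) n := by
    nth_rw 1 [hsum]
    exact powSucc_add (mul_mul_idem_of_relation he h.relation)
      (idem_mul_mul_of_relation he h.relation) n
  have h2 := altProd_mul_cases (a := ζ * epsilon) (b := epsilon * ζ) (e := epsilon)
    (by rw [mul_assoc, he]) (mul_mul_eq_zero_of_relation he h.relation) n
  have h0 : ∀ s t : ℤ, _ := fun s t => h.eq_zero_of_powSucc n (s := s) (t := t)
  have hb := h.exists_basis_of_pair n
    (x := altProd (ζ * epsilon) (epsilon * ζ) n) (y := altProd (epsilon * ζ) (ζ * epsilon) n)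
  rw [h1, add_mul] at h0 hb
  generalize altProd (ζ * epsilon) (epsilon * ζ) n = x at *
  generalize altProd (epsilon * ζ) (ζ * epsilon) n = y at *
  rcases h2 with ⟨hx, hy⟩ | ⟨hx, hy⟩
  · rw [hx, hy, add_zero] at hb h0
    refine hb ⟨0, 1, by simp⟩ ⟨1, -1, by simp⟩ (fun s t => ⟨s + t, s, by module⟩) fun s t hst => ?_
    obtain ⟨h3, h4⟩ := h0 t (s - t) (by rw [← hst]; module)
    omega
  · rw [hx, hy, zero_add] at hb h0
    refine hb ⟨1, -1, by simp⟩ ⟨0, 1, by simp⟩ (fun s t => ⟨s, s + t, by module⟩) fun s t hst => ?_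
    obtain ⟨h3, h4⟩ := h0 s (t - s) (by rw [← hst]; module)
    omega

/-- The degree zero part of an identity is `r • epsilon`, so `ζ = r • (ζ * epsilon)`, contrary to
the independence of `ζ` and `ζ * epsilon`. -/
theorem not_exists_one (h : IsFreeGenerator ζ) : ¬ ∃ u : HF, ∀ x : HF, u * x = x ∧ x * u = x := by
  rintro ⟨u, hu⟩
  obtain ⟨g, hg⟩ := h.exists_incl
  obtain ⟨r, hr⟩ := h.exists_eq_zsmul (u 0)
  have h1 := proj_succ_mul 0 g u
  rw [← hg, (hu ζ).2, hg, proj_incl_self rfl, ← hg, proj, hr] at h1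
  have h2 := h.eq_zero_of_powSucc 0 (s := 1) (t := -r) (by
    simp only [powSucc, one_smul, neg_smul]
    rw [← mul_smul_comm, ← h1, add_neg_cancel])
  exact one_ne_zero h2.1

theorem hom_ext (h : IsFreeGenerator ζ) {A : Type*} [NonUnitalRing A] {φ ψ : HF →ₙ+* A}
    (hε : φ epsilon = ψ epsilon) (hζ : φ ζ = ψ ζ) : φ = ψ := by
  refine NonUnitalRingHom.ext fun x => ?_
  induction x using h.induction with
  | h0 => rw [map_zero, map_zero]
  | hadd x y hx hy => rw [map_add, map_add, hx, hy]
  | hneg x hx => rw [map_neg, map_neg, hx]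
  | hε => exact hε
  | hζ => exact hζ
  | hmul x hx => rw [map_mul, map_mul, hx, hζ]

theorem exists_basis_zero (h : IsFreeGenerator ζ) :
    ∃ b : Module.Basis Unit ℤ (HZ F 0), b () = pointClass F := by
  have e : (HZ F 0).isModule = AddCommGroup.toIntModule _ := Subsingleton.elim _ _
  rw [e]
  refine exists_basis_single (pointClass F) (fun m => ?_) fun r hr => ?_
  · obtain ⟨r, hr⟩ := h.exists_eq_zsmul m
    rw [epsilon, ← map_zsmul] at hr
    exact ⟨r, DirectSum.of_injective 0 hr⟩
  · refine (h.eq_zero (b := 0) (s := 0) (r := r) ?_).2.1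
    rw [mul_zero, zero_smul, zero_add, zero_add, epsilon, ← map_zsmul, hr, map_zero]

theorem exists_addMonoidHom (h : IsFreeGenerator ζ) {A : Type*} [NonUnitalRing A] (e : A)
    (z : ℕ → A) : ∃ φ : HF →+ A, φ epsilon = e ∧ ∀ n, φ (powSucc ζ n) = z n ∧
      φ (powSucc ζ n * epsilon) = z n * e := by
  obtain ⟨b₀, hb₀⟩ := h.exists_basis_zero
  choose b hb hb' using h.exists_basis_powSucc
  let φ : ∀ n, HZ F n →+ A
    | 0 => (b₀.constr ℤ fun _ => e).toAddMonoidHom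
    | n + 1 => ((b n).constr ℤ ![z n, z n * e]).toAddMonoidHom
  refine ⟨DirectSum.toAddMonoid φ, ?_, fun n => ⟨?_, ?_⟩⟩
  · rw [epsilon, DirectSum.toAddMonoid_of, ← hb₀]
    exact b₀.constr_basis ℤ _ _
  · rw [← hb, DirectSum.toAddMonoid_of]
    exact (b n).constr_basis ℤ _ _
  · rw [← hb', DirectSum.toAddMonoid_of]
    exact (b n).constr_basis ℤ _ _

theorem mem_closure_powSucc (h : IsFreeGenerator ζ) (x : HF) :
    x ∈ AddSubgroup.closure
      ({epsilon} ∪ Set.range (powSucc ζ) ∪ Set.range fun n => powSucc ζ n * epsilon) := by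
  have hsub := AddSubgroup.subset_closure
    (k := {epsilon} ∪ Set.range (powSucc ζ) ∪ Set.range fun n => powSucc ζ n * epsilon)
  induction x using DirectSum.induction_on with
  | zero => exact zero_mem _
  | add x y hx hy => exact add_mem hx hy
  | of n x =>
    rcases n with _ | n
    · obtain ⟨r, hr⟩ := h.exists_eq_zsmul x
      rw [hr]
      exact AddSubgroup.zsmul_mem _ (hsub (Or.inl (Or.inl rfl))) r
    · obtain ⟨s, t, hst⟩ := h.exists_eq_powSucc n x
      rw [hst]
      exact add_mem (AddSubgroup.zsmul_mem _ (hsub (Or.inl (Or.inr ⟨n, rfl⟩))) s)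
        (AddSubgroup.zsmul_mem _ (hsub (Or.inr ⟨n, rfl⟩)) t)

/-- The additive map prescribed on the basis respects left multiplication by `ζ` by construction.
The relations then give the same for `epsilon`, and induction on the left factor gives all products.
-/
theorem existsUnique_hom (h : IsFreeGenerator ζ) {A : Type*} [NonUnitalRing A] {e z : A}
    (he : e * e = e) (hz : e * z = z - z * e) :
    ∃! φ : HF →ₙ+* A, φ epsilon = e ∧ φ ζ = z := by
  -- These are the powers of `z`, built by multiplication on the left so that `hp` holds by
  -- definition.
  let p : ℕ → A := fun n => Nat.rec z (fun _ y => z * y) n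
  have hp : ∀ n, z * p n = p (n + 1) := fun n => rfl
  obtain ⟨φ, h0, h1⟩ := h.exists_addMonoidHom e p
  have hζ : φ ζ = z := (h1 0).1
  have mulζ : ∀ x, φ (ζ * x) = z * φ x := by
    intro x
    induction h.mem_closure_powSucc x using AddSubgroup.closure_induction with
    | mem x hx =>
      rcases hx with (rfl | ⟨n, rfl⟩) | ⟨n, rfl⟩
      · rw [h0]
        exact (h1 0).2
      · rw [mul_powSucc, (h1 _).1, (h1 _).1, hp]
      · dsimp only
        rw [← mul_assoc, mul_powSucc, (h1 _).2, (h1 _).2, ← hp, mul_assoc]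
    | zero => rw [mul_zero, map_zero, mul_zero]
    | add x y _ _ hx hy => rw [mul_add, map_add, hx, hy, map_add, mul_add]
    | neg x _ hx => rw [mul_neg, map_neg, hx, map_neg, mul_neg]
  have mulε : ∀ x, φ (epsilon * x) = e * φ x := by
    intro x
    induction x using h.induction with
    | h0 => rw [mul_zero, map_zero, mul_zero]
    | hadd x y hx hy => rw [mul_add, map_add, hx, hy, map_add, mul_add]
    | hneg x hx => rw [mul_neg, map_neg, hx, map_neg, mul_neg]
    | hε => rw [epsilon_mul_epsilon, h0, he]
    | hζ => rw [h.relation, map_sub, mulζ, hζ, h0, hz]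
    | hmul x hx =>
      rw [← mul_assoc, h.relation, sub_mul, map_sub, mul_assoc, mulζ, mulζ, hx, ← mul_assoc e, hz,
        sub_mul, mul_assoc z e]
  have mul : ∀ x y, φ (x * y) = φ x * φ y := by
    intro x y
    induction x using h.induction with
    | h0 => rw [zero_mul, map_zero, zero_mul]
    | hadd x x' hx hx' => rw [add_mul, map_add, hx, hx', map_add, add_mul]
    | hneg x hx => rw [neg_mul, map_neg, hx, map_neg, neg_mul]
    | hε => rw [mulε, h0]
    | hζ => rw [mulζ, hζ]
    | hmul x hx => rw [mul_assoc, mulζ, hx, mulζ, mul_assoc]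
  exact ⟨{ φ with map_mul' := mul }, ⟨h0, hζ⟩, fun ψ hψ => h.hom_ext (hψ.1.trans h0.symm)
    (hψ.2.trans hζ.symm)⟩

end IsFreeGenerator

end Thompson

end

theorem theorem1 (ε ζ α β : HF) (hε : ε = epsilon) (hζ : ζ = x0Class ∨ ζ = -x0Class)
    (hα : α = ζ * ε) (hβ : β = ε * ζ) :
    -- `H_*(F)` is an associative ring without identity
    (∀ x y z : HF, x * y * z = x * (y * z)) ∧
    (¬ ∃ u : HF, ∀ x : HF, u * x = x ∧ x * u = x) ∧
    -- it is generated by `ε` and `ζ`, with the following defining relations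
    NonUnitalSubring.closure {ε, ζ} = (⊤ : NonUnitalSubring HF) ∧
    ε * ε = ε ∧
    ε * ζ = ζ - ζ * ε ∧
    (∀ (A : Type*) [NonUnitalRing A] (e z : A), e * e = e → e * z = z - z * e →
      ∃! φ : HF →ₙ+* A, φ ε = e ∧ φ ζ = z) ∧
    -- `ζ ^ n` and `ζ ^ n * ε` form a basis of `H_n(F)` for `n ≥ 1` (here `n` is written `n + 1`)
    (∀ n : ℕ, ∃ b : Module.Basis (Fin 2) ℤ (HZ F (n + 1)),
      incl (n + 1) (b 0) = powSucc ζ n ∧ incl (n + 1) (b 1) = powSucc ζ n * ε) ∧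
    -- it is generated by `ε`, `α` and `β`, with the following defining relations
    NonUnitalSubring.closure {ε, α, β} = (⊤ : NonUnitalSubring HF) ∧
    ε * ε = ε ∧
    ε * α = 0 ∧ β * ε = 0 ∧
    α * ε = α ∧ ε * β = β ∧
    (∀ (A : Type*) [NonUnitalRing A] (e a b : A), e * e = e → e * a = 0 → b * e = 0 →
      a * e = a → e * b = b → ∃! φ : HF →ₙ+* A, φ ε = e ∧ φ α = a ∧ φ β = b) ∧
    -- squares, and the basis of alternating products in positive degrees
    α * α = 0 ∧ β * β = 0 ∧
    (∀ n : ℕ, ∃ b : Module.Basis (Fin 2) ℤ (HZ F (n + 1)),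
      incl (n + 1) (b 0) = altProd α β n ∧ incl (n + 1) (b 1) = altProd β α n) := by
  have hg : IsFreeGenerator ζ := by
    rcases hζ with rfl | rfl
    · exact isFreeGenerator_x0Class
    · exact isFreeGenerator_x0Class.neg
  subst hε hα hβ
  have he := epsilon_mul_epsilon
  have hr := hg.relation
  have hαε : ζ * epsilon * epsilon = ζ * epsilon := by rw [HF_mul_assoc, he]
  have hεβ : epsilon * (epsilon * ζ) = epsilon * ζ := by rw [← HF_mul_assoc, he]
  have hβε : epsilon * ζ * epsilon = 0 := mul_mul_eq_zero_of_relation he hr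
  have hsum : ζ = ζ * epsilon + epsilon * ζ := by rw [hr, add_sub_cancel]
  refine ⟨HF_mul_assoc, hg.not_exists_one, hg.closure_eq_top, he, hr,
    fun A _ e z h1 h2 => hg.existsUnique_hom h1 h2, hg.exists_basis_powSucc, ?_, he,
    by rw [← HF_mul_assoc, hβε], hβε, hαε, hεβ, fun A _ e a b h1 h2 h3 h4 h5 => ?_,
    mul_mul_idem_of_relation he hr, idem_mul_mul_of_relation he hr, hg.exists_basis_altProd⟩
  · rw [eq_top_iff, ← hg.closure_eq_top, NonUnitalSubring.closure_le]
    have hsub := NonUnitalSubring.subset_closure (s := {epsilon, ζ * epsilon, epsilon * ζ})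
    rintro x (hx | hx) <;> rw [hx]
    · exact hsub (by simp)
    · have := add_mem (hsub (show ζ * epsilon ∈ _ by simp)) (hsub (show epsilon * ζ ∈ _ by simp))
      rwa [← hsum] at this
  · have ha : (a + b) * e = a := by rw [add_mul, h4, h3, add_zero]
    have hb : e * (a + b) = b := by rw [mul_add, h2, h5, zero_add]
    -- The image of `ζ = ζ * epsilon + epsilon * ζ` has to be `a + b`; conversely `a` and `b` are
    -- recovered as `(a + b) * e` and `e * (a + b)`.
    obtain ⟨φ, ⟨hφ, hφ'⟩, hu⟩ := hg.existsUnique_hom (z := a + b) h1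
      (by rw [ha, hb, add_sub_cancel_left])
    refine ⟨φ, ⟨hφ, by rw [map_mul, hφ, hφ', ha], by rw [map_mul, hφ, hφ', hb]⟩,
      fun ψ hψ => hu ψ ⟨hψ.1, ?_⟩⟩
    rw [hsum, map_add, hψ.2.1, hψ.2.2]
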